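/- All rings are commutative, noetherian and have a non-zero identity. Let $(R,\mathfrak m,k)$ be a local ring with a dualizing complex $D$, that is, a homologically bounded $R$-complex with finitely generated homology modules that is isomorphic in the derived category to a bounded complex of injective modules and for which the homothety morphism $R\to\mathbf R\mathrm{Hom}_R(D,D)$ is an isomorphism in the derived category. The Auslander class $\mathcal A(R)$ consists of the $R$-complexes $Z$ such that $Z$ and $D\otimes^{\mathbf L}_R Z$ are homologically bounded and the canonical morphism $Z\to\mathbf R\mathrm{Hom}_R(D,D\otimes^{\mathbf L}_R Z)$ is an isomorphism in the derived category. The Bass class $\mathcal B(R)$ consists of the $R$-complexes $Z$ such that $Z$ and $\mathbf R\mathrm{Hom}_R(D,Z)$ are homologically bounded and the canonical morphism $D\otimes^{\mathbf L}_R\mathbf R\mathrm{Hom}_R(D,Z)\to Z$ is an isomorphism in the derived category. Let $Q$ be a ring, let $R$ (as above) and $S$ be $Q$-algebras, and let $X$ and $Y$ be homologically bounded complexes of $(R,S)$-bimodules (that is, of $R\otimes_Q S$-modules). Let $F$ be a homologically bounded $S$-complex of finite flat dimension (isomorphic in the derived category of $S$ to a bounded complex of flat $S$-modules), and let $I$ be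 a homologically bounded $S$-complex of finite injective dimension (isomorphic in the derived category of $S$ to a bounded complex of injective $S$-modules). Regard $\mathbf R\mathrm{Hom}_S(X,I)$, $X\otimes^{\mathbf L}_S F$, $\mathbf R\mathrm{Hom}_S(Y,I)$ and $Y\otimes^{\mathbf L}_S F$ as $R$-complexes through the $R$-actions on $X$ and $Y$. Then: (i) if $X\in\mathcal A(R)$, then $\mathbf R\mathrm{Hom}_S(X,I)\in\mathcal B(R)$ and $X\otimes^{\mathbf L}_S F\in\mathcal A(R)$; (ii) if $Y\in\mathcal B(R)$, then $\mathbf R\mathrm{Hom}_S(Y,I)\in\mathcal A(R)$ and $Y\otimes^{\mathbf L}_S F\in\mathcal B(R)$. -/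

import Mathlib

open scoped TensorProduct

universe v u

namespace FoxbyClasses

open CategoryTheory Limits MonoidalCategory Opposite

noncomputable section

/-! ### Boundedness, equivalence, resolutions

Complexes are indexed cohomologically: `K.X n` is the module in homological degree `-n`. -/

section Resolutions

variable {C : Type*} [Category* C] [Abelian C]

/-- `K` is homologically bounded: its homology vanishes in almost all degrees. -/
def HomologicallyBounded (K : CochainComplex C ℤ) : Prop :=
  ∃ a b : ℤ, K.IsGE a ∧ K.IsLE b

/-- `K` is bounded: its objects vanish in almost all degrees. -/
def StrictlyBounded (K : CochainComplex C ℤ) : Prop :=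
  ∃ a b : ℤ, K.IsStrictlyGE a ∧ K.IsStrictlyLE b

attribute [local instance] HasDerivedCategory.standard in
/-- `K ≃ L`: the complexes are isomorphic in the derived category. -/
def Equivalent (K L : CochainComplex C ℤ) : Prop :=
  Nonempty (DerivedCategory.Q.obj K ≅ DerivedCategory.Q.obj L)

/-- A projective resolution of `K`: a quasi-isomorphism `P ⟶ K` from a complex of projectives that
vanishes in high cohomological (that is, low homological) degrees. -/
structure ProjRes (K : CochainComplex C ℤ) where
  /-- the resolving complex -/
  P : CochainComplex C ℤ
  /-- the augmentation -/
  π : P ⟶ K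
  quasiIso : QuasiIso π
  projective : ∀ n, Projective (P.X n)
  bounded : ∃ b : ℤ, P.IsStrictlyLE b

/-- An injective resolution of `K`: a quasi-isomorphism `K ⟶ J` to a complex of injectives that
vanishes in low cohomological (that is, high homological) degrees. -/
structure InjRes (K : CochainComplex C ℤ) where
  /-- the resolving complex -/
  J : CochainComplex C ℤ
  /-- the coaugmentation -/
  ι : K ⟶ J
  quasiIso : QuasiIso ι
  injective : ∀ n, Injective (J.X n)
  bounded : ∃ a : ℤ, J.IsStrictlyGE a

theorem nonempty_injRes [EnoughInjectives C] (K : CochainComplex C ℤ)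
    (hK : HomologicallyBounded K) : Nonempty (InjRes K) := by
  obtain ⟨a, _, ha, _⟩ := hK
  obtain ⟨L, i, hi, hL, hL'⟩ :=
    CochainComplex.Plus.modelCategoryQuillen.exists_quasiIso_injective (K.truncGE a) a
  exact ⟨⟨L, K.πTruncGE a ≫ i, inferInstance, hL, a, hL'⟩⟩

theorem quasiIso_restrictionMap_neg {K L : CochainComplex C ℤ} (f : K ⟶ L) [hf : QuasiIso f] :
    QuasiIso (HomologicalComplex.restrictionMap f ComplexShape.embeddingDownIntUpInt) where
  quasiIsoAt n := by
    have h : QuasiIsoAt f (-n) := inferInstance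
    rw [quasiIsoAt_iff' f (-n - 1) (-n) (-n + 1) (by simp) (by simp)] at h
    rw [quasiIsoAt_iff' _ (n + 1) n (n - 1) (by simp) (by simp)]
    have e₁ : - n - 1 = -(n + 1) := by lia
    have e₂ : - n + 1 = -(n - 1) := by lia
    rw [e₁, e₂] at h
    exact h

theorem exists_projective (K : CochainComplex C ℤ) [EnoughProjectives C] (b : ℤ)
    [K.IsStrictlyLE b] : ∃ (P : CochainComplex C ℤ) (π : P ⟶ K), QuasiIso π ∧
      (∀ n, Projective (P.X n)) ∧ P.IsStrictlyLE b := by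
  let E := CochainComplex.opEquivalence C
  have : (E.functor.obj (op K)).IsStrictlyGE (-b) := by
    rw [CochainComplex.isStrictlyGE_iff]
    intro i hi
    exact (K.isZero_of_isStrictlyLE b (-i) (by lia)).op
  obtain ⟨L, i, hi, hL, hL'⟩ :=
    CochainComplex.Plus.modelCategoryQuillen.exists_quasiIso_injective (E.functor.obj (op K)) (-b)
  have h₁ := quasiIso_restrictionMap_neg i
  have h₂ : QuasiIso (E.inverse.map i).unop := by
    rw [← HomologicalComplex.quasiIso_opFunctor_map_iff]
    exact h₁
  refine ⟨(E.inverse.obj L).unop, (E.inverse.map i).unop ≫ (E.unit.app (op K)).unop,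
    inferInstance, fun n ↦ ?_, ?_⟩
  · exact (inferInstance : Projective (L.X (-n)).unop)
  · rw [CochainComplex.isStrictlyLE_iff]
    intro n hn
    exact (L.isZero_of_isStrictlyGE (-b) (-n) (by lia)).unop

theorem nonempty_projRes [EnoughProjectives C] (K : CochainComplex C ℤ)
    (hK : HomologicallyBounded K) : Nonempty (ProjRes K) := by
  obtain ⟨_, b, _, hb⟩ := hK
  obtain ⟨P, π, hπ, hP, hP'⟩ := exists_projective (K.truncLE b) b
  exact ⟨⟨P, π ≫ K.ιTruncLE b, inferInstance, hP, b, hP'⟩⟩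

/-- A chosen projective resolution of a homologically bounded complex. -/
def projRes [EnoughProjectives C] (K : CochainComplex C ℤ) (hK : HomologicallyBounded K) :
    ProjRes K :=
  (nonempty_projRes K hK).some

/-- A chosen injective resolution of a homologically bounded complex. -/
def injRes [EnoughInjectives C] (K : CochainComplex C ℤ) (hK : HomologicallyBounded K) :
    InjRes K :=
  (nonempty_injRes K hK).some

end Resolutions

/-! ### Complexes over one ring -/

section OneRing

variable {R : Type u} [CommRing R]

/-- `K ∈ 𝓕(R)`: homologically bounded, and equivalent to a bounded complex of flat modules. -/
structure HasFiniteFlatDim (K : CochainComplex (ModuleCat.{u} R) ℤ) : Prop where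
  homologicallyBounded : HomologicallyBounded K
  exists_equivalent : ∃ U : CochainComplex (ModuleCat.{u} R) ℤ,
    Equivalent K U ∧ StrictlyBounded U ∧ ∀ n, Module.Flat R (U.X n)

/-- `K ∈ 𝓘(R)`: homologically bounded, and equivalent to a bounded complex of injective modules. -/
structure HasFiniteInjDim (K : CochainComplex (ModuleCat.{u} R) ℤ) : Prop where
  homologicallyBounded : HomologicallyBounded K
  exists_equivalent : ∃ U : CochainComplex (ModuleCat.{u} R) ℤ,
    Equivalent K U ∧ StrictlyBounded U ∧ ∀ n, Injective (U.X n)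

open CochainComplex.HomComplex in
/-- The complex `Hom_R(P, Z)` of `R`-modules. -/
@[simps]
def homComplex (P Z : CochainComplex (ModuleCat.{u} R) ℤ) : CochainComplex (ModuleCat.{u} R) ℤ where
  X n := ModuleCat.of R (Cochain P Z n)
  d i j := ModuleCat.ofHom (δ_hom R P Z i j)
  shape i j hij := by ext; simp [δ_shape _ _ hij]
  d_comp_d' _ _ _ _ _ := by ext; simp [δ_δ]

/-- The complex `P ⊗_R X` of `R`-modules. -/
abbrev tensorComplex (P X : CochainComplex (ModuleCat.{u} R) ℤ) :
    CochainComplex (ModuleCat.{u} R) ℤ :=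
  HomologicalComplex.tensorObj P X

theorem tensorComplex_d_tmul (P X : CochainComplex (ModuleCat.{u} R) ℤ) (i n j i' n' k : ℤ)
    (hij : i + n = j) (hi : i + 1 = i') (hn : n + 1 = n') (hik : i' + n = k) (hnk : i + n' = k)
    (p : P.X i) (x : X.X n) :
    ((tensorComplex P X).d j k).hom
        ((HomologicalComplex.ιTensorObj P X i n j hij).hom (p ⊗ₜ x)) =
      (HomologicalComplex.ιTensorObj P X i' n k hik).hom ((P.d i i').hom p ⊗ₜ x) +
        i.negOnePow •
          (HomologicalComplex.ιTensorObj P X i n' k hnk).hom (p ⊗ₜ (X.d n n').hom x) := by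
  have h : HomologicalComplex.ιTensorObj P X i n j hij ≫ (tensorComplex P X).d j k =
      ((curriedTensor (ModuleCat.{u} R)).map (P.d i i')).app (X.X n) ≫
        HomologicalComplex.ιTensorObj P X i' n k hik +
      i.negOnePow • (((curriedTensor (ModuleCat.{u} R)).obj (P.X i)).map (X.d n n') ≫
        HomologicalComplex.ιTensorObj P X i n' k hnk) := by
    rw [HomologicalComplex.mapBifunctor.d_eq, Preadditive.comp_add,
      HomologicalComplex.mapBifunctor.ι_D₁, HomologicalComplex.mapBifunctor.ι_D₂,
      HomologicalComplex.mapBifunctor.d₁_eq P X (curriedTensor (ModuleCat.{u} R)) _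
        (show (ComplexShape.up ℤ).Rel i i' from hi) n k hik,
      HomologicalComplex.mapBifunctor.d₂_eq P X (curriedTensor (ModuleCat.{u} R)) _ i
        (show (ComplexShape.up ℤ).Rel n n' from hn) k hnk]
    congr 1
    exact one_smul _ _
  exact LinearMap.congr_fun (congrArg ModuleCat.Hom.hom h) (p ⊗ₜ x)

open CochainComplex.HomComplex in
/-- For `x ∈ X^n`, the cochain `P ⟶ P ⊗_R X` of degree `n` given by `p ↦ (-1)^(in) p ⊗ x` on
`P^i`. -/
def unitCochain (P X : CochainComplex (ModuleCat.{u} R) ℤ) (n : ℤ) :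
    X.X n →ₗ[R] Cochain P (tensorComplex P X) n where
  toFun x := Cochain.mk fun i j hij ↦
    (i * n).negOnePow • ModuleCat.ofHom
      ((HomologicalComplex.ιTensorObj P X i n j hij).hom ∘ₗ
        (TensorProduct.mk R (P.X i) (X.X n)).flip x)
  map_add' x y := by
    ext i j hij p
    simp
  map_smul' r x := by
    ext i j hij p
    simp [smul_comm r]

/-- The canonical morphism `X ⟶ Hom_R(P, P ⊗_R X)`. -/
def unitHom (P X : CochainComplex (ModuleCat.{u} R) ℤ) :
    X ⟶ homComplex P (tensorComplex P X) where
  f n := ModuleCat.ofHom (unitCochain P X n)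
  comm' n m hnm := by
    obtain rfl : n + 1 = m := hnm
    refine ModuleCat.hom_ext (LinearMap.ext fun x ↦ ?_)
    change CochainComplex.HomComplex.δ n (n + 1) (unitCochain P X n x) =
      unitCochain P X (n + 1) ((X.d n (n + 1)).hom x)
    ext i j hij p
    rw [CochainComplex.HomComplex.δ_v n (n + 1) rfl _ i j hij (j - 1) (i + 1) rfl rfl]
    have h := tensorComplex_d_tmul P X i n (j - 1) (i + 1) (n + 1) j (by lia) rfl rfl (by lia)
      (by lia) p x
    have e₁ : (n + 1).negOnePow * ((i + 1) * n).negOnePow = -(i * n).negOnePow := by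
      rw [← Int.negOnePow_add, show n + 1 + (i + 1) * n = i * n + 2 * n + 1 by ring,
        Int.negOnePow_succ, Int.negOnePow_add, Int.negOnePow_two_mul, mul_one]
    have e₂ : (i * n).negOnePow * i.negOnePow = (i * (n + 1)).negOnePow := by
      rw [← Int.negOnePow_add]; congr 1; ring
    simp only [unitCochain, LinearMap.coe_mk, AddHom.coe_mk, CochainComplex.HomComplex.Cochain.mk_v,
      Linear.units_smul_comp, Linear.comp_units_smul, ModuleCat.hom_add, ModuleCat.hom_comp,
      ModuleCat.hom_smul, ModuleCat.hom_ofHom, LinearMap.add_apply, LinearMap.comp_apply,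
      LinearMap.smul_apply, LinearMap.flip_apply, TensorProduct.mk_apply]
    rw [h, smul_add, smul_smul, smul_smul, e₁, e₂, Units.neg_smul]
    abel

open CochainComplex.HomComplex in
/-- The map `(P ⊗_R Hom_R(P, Y))^j ⟶ Y^j` given by `p ⊗ f ↦ (-1)^(in) f(p)` for `p ∈ P^i` and `f` of
degree `n`, where `i + n = j`. -/
def counitMap (P Y : CochainComplex (ModuleCat.{u} R) ℤ) (j : ℤ) :
    (tensorComplex P (homComplex P Y)).X j ⟶ Y.X j :=
  HomologicalComplex.mapBifunctorDesc fun i n hij ↦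
    (i * n).negOnePow • ModuleCat.ofHom (TensorProduct.lift (LinearMap.flip
      { toFun := fun z : Cochain P Y n ↦ (z.v i j hij).hom
        map_add' := fun _ _ ↦ rfl
        map_smul' := fun _ _ ↦ rfl }))

open CochainComplex.HomComplex in
theorem counitMap_tmul (P Y : CochainComplex (ModuleCat.{u} R) ℤ) (i n j : ℤ) (hij : i + n = j)
    (p : P.X i) (z : Cochain P Y n) :
    (counitMap P Y j).hom
        ((HomologicalComplex.ιTensorObj P (homComplex P Y) i n j hij).hom (p ⊗ₜ z)) =
      (i * n).negOnePow • (z.v i j hij).hom p := by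
  have h := HomologicalComplex.ι_mapBifunctorDesc (K₁ := P) (K₂ := homComplex P Y)
    (F := curriedTensor (ModuleCat.{u} R)) (c := ComplexShape.up ℤ) (j := j) (A := Y.X j)
    (fun i n hij ↦ (i * n).negOnePow • ModuleCat.ofHom (TensorProduct.lift (LinearMap.flip
      { toFun := fun z : Cochain P Y n ↦ (z.v i j hij).hom
        map_add' := fun _ _ ↦ rfl
        map_smul' := fun _ _ ↦ rfl }))) i n hij
  exact LinearMap.congr_fun (congrArg ModuleCat.Hom.hom h) (p ⊗ₜ z)

/-- The canonical morphism `P ⊗_R Hom_R(P, Y) ⟶ Y`. -/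
def counitHom (P Y : CochainComplex (ModuleCat.{u} R) ℤ) :
    tensorComplex P (homComplex P Y) ⟶ Y where
  f j := counitMap P Y j
  comm' j k hjk := by
    obtain rfl : j + 1 = k := hjk
    refine HomologicalComplex.mapBifunctor.hom_ext fun i n hij ↦ ?_
    refine ModuleCat.hom_ext (TensorProduct.ext' fun p
      (z : CochainComplex.HomComplex.Cochain P Y n) ↦ ?_)
    replace hij : i + n = j := hij
    have h := tensorComplex_d_tmul P (homComplex P Y) i n j (i + 1) (n + 1) (j + 1) hij rfl rfl
      (by lia) (by lia) p z
    have hv := congrArg (fun f ↦ f.hom p)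
      (CochainComplex.HomComplex.δ_v n (n + 1) rfl z i (j + 1) (by lia) j (i + 1) (by lia) rfl)
    change (Y.d j (j + 1)).hom ((counitMap P Y j).hom
        ((HomologicalComplex.ιTensorObj P (homComplex P Y) i n j hij).hom (p ⊗ₜ z))) =
      (counitMap P Y (j + 1)).hom (((tensorComplex P (homComplex P Y)).d j (j + 1)).hom
        ((HomologicalComplex.ιTensorObj P (homComplex P Y) i n j hij).hom (p ⊗ₜ z)))
    have e₁ : i.negOnePow * (i * (n + 1)).negOnePow = (i * n).negOnePow := by
      rw [← Int.negOnePow_add, show i + i * (n + 1) = i * n + 2 * i by ring,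
        Int.negOnePow_add, Int.negOnePow_two_mul, mul_one]
    have e₂ : (i * n).negOnePow * (n + 1).negOnePow = -((i + 1) * n).negOnePow := by
      rw [← Int.negOnePow_add, show i * n + (n + 1) = (i + 1) * n + 1 by ring,
        Int.negOnePow_succ]
    have hd : ((homComplex P Y).d n (n + 1)).hom z =
      CochainComplex.HomComplex.δ n (n + 1) z := rfl
    rw [h, map_add, map_zsmul_unit, hd, counitMap_tmul, counitMap_tmul, counitMap_tmul,
      map_zsmul_unit, smul_smul, e₁]
    simp only [ModuleCat.hom_add, ModuleCat.hom_comp, ModuleCat.hom_smul, LinearMap.add_apply,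
      LinearMap.comp_apply, LinearMap.smul_apply] at hv
    rw [hv, smul_add, smul_smul, e₂, Units.neg_smul]
    abel

/-- The homothety morphism `R ⟶ Hom_R(P, D)`, `r ↦ r • π`, of a morphism `π : P ⟶ D`. -/
def homothety {P D : CochainComplex (ModuleCat.{u} R) ℤ} (π : P ⟶ D) :
    (HomologicalComplex.single (ModuleCat.{u} R) (ComplexShape.up ℤ) 0).obj (ModuleCat.of R R) ⟶
      homComplex P D :=
  HomologicalComplex.mkHomFromSingle
    (ModuleCat.ofHom (LinearMap.toSpanSingleton R (CochainComplex.HomComplex.Cochain P D 0)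
      (CochainComplex.HomComplex.Cochain.ofHom π)))
    (fun i _ ↦ by
      ext
      change CochainComplex.HomComplex.δ 0 i 
        ((1 : R) • CochainComplex.HomComplex.Cochain.ofHom π) = 0
      rw [one_smul, CochainComplex.HomComplex.δ_ofHom])

/-- `D` is a dualizing complex for `R`: it has finite injective dimension and finitely generated
homology modules, and the homothety morphism `R ⟶ RHom_R(D, D)` is an isomorphism in the derived
category. -/
structure IsDualizingComplex (D : CochainComplex (ModuleCat.{u} R) ℤ) : Prop where
  finiteInjDim : HasFiniteInjDim D
  finite_homology : ∀ n, Module.Finite R (D.homology n)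
  quasiIso_homothety :
    QuasiIso (homothety (projRes D finiteInjDim.homologicallyBounded).π)

section Foxby

variable (D : CochainComplex (ModuleCat.{u} R) ℤ) (hD : HomologicallyBounded D)

/-- `D ⊗ᴸ_R X`, computed by the projective resolution of `D`. -/
abbrev lTensor (X : CochainComplex (ModuleCat.{u} R) ℤ) : CochainComplex (ModuleCat.{u} R) ℤ :=
  tensorComplex (projRes D hD).P X

/-- `RHom_R(D, Y)`, computed by the projective resolution of `D`. -/
abbrev rHom (Y : CochainComplex (ModuleCat.{u} R) ℤ) : CochainComplex (ModuleCat.{u} R) ℤ :=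
  homComplex (projRes D hD).P Y

/-- The canonical morphism `X ⟶ RHom_R(D, D ⊗ᴸ_R X)`. -/
abbrev rUnit (X : CochainComplex (ModuleCat.{u} R) ℤ) : X ⟶ rHom D hD (lTensor D hD X) :=
  unitHom (projRes D hD).P X

/-- The canonical morphism `D ⊗ᴸ_R RHom_R(D, Y) ⟶ Y`. -/
abbrev rCounit (Y : CochainComplex (ModuleCat.{u} R) ℤ) : lTensor D hD (rHom D hD Y) ⟶ Y :=
  counitHom (projRes D hD).P Y

/-- The Auslander class `𝓐(R)` with respect to `D`. -/
structure AuslanderClass (X : CochainComplex (ModuleCat.{u} R) ℤ) : Prop where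
  homologicallyBounded : HomologicallyBounded X
  homologicallyBounded_lTensor : HomologicallyBounded (lTensor D hD X)
  quasiIso_rUnit : QuasiIso (rUnit D hD X)

/-- The Bass class `𝓑(R)` with respect to `D`. -/
structure BassClass (Y : CochainComplex (ModuleCat.{u} R) ℤ) : Prop where
  homologicallyBounded : HomologicallyBounded Y
  homologicallyBounded_rHom : HomologicallyBounded (rHom D hD Y)
  quasiIso_rCounit : QuasiIso (rCounit D hD Y)

end Foxby

end OneRing

/-! ### Complexes of bimodules

For `Q`-algebras `R` and `S`, an `(R, S)`-bimodule on which the two `Q`-actions agree is a module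
over `R ⊗[Q] S`. -/

section Bimodules

variable {Q : Type v} {R S : Type u} [CommRing Q] [CommRing R] [CommRing S] [Algebra Q R]
  [Algebra Q S]

variable (Q R S) in
/-- The underlying `R`-module of an `(R, S)`-bimodule. -/
abbrev toLeft : ModuleCat.{u} (R ⊗[Q] S) ⥤ ModuleCat.{u} R :=
  ModuleCat.restrictScalars (Algebra.TensorProduct.includeLeftRingHom : R →+* R ⊗[Q] S)

variable (Q R S) in
/-- The underlying `S`-module of an `(R, S)`-bimodule. -/
abbrev toRight : ModuleCat.{u} (R ⊗[Q] S) ⥤ ModuleCat.{u} S :=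
  ModuleCat.restrictScalars
    (Algebra.TensorProduct.includeRight : S →ₐ[Q] R ⊗[Q] S).toRingHom

variable (Q R S) in
/-- The underlying complex of `R`-modules of a complex of `(R, S)`-bimodules. -/
abbrev leftComplex (X : CochainComplex (ModuleCat.{u} (R ⊗[Q] S)) ℤ) :
    CochainComplex (ModuleCat.{u} R) ℤ :=
  ((toLeft Q R S).mapHomologicalComplex (ComplexShape.up ℤ)).obj X

variable (Q R S) in
/-- The underlying complex of `S`-modules of a complex of `(R, S)`-bimodules. -/
abbrev rightComplex (X : CochainComplex (ModuleCat.{u} (R ⊗[Q] S)) ℤ) :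
    CochainComplex (ModuleCat.{u} S) ℤ :=
  ((toRight Q R S).mapHomologicalComplex (ComplexShape.up ℤ)).obj X

/-- The `R`-action on the underlying `S`-module of an `(R, S)`-bimodule. -/
@[reducible]
def leftModule (M : ModuleCat.{u} (R ⊗[Q] S)) : Module R ((toRight Q R S).obj M) :=
  inferInstanceAs (Module R ((toLeft Q R S).obj M))

attribute [local instance] leftModule

theorem smulCommClass_leftModule (M : ModuleCat.{u} (R ⊗[Q] S)) :
    SMulCommClass S R ((toRight Q R S).obj M) where
  smul_comm _ _ m := smul_comm (M := R ⊗[Q] S) (N := R ⊗[Q] S) (α := M) _ _ m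

attribute [local instance] smulCommClass_leftModule

/-- The map `M ⊗_S N ⟶ M' ⊗_S N'` induced by `f` and `g`; `R` acts through `M` and `M'`. -/
def bimodTensorMap {M M' : ModuleCat.{u} (R ⊗[Q] S)} {N N' : ModuleCat.{u} S} (f : M ⟶ M')
    (g : N ⟶ N') :
    ((toRight Q R S).obj M ⊗[S] N) →ₗ[R] ((toRight Q R S).obj M' ⊗[S] N') where
  toFun := TensorProduct.map ((toRight Q R S).map f).hom g.hom
  map_add' := map_add _
  map_smul' r x := by
    induction x using TensorProduct.induction_on with
    | zero => simp only [smul_zero, map_zero]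
    | tmul m n =>
      have h : ((toRight Q R S).map f).hom (r • m) =
        r • ((toRight Q R S).map f).hom m := ((toLeft Q R S).map f).hom.map_smul r m
      simp only [TensorProduct.smul_tmul', TensorProduct.map_tmul, h, RingHom.id_apply]
    | add x y hx hy => simp only [smul_add, map_add, hx, hy]

theorem bimodTensor_hom_ext {M : ModuleCat.{u} (R ⊗[Q] S)} {N : ModuleCat.{u} S} {T : Type u}
    [AddCommGroup T] [Module R T] {h h' : ((toRight Q R S).obj M ⊗[S] N) →ₗ[R] T}
    (H : ∀ m n, h (m ⊗ₜ n) = h' (m ⊗ₜ n)) : h = h' := by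
  refine LinearMap.ext fun x ↦ ?_
  induction x using TensorProduct.induction_on with
  | zero => simp only [map_zero]
  | tmul m n => exact H m n
  | add x y hx hy => simp only [map_add, hx, hy]

/-- The bifunctor `(M, N) ↦ M ⊗_S N`, with `R` acting on `M ⊗_S N` through `M`. -/
def bimodTensor : ModuleCat.{u} (R ⊗[Q] S) ⥤ ModuleCat.{u} S ⥤ ModuleCat.{u} R where
  obj M :=
    { obj N := ModuleCat.of R ((toRight Q R S).obj M ⊗[S] N)
      map g := ModuleCat.ofHom (bimodTensorMap (𝟙 M) g)
      map_id _ := ModuleCat.hom_ext (bimodTensor_hom_ext fun _ _ ↦ rfl)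
      map_comp _ _ := ModuleCat.hom_ext (bimodTensor_hom_ext fun _ _ ↦ rfl) }
  map f :=
    { app N := ModuleCat.ofHom (bimodTensorMap f (𝟙 N))
      naturality _ _ _ := ModuleCat.hom_ext (bimodTensor_hom_ext fun _ _ ↦ rfl) }
  map_id _ := NatTrans.ext (funext fun _ ↦
    ModuleCat.hom_ext (bimodTensor_hom_ext fun _ _ ↦ rfl))
  map_comp _ _ := NatTrans.ext (funext fun _ ↦
    ModuleCat.hom_ext (bimodTensor_hom_ext fun _ _ ↦ rfl))

instance : (bimodTensor (Q := Q) (R := R) (S := S)).Additive where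
  map_add {_ _ f f'} := NatTrans.ext (funext fun _ ↦
    ModuleCat.hom_ext (bimodTensor_hom_ext fun m n ↦
      TensorProduct.add_tmul (((toRight Q R S).map f).hom m) (((toRight Q R S).map f').hom m) n))

instance (M : ModuleCat.{u} (R ⊗[Q] S)) : (bimodTensor.obj M).Additive where
  map_add {_ _ g g'} := ModuleCat.hom_ext (bimodTensor_hom_ext fun m n ↦
    TensorProduct.tmul_add m (g.hom n) (g'.hom n))

/-- The complex `X ⊗_S F` of `R`-modules, for a complex `X` of `(R, S)`-bimodules and a complex `F`
of `S`-modules. -/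
abbrev bimodTensorComplex (X : CochainComplex (ModuleCat.{u} (R ⊗[Q] S)) ℤ)
    (F : CochainComplex (ModuleCat.{u} S) ℤ) : CochainComplex (ModuleCat.{u} R) ℤ :=
  HomologicalComplex.mapBifunctor X F bimodTensor (ComplexShape.up ℤ)

section BimodHom

open CochainComplex CochainComplex.HomComplex

/-- Multiplication by `r : R` on a complex of `(R, S)`-bimodules, as an endomorphism of the
underlying complex of `S`-modules. -/
def leftMul (X : CochainComplex (ModuleCat.{u} (R ⊗[Q] S)) ℤ) (r : R) :
    rightComplex Q R S X ⟶ rightComplex Q R S X :=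
  ((toRight Q R S).mapHomologicalComplex (ComplexShape.up ℤ)).map ((r ⊗ₜ[Q] (1 : S)) • 𝟙 X)

theorem leftMul_one (X : CochainComplex (ModuleCat.{u} (R ⊗[Q] S)) ℤ) :
    leftMul X (1 : R) = 𝟙 _ := by
  simp [leftMul, ← Algebra.TensorProduct.one_def]

theorem leftMul_add (X : CochainComplex (ModuleCat.{u} (R ⊗[Q] S)) ℤ) (r r' : R) :
    leftMul X (r + r') = leftMul X r + leftMul X r' := by
  simp only [leftMul, TensorProduct.add_tmul, add_smul, Functor.map_add]

theorem leftMul_zero (X : CochainComplex (ModuleCat.{u} (R ⊗[Q] S)) ℤ) :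
    leftMul X (0 : R) = 0 := by
  simp only [leftMul, TensorProduct.zero_tmul, zero_smul, Functor.map_zero]

theorem leftMul_mul (X : CochainComplex (ModuleCat.{u} (R ⊗[Q] S)) ℤ) (r r' : R) :
    leftMul X (r * r') = leftMul X r ≫ leftMul X r' := by
  rw [mul_comm r r']
  simp only [leftMul, ← Functor.map_comp, Linear.smul_comp, Linear.comp_smul, smul_smul,
    Category.id_comp, Algebra.TensorProduct.tmul_mul_tmul, mul_one]

/-- `R` acts on `Hom_S(X, J)` through `X`: `(r • f) x = f (r • x)`. -/
@[reducible]
def bimodCochainModule (X : CochainComplex (ModuleCat.{u} (R ⊗[Q] S)) ℤ)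
    (J : CochainComplex (ModuleCat.{u} S) ℤ) (n : ℤ) :
    Module R (Cochain (rightComplex Q R S X) J n) where
  smul r z := (Cochain.ofHom (leftMul X r)).comp z (zero_add n)
  one_smul z := by
    change (Cochain.ofHom (leftMul X 1)).comp z (zero_add n) = z
    rw [leftMul_one, Cochain.id_comp]
  mul_smul r r' z := by
    change (Cochain.ofHom (leftMul X (r * r'))).comp z (zero_add n) =
      (Cochain.ofHom (leftMul X r)).comp
        ((Cochain.ofHom (leftMul X r')).comp z (zero_add n)) (zero_add n)
    rw [leftMul_mul, Cochain.ofHom_comp, Cochain.comp_assoc_of_first_is_zero_cochain]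
  smul_zero r := Cochain.comp_zero _ _
  smul_add r z z' := Cochain.comp_add _ _ _ _
  add_smul r r' z := by
    change (Cochain.ofHom (leftMul X (r + r'))).comp z (zero_add n) =
      (Cochain.ofHom (leftMul X r)).comp z (zero_add n) +
        (Cochain.ofHom (leftMul X r')).comp z (zero_add n)
    rw [leftMul_add, Cochain.ofHom_add, Cochain.add_comp]
  zero_smul z := by
    change (Cochain.ofHom (leftMul X 0)).comp z (zero_add n) = 0
    rw [leftMul_zero, Cochain.ofHom_zero, Cochain.zero_comp]

attribute [local instance] bimodCochainModule

/-- The complex `Hom_S(X, J)` of `R`-modules, for a complex `X` of `(R, S)`-bimodules and a complex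
`J` of `S`-modules. -/
def bimodHomComplex (X : CochainComplex (ModuleCat.{u} (R ⊗[Q] S)) ℤ)
    (J : CochainComplex (ModuleCat.{u} S) ℤ) : CochainComplex (ModuleCat.{u} R) ℤ where
  X n := ModuleCat.of R (Cochain (rightComplex Q R S X) J n)
  d n m := ModuleCat.ofHom
    { toFun := fun z ↦ δ n m z
      map_add' := fun z z' ↦ δ_add n m z z'
      map_smul' := fun r z ↦ δ_ofHom_comp (leftMul X r) z m }
  shape n m hnm :=
    ModuleCat.hom_ext (LinearMap.ext fun z ↦ δ_shape n m hnm z)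
  d_comp_d' n m k _ _ :=
    ModuleCat.hom_ext (LinearMap.ext fun z ↦ δ_δ n m k z)

end BimodHom

/-- `X ⊗ᴸ_S F` as a complex of `R`-modules, computed by the projective resolution of `F`. -/
abbrev bimodLTensor (X : CochainComplex (ModuleCat.{u} (R ⊗[Q] S)) ℤ)
    (F : CochainComplex (ModuleCat.{u} S) ℤ) (hF : HomologicallyBounded F) :
    CochainComplex (ModuleCat.{u} R) ℤ :=
  bimodTensorComplex X (projRes F hF).P

/-- `RHom_S(X, I)` as a complex of `R`-modules, computed by the injective resolution of `I`. -/
abbrev bimodRHom (X : CochainComplex (ModuleCat.{u} (R ⊗[Q] S)) ℤ)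
    (I : CochainComplex (ModuleCat.{u} S) ℤ) (hI : HomologicallyBounded I) :
    CochainComplex (ModuleCat.{u} R) ℤ :=
  bimodHomComplex X (injRes I hI).J

end Bimodules

end

end FoxbyClasses

namespace FoxbyClasses

open CategoryTheory Limits MonoidalCategory Opposite

noncomputable section


/-! ### Elementwise criteria -/

section Elementwise

variable {A : Type u} [CommRing A]

theorem exactAt_iff_forall_exists (K : CochainComplex (ModuleCat.{u} A) ℤ) (n : ℤ) :
    K.ExactAt n ↔ ∀ x : K.X n, (K.d n (n + 1)).hom x = 0 →
      ∃ y : K.X (n - 1), (K.d (n - 1) n).hom y = x := by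
  rw [HomologicalComplex.exactAt_iff' K (n - 1) n (n + 1) (by simp) (by simp),
    ShortComplex.moduleCat_exact_iff]
  rfl

theorem homologicallyBounded_iff {C : Type*} [Category* C] [Abelian C]
    (K : CochainComplex C ℤ) :
    HomologicallyBounded K ↔ ∃ a b : ℤ, ∀ n, (n < a ∨ b < n) → K.ExactAt n := by
  constructor
  · rintro ⟨a, b, ha, hb⟩
    refine ⟨a, b, fun n hn ↦ hn.elim (fun h ↦ ?_) fun h ↦ ?_⟩
    · exact (CochainComplex.isGE_iff K a).1 ha n h
    · exact (CochainComplex.isLE_iff K b).1 hb n h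
  · rintro ⟨a, b, h⟩
    exact ⟨a, b, (CochainComplex.isGE_iff K a).2 fun i hi ↦ h i (Or.inl hi),
      (CochainComplex.isLE_iff K b).2 fun i hi ↦ h i (Or.inr hi)⟩

theorem HomologicallyBounded.of_quasiIso {C : Type*} [Category* C] [Abelian C]
    {K L : CochainComplex C ℤ} (f : K ⟶ L) [QuasiIso f] (hK : HomologicallyBounded K) :
    HomologicallyBounded L := by
  rw [homologicallyBounded_iff] at hK ⊢
  obtain ⟨a, b, h⟩ := hK
  exact ⟨a, b, fun n hn ↦ (exactAt_iff_of_quasiIsoAt f n).1 (h n hn)⟩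

theorem HomologicallyBounded.of_quasiIso' {C : Type*} [Category* C] [Abelian C]
    {K L : CochainComplex C ℤ} (f : K ⟶ L) [QuasiIso f] (hL : HomologicallyBounded L) :
    HomologicallyBounded K := by
  rw [homologicallyBounded_iff] at hL ⊢
  obtain ⟨a, b, h⟩ := hL
  exact ⟨a, b, fun n hn ↦ (exactAt_iff_of_quasiIsoAt f n).2 (h n hn)⟩

theorem StrictlyBounded.homologicallyBounded {C : Type*} [Category* C] [Abelian C]
    {K : CochainComplex C ℤ} (hK : StrictlyBounded K) : HomologicallyBounded K := by
  obtain ⟨a, b, _, _⟩ := hK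
  exact ⟨a, b, inferInstance, inferInstance⟩

/-- The map on homology in degree `n` is surjective. -/
def SurjectiveAt {K L : CochainComplex (ModuleCat.{u} A) ℤ}
    (f : K ⟶ L) (n : ℤ) : Prop :=
  ∀ y : L.X n, (L.d n (n + 1)).hom y = 0 → ∃ (x : K.X n) (w : L.X (n - 1)),
    (K.d n (n + 1)).hom x = 0 ∧ (f.f n).hom x = y + (L.d (n - 1) n).hom w

/-- The map on homology in degree `n` is injective. -/
def InjectiveAt {K L : CochainComplex (ModuleCat.{u} A) ℤ}
    (f : K ⟶ L) (n : ℤ) : Prop :=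
  ∀ x : K.X n, (K.d n (n + 1)).hom x = 0 → (∃ y' : L.X (n - 1),
    (f.f n).hom x = (L.d (n - 1) n).hom y') → ∃ x' : K.X (n - 1), x = (K.d (n - 1) n).hom x'

theorem ShortComplex.quasiIso_iff_elementwise {S T : ShortComplex (ModuleCat.{u} A)}
    (φ : S ⟶ T) : ShortComplex.QuasiIso φ ↔
      (∀ x : S.X₂, S.g.hom x = 0 → (∃ y', φ.τ₂.hom x = T.f.hom y') → ∃ x', x = S.f.hom x') ∧
      ∀ y : T.X₂, T.g.hom y = 0 → ∃ (x : S.X₂) (y' : T.X₁),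
        S.g.hom x = 0 ∧ φ.τ₂.hom x = y + T.f.hom y' := by
  let γ : ShortComplex.LeftHomologyMapData φ S.moduleCatLeftHomologyData
    T.moduleCatLeftHomologyData := default
  let φK : LinearMap.ker S.g.hom →ₗ[A] LinearMap.ker T.g.hom := γ.φK.hom
  let φH : (LinearMap.ker S.g.hom ⧸ LinearMap.range S.moduleCatToCycles) →ₗ[A]
    (LinearMap.ker T.g.hom ⧸ LinearMap.range T.moduleCatToCycles) := γ.φH.hom
  have hi (x : LinearMap.ker S.g.hom) : (φK x).1 = φ.τ₂.hom x.1 :=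
    LinearMap.congr_fun (congrArg ModuleCat.Hom.hom γ.commi) x
  have hπ (x : LinearMap.ker S.g.hom) :
      φH ((LinearMap.range S.moduleCatToCycles).mkQ x) =
        (LinearMap.range T.moduleCatToCycles).mkQ (φK x) :=
    LinearMap.congr_fun (congrArg ModuleCat.Hom.hom γ.commπ) x
  have h0 (S : ShortComplex (ModuleCat.{u} A)) (x : LinearMap.ker S.g.hom) :
      (LinearMap.range S.moduleCatToCycles).mkQ x = 0 ↔ ∃ x', x.1 = S.f.hom x' := by
    rw [Submodule.mkQ_apply, Submodule.Quotient.mk_eq_zero, LinearMap.mem_range]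
    exact ⟨fun ⟨y, hy⟩ ↦ ⟨y, (congrArg Subtype.val hy).symm⟩,
      fun ⟨y, hy⟩ ↦ ⟨y, Subtype.ext hy.symm⟩⟩
  rw [γ.quasiIso_iff, ConcreteCategory.isIso_iff_bijective]
  change Function.Injective φH ∧ Function.Surjective φH ↔ _
  clear_value φK φH
  refine and_congr ?_ ?_
  · refine (injective_iff_map_eq_zero φH).trans ⟨fun h x hx hy ↦ ?_, fun h a ha ↦ ?_⟩
    · refine (h0 S ⟨x, LinearMap.mem_ker.2 hx⟩).1 (h _ ?_)
      rw [hπ, h0 T, hi]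
      exact hy
    · obtain ⟨x, rfl⟩ := Submodule.mkQ_surjective _ a
      rw [hπ, h0 T, hi] at ha
      exact (h0 S x).2 (h x.1 (LinearMap.mem_ker.1 x.2) ha)
  · refine ⟨fun h y hy ↦ ?_, fun h a ↦ ?_⟩
    · obtain ⟨a, ha⟩ := h ((LinearMap.range T.moduleCatToCycles).mkQ ⟨y, LinearMap.mem_ker.2 hy⟩)
      obtain ⟨x, rfl⟩ := Submodule.mkQ_surjective _ a
      rw [hπ, ← sub_eq_zero, ← map_sub, h0 T] at ha
      obtain ⟨y', hy'⟩ := ha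
      refine ⟨x.1, y', LinearMap.mem_ker.1 x.2, ?_⟩
      rw [← hi, ← hy']
      exact (add_sub_cancel _ _).symm
    · obtain ⟨y, rfl⟩ := Submodule.mkQ_surjective _ a
      obtain ⟨x, y', hx, hy'⟩ := h y.1 (LinearMap.mem_ker.1 y.2)
      refine ⟨(LinearMap.range S.moduleCatToCycles).mkQ ⟨x, LinearMap.mem_ker.2 hx⟩, ?_⟩
      rw [hπ, ← sub_eq_zero, ← map_sub, h0 T]
      refine ⟨y', ?_⟩
      rw [Submodule.coe_sub, hi, hy', add_sub_cancel_left]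

theorem quasiIsoAt_iff_elementwise {K L : CochainComplex (ModuleCat.{u} A) ℤ} (f : K ⟶ L)
    (n : ℤ) : QuasiIsoAt f n ↔ InjectiveAt f n ∧ SurjectiveAt f n := by
  rw [quasiIsoAt_iff' f (n - 1) n (n + 1) (by simp) (by simp),
    ShortComplex.quasiIso_iff_elementwise]
  rfl

theorem quasiIso_iff_elementwise {K L : CochainComplex (ModuleCat.{u} A) ℤ} (f : K ⟶ L) :
    QuasiIso f ↔ ∀ n, InjectiveAt f n ∧ SurjectiveAt f n := by
  rw [quasiIso_iff]
  exact forall_congr' fun n ↦ quasiIsoAt_iff_elementwise f n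

theorem isIso_of_bijective {K L : CochainComplex (ModuleCat.{u} A) ℤ} (f : K ⟶ L)
    (h : ∀ n, Function.Bijective (f.f n).hom) : IsIso f := by
  have (n : ℤ) : IsIso (f.f n) := (ConcreteCategory.isIso_iff_bijective _).2 (h n)
  exact HomologicalComplex.Hom.isIso_of_components f

/-- Maps that are mutually inverse up to coboundaries on cocycles are quasi-isomorphisms. -/
theorem quasiIso_of_inverse {K L : CochainComplex (ModuleCat.{u} A) ℤ} (f : K ⟶ L) (g : L ⟶ K)
    (hfg : ∀ n (x : K.X n), (K.d n (n + 1)).hom x = 0 →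
      ∃ x', (g.f n).hom ((f.f n).hom x) = x + (K.d (n - 1) n).hom x')
    (hgf : ∀ n (y : L.X n), (L.d n (n + 1)).hom y = 0 →
      ∃ y', (f.f n).hom ((g.f n).hom y) = y + (L.d (n - 1) n).hom y') : QuasiIso f := by
  have comm {K L : CochainComplex (ModuleCat.{u} A) ℤ} (g : L ⟶ K) (i j : ℤ) (y : L.X i) :
      (g.f j).hom ((L.d i j).hom y) = (K.d i j).hom ((g.f i).hom y) :=
    (LinearMap.congr_fun (congrArg ModuleCat.Hom.hom (g.comm i j)) y).symm
  rw [quasiIso_iff_elementwise]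
  refine fun n ↦ ⟨fun x hx ⟨y', hy'⟩ ↦ ?_, fun y hy ↦ ?_⟩
  · obtain ⟨x', hx'⟩ := hfg n x hx
    refine ⟨(g.f (n - 1)).hom y' - x', ?_⟩
    rw [map_sub, ← comm, ← hy', hx', add_sub_cancel_right]
  · obtain ⟨y', hy'⟩ := hgf n y hy
    exact ⟨(g.f n).hom y, y', by rw [← comm, hy, map_zero], hy'⟩

end Elementwise


/-! ### Cocycles and K-injective, K-projective complexes -/

section Cocycles

open CochainComplex CochainComplex.HomComplex

variable {C : Type*} [Category* C] [Abelian C]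

theorem toHom_mk_precomp {K L U : CochainComplex C ℤ} (f : K ⟶ L) {n : ℤ} (z : Cocycle L U n) :
    CohomologyClass.toHom (CohomologyClass.mk (z.precomp f)) =
      (HomotopyCategory.quotient C _).map f ≫ CohomologyClass.toHom (CohomologyClass.mk z) := by
  rw [CohomologyClass.toHom_mk, CohomologyClass.toHom_mk, Cocycle.equivHomShift_symm_precomp,
    Functor.map_comp]

theorem toHom_mk_postcomp {P K L : CochainComplex C ℤ} (f : K ⟶ L) {n : ℤ} (z : Cocycle P K n) :
    CohomologyClass.toHom (CohomologyClass.mk (z.postcomp f)) =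
      CohomologyClass.toHom (CohomologyClass.mk z) ≫
        (HomotopyCategory.quotient C _).map (f⟦n⟧') := by
  rw [CohomologyClass.toHom_mk, CohomologyClass.toHom_mk, Cocycle.equivHomShift_symm_postcomp,
    Functor.map_comp]

attribute [local instance] HasDerivedCategory.standard in
theorem isIso_Qh_map_quotient_map {K L : CochainComplex C ℤ} (f : K ⟶ L) [QuasiIso f] :
    IsIso (DerivedCategory.Qh.map ((HomotopyCategory.quotient C (ComplexShape.up ℤ)).map f)) := by
  have e := DerivedCategory.quotientCompQhIso C
  have : IsIso (DerivedCategory.Q.map f) := inferInstance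
  exact (NatIso.isIso_map_iff e f).2 this

attribute [local instance] HasDerivedCategory.standard in
theorem bijective_precomp_of_isKInjective {K L : CochainComplex C ℤ} (f : K ⟶ L) [QuasiIso f]
    (U : CochainComplex C ℤ) [U.IsKInjective] :
    Function.Bijective fun g : (HomotopyCategory.quotient C _).obj L ⟶
      (HomotopyCategory.quotient C _).obj U ↦ (HomotopyCategory.quotient C _).map f ≫ g := by
  have := isIso_Qh_map_quotient_map f
  constructor
  · intro g g' h
    apply (IsKInjective.Qh_map_bijective _ U).injective
    rw [← cancel_epi (DerivedCategory.Qh.map ((HomotopyCategory.quotient C _).map f)),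
      ← Functor.map_comp, ← Functor.map_comp]
    exact congrArg _ h
  · intro g
    obtain ⟨g', hg'⟩ := (IsKInjective.Qh_map_bijective _ U).surjective
      (inv (DerivedCategory.Qh.map ((HomotopyCategory.quotient C _).map f)) ≫
        DerivedCategory.Qh.map g)
    refine ⟨g', (IsKInjective.Qh_map_bijective _ U).injective ?_⟩
    simp [hg']

attribute [local instance] HasDerivedCategory.standard in
theorem bijective_postcomp_of_isKProjective (P : CochainComplex C ℤ) [P.IsKProjective]
    {K L : CochainComplex C ℤ} (f : K ⟶ L) [QuasiIso f] :
    Function.Bijective fun g : (HomotopyCategory.quotient C _).obj P ⟶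
      (HomotopyCategory.quotient C _).obj K ↦ g ≫ (HomotopyCategory.quotient C _).map f := by
  have := isIso_Qh_map_quotient_map f
  constructor
  · intro g g' h
    apply (IsKProjective.Qh_map_bijective P _).injective
    rw [← cancel_mono (DerivedCategory.Qh.map ((HomotopyCategory.quotient C _).map f)),
      ← Functor.map_comp, ← Functor.map_comp]
    exact congrArg _ h
  · intro g
    obtain ⟨g', hg'⟩ := (IsKProjective.Qh_map_bijective P _).surjective
      (DerivedCategory.Qh.map g ≫
        inv (DerivedCategory.Qh.map ((HomotopyCategory.quotient C _).map f)))
    refine ⟨g', (IsKProjective.Qh_map_bijective P _).injective ?_⟩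
    simp [hg']

theorem exists_precomp_sub_mem {K L : CochainComplex C ℤ} (f : K ⟶ L) [QuasiIso f]
    (U : CochainComplex C ℤ) [U.IsKInjective] {n : ℤ} (z : Cocycle K U n) :
    ∃ z' : Cocycle L U n, z'.precomp f - z ∈ coboundaries K U n := by
  obtain ⟨g, hg⟩ := (bijective_precomp_of_isKInjective f (U⟦n⟧)).surjective
    (CohomologyClass.toHom (CohomologyClass.mk z))
  obtain ⟨c, rfl⟩ := (CohomologyClass.toHom_bijective L U n).surjective g
  obtain ⟨z', rfl⟩ := c.mk_surjective
  refine ⟨z', ?_⟩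
  rw [← CohomologyClass.mk_eq_zero_iff, CohomologyClass.mk_sub, sub_eq_zero]
  apply (CohomologyClass.toHom_bijective K U n).injective
  rw [toHom_mk_precomp]
  exact hg

theorem mem_coboundaries_of_precomp {K L : CochainComplex C ℤ} (f : K ⟶ L) [QuasiIso f]
    (U : CochainComplex C ℤ) [U.IsKInjective] {n : ℤ} (z : Cocycle L U n)
    (hz : z.precomp f ∈ coboundaries K U n) : z ∈ coboundaries L U n := by
  rw [← CohomologyClass.toHom_mk_eq_zero_iff] at hz ⊢
  apply (bijective_precomp_of_isKInjective f (U⟦n⟧)).injective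
  rw [toHom_mk_precomp] at hz
  simpa using hz

theorem exists_postcomp_sub_mem (P : CochainComplex C ℤ) [P.IsKProjective]
    {K L : CochainComplex C ℤ} (f : K ⟶ L) [QuasiIso f] {n : ℤ} (z : Cocycle P L n) :
    ∃ z' : Cocycle P K n, z'.postcomp f - z ∈ coboundaries P L n := by
  have : QuasiIso (f⟦n⟧') := inferInstance
  obtain ⟨g, hg⟩ := (bijective_postcomp_of_isKProjective P (f⟦n⟧')).surjective
    (CohomologyClass.toHom (CohomologyClass.mk z))
  obtain ⟨c, rfl⟩ := (CohomologyClass.toHom_bijective P K n).surjective g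
  obtain ⟨z', rfl⟩ := c.mk_surjective
  refine ⟨z', ?_⟩
  rw [← CohomologyClass.mk_eq_zero_iff, CohomologyClass.mk_sub, sub_eq_zero]
  apply (CohomologyClass.toHom_bijective P L n).injective
  rw [toHom_mk_postcomp]
  exact hg

theorem mem_coboundaries_of_postcomp (P : CochainComplex C ℤ) [P.IsKProjective]
    {K L : CochainComplex C ℤ} (f : K ⟶ L) [QuasiIso f] {n : ℤ} (z : Cocycle P K n)
    (hz : z.postcomp f ∈ coboundaries P L n) : z ∈ coboundaries P K n := by
  rw [← CohomologyClass.toHom_mk_eq_zero_iff] at hz ⊢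
  apply (bijective_postcomp_of_isKProjective P (f⟦n⟧')).injective
  rw [toHom_mk_postcomp] at hz
  simpa using hz

attribute [local instance] HasDerivedCategory.standard in
/-- Equivalent K-injective complexes are homotopy equivalent. -/
theorem Equivalent.nonempty_homotopyEquiv {K L : CochainComplex C ℤ} (h : Equivalent K L)
    [K.IsKInjective] [L.IsKInjective] : Nonempty (HomotopyEquiv K L) := by
  obtain ⟨e⟩ := h
  let E := DerivedCategory.quotientCompQhIso C
  obtain ⟨a, ha⟩ := (IsKInjective.Qh_map_bijective
    ((HomotopyCategory.quotient C _).obj K) L).surjective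
    (E.hom.app K ≫ e.hom ≫ E.inv.app L)
  obtain ⟨b, hb⟩ := (IsKInjective.Qh_map_bijective
    ((HomotopyCategory.quotient C _).obj L) K).surjective
    (E.hom.app L ≫ e.inv ≫ E.inv.app K)
  refine ⟨HomotopyCategory.homotopyEquivOfIso ⟨a, b, ?_, ?_⟩⟩
  · apply (IsKInjective.Qh_map_bijective _ K).injective
    simp [ha, hb]
  · apply (IsKInjective.Qh_map_bijective _ L).injective
    simp [ha, hb]

attribute [local instance] HasDerivedCategory.standard in
/-- An equivalence out of a K-projective complex is realized by a quasi-isomorphism. -/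
theorem Equivalent.exists_quasiIso {K L : CochainComplex C ℤ} (h : Equivalent K L)
    [K.IsKProjective] : ∃ f : K ⟶ L, QuasiIso f := by
  obtain ⟨e⟩ := h
  let E := DerivedCategory.quotientCompQhIso C
  obtain ⟨a, ha⟩ := (IsKProjective.Qh_map_bijective K
    ((HomotopyCategory.quotient C _).obj L)).surjective
    (E.hom.app K ≫ e.hom ≫ E.inv.app L)
  obtain ⟨f, rfl⟩ := (HomotopyCategory.quotient C _).map_surjective a
  refine ⟨f, ?_⟩
  rw [← DerivedCategory.isIso_Q_map_iff_quasiIso, ← NatIso.isIso_map_iff E f]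
  change IsIso (DerivedCategory.Qh.map ((HomotopyCategory.quotient C _).map f))
  rw [ha]
  infer_instance

attribute [local instance] HasDerivedCategory.standard in
theorem Equivalent.of_quasiIso {K L : CochainComplex C ℤ} (f : K ⟶ L) [QuasiIso f] :
    Equivalent K L :=
  ⟨asIso (DerivedCategory.Q.map f)⟩

theorem Equivalent.symm {K L : CochainComplex C ℤ} (h : Equivalent K L) : Equivalent L K :=
  ⟨h.some.symm⟩

theorem Equivalent.trans {K L M : CochainComplex C ℤ} (h : Equivalent K L)
    (h₂ : Equivalent L M) : Equivalent K M :=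
  ⟨h.some ≪≫ h₂.some⟩

/-- A quasi-isomorphism out of a K-projective complex lifts along a quasi-isomorphism. -/
theorem exists_quasiIso_lift {P K L : CochainComplex C ℤ} [P.IsKProjective] (p : P ⟶ L)
    [QuasiIso p] (f : K ⟶ L) [QuasiIso f] : ∃ g : P ⟶ K, QuasiIso g :=
  ((Equivalent.of_quasiIso p).trans (Equivalent.of_quasiIso f).symm).exists_quasiIso

end Cocycles

/-! ### Functoriality of the complex of homomorphisms -/

section HomComplexMaps

open CochainComplex CochainComplex.HomComplex

variable {A : Type u} [CommRing A]

/-- Precomposition `Hom(L, Z) ⟶ Hom(K, Z)` with a morphism `K ⟶ L`. -/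
def homMapLeft {K L : CochainComplex (ModuleCat.{u} A) ℤ} (f : K ⟶ L)
    (Z : CochainComplex (ModuleCat.{u} A) ℤ) : homComplex L Z ⟶ homComplex K Z where
  f n := ModuleCat.ofHom
    { toFun := fun z : Cochain L Z n ↦ (Cochain.ofHom f).comp z (zero_add n)
      map_add' := fun _ _ ↦ Cochain.comp_add _ _ _ _
      map_smul' := fun _ _ ↦ Cochain.comp_smul _ _ _ _ }
  comm' _ m _ := ModuleCat.hom_ext (LinearMap.ext fun z ↦ δ_ofHom_comp f z m)

/-- Postcomposition `Hom(P, K) ⟶ Hom(P, L)` with a morphism `K ⟶ L`. -/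
def homMapRight (P : CochainComplex (ModuleCat.{u} A) ℤ)
    {K L : CochainComplex (ModuleCat.{u} A) ℤ} (f : K ⟶ L) :
    homComplex P K ⟶ homComplex P L where
  f n := ModuleCat.ofHom
    { toFun := fun z : Cochain P K n ↦ z.comp (Cochain.ofHom f) (add_zero n)
      map_add' := fun _ _ ↦ Cochain.add_comp _ _ _ _
      map_smul' := fun _ _ ↦ Cochain.smul_comp _ _ _ _ }
  comm' _ m _ := ModuleCat.hom_ext (LinearMap.ext fun z ↦ δ_comp_ofHom z f m)

theorem homMapLeft_apply {K L : CochainComplex (ModuleCat.{u} A) ℤ} (f : K ⟶ L)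
    (Z : CochainComplex (ModuleCat.{u} A) ℤ) (n : ℤ) (z : Cochain L Z n) :
    ((homMapLeft f Z).f n).hom z = (Cochain.ofHom f).comp z (zero_add n) := rfl

theorem homMapRight_apply (P : CochainComplex (ModuleCat.{u} A) ℤ)
    {K L : CochainComplex (ModuleCat.{u} A) ℤ} (f : K ⟶ L) (n : ℤ) (z : Cochain P K n) :
    ((homMapRight P f).f n).hom z = z.comp (Cochain.ofHom f) (add_zero n) := rfl

theorem homMapLeft_comp {K L M : CochainComplex (ModuleCat.{u} A) ℤ} (f : K ⟶ L) (g : L ⟶ M)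
    (Z : CochainComplex (ModuleCat.{u} A) ℤ) :
    homMapLeft (f ≫ g) Z = homMapLeft g Z ≫ homMapLeft f Z := by
  ext n (z : Cochain M Z n) : 3
  change (Cochain.ofHom (f ≫ g)).comp z (zero_add n) =
    (Cochain.ofHom f).comp ((Cochain.ofHom g).comp z (zero_add n)) (zero_add n)
  rw [Cochain.ofHom_comp, Cochain.comp_assoc_of_first_is_zero_cochain]

theorem homMapRight_comp (P : CochainComplex (ModuleCat.{u} A) ℤ)
    {K L M : CochainComplex (ModuleCat.{u} A) ℤ} (f : K ⟶ L) (g : L ⟶ M) :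
    homMapRight P (f ≫ g) = homMapRight P f ≫ homMapRight P g := by
  ext n (z : Cochain P K n) : 3
  change z.comp (Cochain.ofHom (f ≫ g)) (add_zero n) =
    (z.comp (Cochain.ofHom f) (add_zero n)).comp (Cochain.ofHom g) (add_zero n)
  rw [Cochain.ofHom_comp, Cochain.comp_assoc_of_third_is_zero_cochain]

theorem quasiIso_homMapLeft {K L : CochainComplex (ModuleCat.{u} A) ℤ} (f : K ⟶ L) [QuasiIso f]
    (U : CochainComplex (ModuleCat.{u} A) ℤ) [U.IsKInjective] : QuasiIso (homMapLeft f U) := by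
  rw [quasiIso_iff_elementwise]
  refine fun n ↦ ⟨fun (x : Cochain L U n) hx ⟨y', hy'⟩ ↦ ?_, fun (y : Cochain K U n) hy ↦ ?_⟩
  · obtain ⟨x', hx'⟩ := (mem_coboundaries_iff _ (n - 1) (by lia)).1
      (mem_coboundaries_of_precomp f U (Cocycle.mk x (n + 1) rfl hx)
        ((mem_coboundaries_iff _ (n - 1) (by lia)).2 ⟨y', hy'.symm⟩))
    exact ⟨x', hx'.symm⟩
  · obtain ⟨z', hz'⟩ := exists_precomp_sub_mem f U (Cocycle.mk y (n + 1) rfl hy)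
    obtain ⟨y', hy'⟩ := (mem_coboundaries_iff _ (n - 1) (by lia)).1 hz'
    refine ⟨z'.1, y', z'.δ_eq_zero (n + 1), ?_⟩
    change (z'.precomp f).1 = y + δ (n - 1) n y'
    rw [hy']
    exact (add_sub_cancel _ _).symm

theorem quasiIso_homMapRight (P : CochainComplex (ModuleCat.{u} A) ℤ) [P.IsKProjective]
    {K L : CochainComplex (ModuleCat.{u} A) ℤ} (f : K ⟶ L) [QuasiIso f] :
    QuasiIso (homMapRight P f) := by
  rw [quasiIso_iff_elementwise]
  refine fun n ↦ ⟨fun (x : Cochain P K n) hx ⟨y', hy'⟩ ↦ ?_, fun (y : Cochain P L n) hy ↦ ?_⟩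
  · obtain ⟨x', hx'⟩ := (mem_coboundaries_iff _ (n - 1) (by lia)).1
      (mem_coboundaries_of_postcomp P f (Cocycle.mk x (n + 1) rfl hx)
        ((mem_coboundaries_iff _ (n - 1) (by lia)).2 ⟨y', hy'.symm⟩))
    exact ⟨x', hx'.symm⟩
  · obtain ⟨z', hz'⟩ := exists_postcomp_sub_mem P f (Cocycle.mk y (n + 1) rfl hy)
    obtain ⟨y', hy'⟩ := (mem_coboundaries_iff _ (n - 1) (by lia)).1 hz'
    refine ⟨z'.1, y', z'.δ_eq_zero (n + 1), ?_⟩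
    change (z'.postcomp f).1 = y + δ (n - 1) n y'
    rw [hy']
    exact (add_sub_cancel _ _).symm

theorem exists_ofHom_comp_eq {C : Type*} [Category* C] [Preadditive C]
    {K U : CochainComplex C ℤ} {f : K ⟶ K} (h : Homotopy f (𝟙 K)) {n : ℤ}
    (z : Cochain K U n) (hz : δ n (n + 1) z = 0) :
    ∃ y : Cochain K U (n - 1), (Cochain.ofHom f).comp z (zero_add n) = z + δ (n - 1) n y := by
  refine ⟨n.negOnePow • (Cochain.ofHomotopy h).comp z (by lia), ?_⟩
  rw [δ_units_smul, δ_comp (Cochain.ofHomotopy h) z (by lia) 0 (n + 1) n (by lia) rfl rfl, hz,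
    Cochain.comp_zero, zero_add, smul_smul, ← Int.negOnePow_add, ← two_mul,
    Int.negOnePow_two_mul, one_smul, δ_ofHomotopy, Cochain.sub_comp, Cochain.id_comp,
    add_sub_cancel]

theorem exists_comp_ofHom_eq {C : Type*} [Category* C] [Preadditive C]
    {P K : CochainComplex C ℤ} {f : K ⟶ K} (h : Homotopy f (𝟙 K)) {n : ℤ}
    (z : Cochain P K n) (hz : δ n (n + 1) z = 0) :
    ∃ y : Cochain P K (n - 1), z.comp (Cochain.ofHom f) (add_zero n) = z + δ (n - 1) n y := by
  refine ⟨z.comp (Cochain.ofHomotopy h) (by lia), ?_⟩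
  rw [δ_comp z (Cochain.ofHomotopy h) (by lia) (n + 1) 0 n (by lia) rfl rfl, hz,
    Cochain.zero_comp, smul_zero, add_zero, δ_ofHomotopy, Cochain.comp_sub, Cochain.comp_id,
    add_sub_cancel]

theorem quasiIso_homMapLeft_hom {K L : CochainComplex (ModuleCat.{u} A) ℤ}
    (e : HomotopyEquiv K L) (Z : CochainComplex (ModuleCat.{u} A) ℤ) :
    QuasiIso (homMapLeft e.hom Z) := by
  refine quasiIso_of_inverse _ (homMapLeft e.inv Z) (fun n (x : Cochain L Z n) hx ↦ ?_)
    fun n (y : Cochain K Z n) hy ↦ ?_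
  · obtain ⟨y, hy⟩ := exists_ofHom_comp_eq e.homotopyInvHomId x hx
    refine ⟨y, Eq.trans ?_ hy⟩
    rw [homMapLeft_apply, homMapLeft_apply, Cochain.ofHom_comp,
      Cochain.comp_assoc_of_first_is_zero_cochain]
  · obtain ⟨y', hy'⟩ := exists_ofHom_comp_eq e.homotopyHomInvId y hy
    refine ⟨y', Eq.trans ?_ hy'⟩
    rw [homMapLeft_apply, homMapLeft_apply, Cochain.ofHom_comp,
      Cochain.comp_assoc_of_first_is_zero_cochain]

end HomComplexMaps


/-! ### Elements of tensor products of complexes -/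

section TensorElements

open CochainComplex.HomComplex

variable {A : Type u} [CommRing A]

/-- The bilinear map `P^i × X^n ⟶ (P ⊗ X)^j`, where `i + n = j`. -/
def tmul (P X : CochainComplex (ModuleCat.{u} A) ℤ) {i n j : ℤ} (h : i + n = j) :
    P.X i →ₗ[A] X.X n →ₗ[A] (tensorComplex P X).X j :=
  (TensorProduct.mk A (P.X i) (X.X n)).compr₂ (HomologicalComplex.ιTensorObj P X i n j h).hom

theorem tensorComplex_hom_ext {P X : CochainComplex (ModuleCat.{u} A) ℤ} {j : ℤ} {M : Type u}
    [AddCommGroup M] [Module A M] {f g : (tensorComplex P X).X j →ₗ[A] M}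
    (h : ∀ i n (hij : i + n = j) p x, f (tmul P X hij p x) = g (tmul P X hij p x)) : f = g := by
  have : ModuleCat.ofHom f = ModuleCat.ofHom g :=
    HomologicalComplex.mapBifunctor.hom_ext fun i n hij ↦
      ModuleCat.hom_ext (TensorProduct.ext' fun p x ↦ h i n hij p x)
  exact congrArg ModuleCat.Hom.hom this

/-- The linear map out of `(P ⊗ X)^j` given by bilinear maps. -/
def tensorLift {P X : CochainComplex (ModuleCat.{u} A) ℤ} {j : ℤ} {M : Type u}
    [AddCommGroup M] [Module A M] (φ : ∀ i n, i + n = j → P.X i →ₗ[A] X.X n →ₗ[A] M) :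
    (tensorComplex P X).X j →ₗ[A] M :=
  (HomologicalComplex.mapBifunctorDesc (K₁ := P) (K₂ := X)
    (F := curriedTensor (ModuleCat.{u} A)) (c := ComplexShape.up ℤ) (j := j)
    (A := ModuleCat.of A M)
    fun i n hij ↦ ModuleCat.ofHom (TensorProduct.lift (φ i n hij))).hom

theorem tensorLift_tmul {P X : CochainComplex (ModuleCat.{u} A) ℤ} {j : ℤ} {M : Type u}
    [AddCommGroup M] [Module A M] (φ : ∀ i n, i + n = j → P.X i →ₗ[A] X.X n →ₗ[A] M)
    {i n : ℤ} (hij : i + n = j) (p : P.X i) (x : X.X n) :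
    tensorLift φ (tmul P X hij p x) = φ i n hij p x := by
  have h := HomologicalComplex.ι_mapBifunctorDesc (K₁ := P) (K₂ := X)
    (F := curriedTensor (ModuleCat.{u} A)) (c := ComplexShape.up ℤ) (j := j)
    (A := ModuleCat.of A M)
    (fun i n hij ↦ ModuleCat.ofHom (TensorProduct.lift (φ i n hij))) i n hij
  exact LinearMap.congr_fun (congrArg ModuleCat.Hom.hom h) (p ⊗ₜ x)

theorem d_tmul {P X : CochainComplex (ModuleCat.{u} A) ℤ} {i n j i' n' k : ℤ}
    (hij : i + n = j) (hi : i + 1 = i') (hn : n + 1 = n') (hik : i' + n = k) (hnk : i + n' = k)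
    (p : P.X i) (x : X.X n) :
    ((tensorComplex P X).d j k).hom (tmul P X hij p x) =
      tmul P X hik ((P.d i i').hom p) x +
        i.negOnePow • tmul P X hnk p ((X.d n n').hom x) :=
  tensorComplex_d_tmul P X i n j i' n' k hij hi hn hik hnk p x

/-- The morphism `P ⊗ X ⟶ P' ⊗ X'` induced by `f` and `g`. -/
abbrev tensorMap {P P' X X' : CochainComplex (ModuleCat.{u} A) ℤ} (f : P ⟶ P') (g : X ⟶ X') :
    tensorComplex P X ⟶ tensorComplex P' X' :=
  HomologicalComplex.tensorHom f g

theorem tensorMap_tmul {P P' X X' : CochainComplex (ModuleCat.{u} A) ℤ} (f : P ⟶ P')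
    (g : X ⟶ X') {i n j : ℤ} (hij : i + n = j) (p : P.X i) (x : X.X n) :
    ((tensorMap f g).f j).hom (tmul P X hij p x) =
      tmul P' X' hij ((f.f i).hom p) ((g.f n).hom x) := by
  have h := HomologicalComplex.ι_mapBifunctorMap f g (curriedTensor (ModuleCat.{u} A))
    (ComplexShape.up ℤ) i n j hij
  exact LinearMap.congr_fun (congrArg ModuleCat.Hom.hom h) (p ⊗ₜ x)

theorem tensorComplex_mor_ext {P X W : CochainComplex (ModuleCat.{u} A) ℤ}
    {f g : tensorComplex P X ⟶ W}
    (h : ∀ i n j (hij : i + n = j) p x,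
      (f.f j).hom (tmul P X hij p x) = (g.f j).hom (tmul P X hij p x)) : f = g :=
  HomologicalComplex.hom_ext _ _ fun j ↦
    ModuleCat.hom_ext (tensorComplex_hom_ext fun i n hij p x ↦ h i n j hij p x)

/-- The components of an element of `Hom(P, W)`. -/
def homEval (P W : CochainComplex (ModuleCat.{u} A) ℤ) {n i j : ℤ} (h : i + n = j) :
    (homComplex P W).X n →ₗ[A] P.X i →ₗ[A] W.X j where
  toFun z := (Cochain.v z i j h).hom
  map_add' _ _ := rfl
  map_smul' _ _ := rfl

/-- The linear map to `Hom(P, W)^n` with given components. -/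
def homMk {P W : CochainComplex (ModuleCat.{u} A) ℤ} {n : ℤ} {M : Type u} [AddCommGroup M]
    [Module A M] (f : ∀ i j, i + n = j → M →ₗ[A] P.X i →ₗ[A] W.X j) :
    M →ₗ[A] (homComplex P W).X n where
  toFun m := Cochain.mk fun i j h ↦ ModuleCat.ofHom (f i j h m)
  map_add' m m' := Cochain.ext _ _ fun i j h ↦ ModuleCat.hom_ext ((f i j h).map_add m m')
  map_smul' r m := Cochain.ext _ _ fun i j h ↦ ModuleCat.hom_ext ((f i j h).map_smul r m)

@[simp]
theorem homEval_homMk {P W : CochainComplex (ModuleCat.{u} A) ℤ} {n : ℤ} {M : Type u}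
    [AddCommGroup M] [Module A M] (f : ∀ i j, i + n = j → M →ₗ[A] P.X i →ₗ[A] W.X j)
    (m : M) {i j : ℤ} (h : i + n = j) : homEval P W h (homMk f m) = f i j h m := rfl

theorem homEval_ext {P W : CochainComplex (ModuleCat.{u} A) ℤ} {n : ℤ}
    {z z' : (homComplex P W).X n}
    (h : ∀ i j (hij : i + n = j) p, homEval P W hij z p = homEval P W hij z' p) : z = z' :=
  Cochain.ext _ _ fun i j hij ↦ ModuleCat.hom_ext (LinearMap.ext fun p ↦ h i j hij p)

theorem homEval_d {P W : CochainComplex (ModuleCat.{u} A) ℤ} {n m i i' j j' : ℤ}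
    (hm : n + 1 = m) (hi : i + 1 = i') (hj : j + 1 = j') (hij : i + n = j) (hij' : i + m = j')
    (h : i' + n = j') (z : (homComplex P W).X n) (p : P.X i) :
    homEval P W hij' (((homComplex P W).d n m).hom z) p =
      (W.d j j').hom (homEval P W hij z p) +
        m.negOnePow • homEval P W h z ((P.d i i').hom p) := by
  have := δ_v n m hm z i j' hij' j i' (by lia) hi
  exact LinearMap.congr_fun (congrArg ModuleCat.Hom.hom this) p

theorem homEval_homMapLeft {K L : CochainComplex (ModuleCat.{u} A) ℤ} (f : K ⟶ L)
    (Z : CochainComplex (ModuleCat.{u} A) ℤ) {n i j : ℤ} (hij : i + n = j)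
    (z : (homComplex L Z).X n) (x : K.X i) :
    homEval K Z hij (((homMapLeft f Z).f n).hom z) x = homEval L Z hij z ((f.f i).hom x) :=
  LinearMap.congr_fun (congrArg ModuleCat.Hom.hom
    ((Cochain.zero_cochain_comp_v (Cochain.ofHom f) z i j hij).trans
      (congrArg (· ≫ Cochain.v z i j hij) (Cochain.ofHom_v f i)))) x

theorem homEval_homMapRight (P : CochainComplex (ModuleCat.{u} A) ℤ)
    {K L : CochainComplex (ModuleCat.{u} A) ℤ} (f : K ⟶ L) {n i j : ℤ} (hij : i + n = j)
    (z : (homComplex P K).X n) (p : P.X i) :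
    homEval P L hij (((homMapRight P f).f n).hom z) p = (f.f j).hom (homEval P K hij z p) :=
  LinearMap.congr_fun (congrArg ModuleCat.Hom.hom
    ((Cochain.comp_zero_cochain_v z (Cochain.ofHom f) i j hij).trans
      (congrArg (Cochain.v z i j hij ≫ ·) (Cochain.ofHom_v f j)))) p

theorem homComplex_mor_ext {K P W : CochainComplex (ModuleCat.{u} A) ℤ}
    {f g : K ⟶ homComplex P W}
    (h : ∀ n (x : K.X n) i j (hij : i + n = j) p,
      homEval P W hij ((f.f n).hom x) p = homEval P W hij ((g.f n).hom x) p) : f = g :=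
  HomologicalComplex.hom_ext _ _ fun n ↦ ModuleCat.hom_ext (LinearMap.ext fun x ↦
    homEval_ext fun i j hij p ↦ h n x i j hij p)

end TensorElements

/-! ### The adjunction between tensor product and homomorphisms -/

section Adjunction

open CochainComplex.HomComplex

variable {A : Type u} [CommRing A] {P X W : CochainComplex (ModuleCat.{u} A) ℤ}

/-- The morphism `X ⟶ Hom(P, W)` adjoint to `φ : P ⊗ X ⟶ W`. -/
def adj (φ : tensorComplex P X ⟶ W) : X ⟶ homComplex P W :=
  unitHom P X ≫ homMapRight P φ

/-- The morphism `P ⊗ X ⟶ W` adjoint to `ψ : X ⟶ Hom(P, W)`. -/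
def coadj (ψ : X ⟶ homComplex P W) : tensorComplex P X ⟶ W :=
  tensorMap (𝟙 P) ψ ≫ counitHom P W

theorem homEval_adj (φ : tensorComplex P X ⟶ W) {n i j : ℤ} (x : X.X n) (hij : i + n = j)
    (p : P.X i) :
    homEval P W hij (((adj φ).f n).hom x) p =
      (i * n).negOnePow • (φ.f j).hom (tmul P X hij p x) :=
  (homEval_homMapRight P φ hij (unitCochain P X n x) p).trans
    (map_zsmul_unit (φ.f j).hom (i * n).negOnePow (tmul P X hij p x))

theorem coadj_tmul (ψ : X ⟶ homComplex P W) {i n j : ℤ} (hij : i + n = j) (p : P.X i)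
    (x : X.X n) :
    ((coadj ψ).f j).hom (tmul P X hij p x) =
      (i * n).negOnePow • homEval P W hij ((ψ.f n).hom x) p := by
  change (counitMap P W j).hom (((tensorMap (𝟙 P) ψ).f j).hom (tmul P X hij p x)) = _
  rw [tensorMap_tmul]
  exact counitMap_tmul P W i n j hij p _

theorem adj_coadj (ψ : X ⟶ homComplex P W) : adj (coadj ψ) = ψ := by
  refine homComplex_mor_ext fun n x i j hij p ↦ ?_
  rw [homEval_adj, coadj_tmul, smul_smul, Int.units_mul_self, one_smul]

theorem coadj_adj (φ : tensorComplex P X ⟶ W) : coadj (adj φ) = φ := by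
  refine tensorComplex_mor_ext fun i n j hij p x ↦ ?_
  rw [coadj_tmul, homEval_adj, smul_smul, Int.units_mul_self, one_smul]

theorem adj_comp (φ : tensorComplex P X ⟶ W) {W' : CochainComplex (ModuleCat.{u} A) ℤ}
    (g : W ⟶ W') : adj (φ ≫ g) = adj φ ≫ homMapRight P g := by
  rw [adj, homMapRight_comp, adj, Category.assoc]

theorem adj_tensorMap_left {P' : CochainComplex (ModuleCat.{u} A) ℤ} (e : P' ⟶ P)
    (φ : tensorComplex P X ⟶ W) :
    adj (tensorMap e (𝟙 X) ≫ φ) = adj φ ≫ homMapLeft e W := by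
  refine homComplex_mor_ext fun n x i j hij p ↦ ?_
  rw [HomologicalComplex.comp_f, ModuleCat.hom_comp, LinearMap.comp_apply, homEval_homMapLeft,
    homEval_adj, homEval_adj, HomologicalComplex.comp_f, ModuleCat.hom_comp,
    LinearMap.comp_apply, tensorMap_tmul]
  rfl

theorem adj_tensorMap_right {X' : CochainComplex (ModuleCat.{u} A) ℤ} (f : X' ⟶ X)
    (φ : tensorComplex P X ⟶ W) :
    adj (tensorMap (𝟙 P) f ≫ φ) = f ≫ adj φ := by
  refine homComplex_mor_ext fun n x i j hij p ↦ ?_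
  rw [HomologicalComplex.comp_f, ModuleCat.hom_comp, LinearMap.comp_apply,
    homEval_adj, homEval_adj, HomologicalComplex.comp_f, ModuleCat.hom_comp,
    LinearMap.comp_apply, tensorMap_tmul]
  rfl

theorem coadj_comp_homMapRight {W' : CochainComplex (ModuleCat.{u} A) ℤ} (g : W ⟶ W')
    (ψ : X ⟶ homComplex P W) : coadj (ψ ≫ homMapRight P g) = coadj ψ ≫ g := by
  rw [← coadj_adj (coadj ψ ≫ g), adj_comp, adj_coadj]

theorem tensorMap_id (P X : CochainComplex (ModuleCat.{u} A) ℤ) :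
    tensorMap (𝟙 P) (𝟙 X) = 𝟙 _ := by
  refine tensorComplex_mor_ext fun i n j hij p x ↦ ?_
  rw [tensorMap_tmul]
  rfl

theorem homMapRight_id (P Z : CochainComplex (ModuleCat.{u} A) ℤ) :
    homMapRight P (𝟙 Z) = 𝟙 _ :=
  homComplex_mor_ext fun _ x _ _ hij p ↦ homEval_homMapRight P (𝟙 Z) hij x p

theorem adj_id (P X : CochainComplex (ModuleCat.{u} A) ℤ) :
    adj (𝟙 (tensorComplex P X)) = unitHom P X := by
  rw [adj, homMapRight_id, Category.comp_id]

theorem coadj_id (P Y : CochainComplex (ModuleCat.{u} A) ℤ) :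
    coadj (𝟙 (homComplex P Y)) = counitHom P Y := by
  rw [coadj, tensorMap_id, Category.id_comp]

variable (P X) in
/-- Currying `Hom(P ⊗ X, U)^n ⟶ Hom(P, Hom(X, U))^n`. -/
def curryMap (U : CochainComplex (ModuleCat.{u} A) ℤ) (n : ℤ) :
    (homComplex (tensorComplex P X) U).X n →ₗ[A] (homComplex P (homComplex X U)).X n :=
  homMk fun i j hij ↦ LinearMap.flip
    { toFun := fun p ↦ homMk fun k l hkl ↦
        (tmul P X (rfl : i + k = i + k) p).lcomp A _ ∘ₗ
          homEval (tensorComplex P X) U (show i + k + n = l by lia)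
      map_add' := fun p p' ↦ by
        refine LinearMap.ext fun z ↦ homEval_ext fun k l hkl x ↦ ?_
        simp
      map_smul' := fun r p ↦ by
        refine LinearMap.ext fun z ↦ homEval_ext fun k l hkl x ↦ ?_
        simp }

theorem homEval_curryMap (U : CochainComplex (ModuleCat.{u} A) ℤ) {n i j k l m : ℤ}
    (hij : i + n = j) (hkl : k + j = l) (hik : i + k = m) (hm : m + n = l)
    (z : (homComplex (tensorComplex P X) U).X n) (p : P.X i) (x : X.X k) :
    homEval X U hkl (homEval P (homComplex X U) hij (curryMap P X U n z) p) x =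
      homEval (tensorComplex P X) U hm z (tmul P X hik p x) := by
  subst hik
  rfl

variable (P X) in
/-- Currying `Hom(P ⊗ X, U) ⟶ Hom(P, Hom(X, U))`. -/
def curry (U : CochainComplex (ModuleCat.{u} A) ℤ) :
    homComplex (tensorComplex P X) U ⟶ homComplex P (homComplex X U) where
  f n := ModuleCat.ofHom (curryMap P X U n)
  comm' n m hnm := by
    obtain rfl : n + 1 = m := hnm
    refine ModuleCat.hom_ext (LinearMap.ext fun z ↦ ?_)
    refine homEval_ext fun i j hij p ↦ homEval_ext fun k l hkl x ↦ ?_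
    obtain rfl : j = i + n + 1 := by lia
    obtain rfl : l = i + k + n + 1 := by lia
    change homEval X U hkl (homEval P (homComplex X U) hij
        (((homComplex P (homComplex X U)).d n (n + 1)).hom (curryMap P X U n z)) p) x =
      homEval X U hkl (homEval P (homComplex X U) hij
        (curryMap P X U (n + 1) (((homComplex (tensorComplex P X) U).d n (n + 1)).hom z)) p) x
    rw [homEval_curryMap U hij hkl rfl (by lia),
      homEval_d (i' := i + k + 1) (j := i + k + n) rfl rfl rfl rfl _ (by lia),
      homEval_d (i' := i + 1) (j := i + n) rfl rfl rfl rfl _ (by lia),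
      d_tmul (i' := i + 1) (n' := k + 1) rfl rfl rfl (by lia) (by lia), map_add, map_add,
      LinearMap.add_apply,
      homEval_d (i' := k + 1) (j := i + k + n) rfl rfl rfl (by lia) _ (by lia),
      homEval_curryMap U _ _ rfl rfl, homEval_curryMap U _ _ (show i + (k + 1) = i + k + 1 by lia)
      (by lia), map_zsmul_unit, map_zsmul_unit, LinearMap.smul_apply,
      homEval_curryMap U _ _ (show i + 1 + k = i + k + 1 by lia) (by lia), smul_add, smul_smul,
      ← Int.negOnePow_add,
      show n + 1 + i = i + n + 1 by ring]
    abel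

theorem bijective_curryMap (U : CochainComplex (ModuleCat.{u} A) ℤ) (n : ℤ) :
    Function.Bijective (curryMap P X U n) := by
  refine ⟨(injective_iff_map_eq_zero _).2 fun z hz ↦ homEval_ext fun m l hml y ↦ ?_, fun w ↦ ?_⟩
  · have : homEval (tensorComplex P X) U hml z = 0 := tensorComplex_hom_ext fun i k hik p x ↦ by
      rw [← homEval_curryMap U rfl (show k + (i + n) = l by lia) hik hml, hz]
      simp
    rw [this]
    simp
  · let z : (homComplex (tensorComplex P X) U).X n := homMk (M := A) (fun m l hml ↦
      LinearMap.toSpanSingleton A _ (tensorLift fun i k hik ↦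
        homEval X U (show k + (i + n) = l by lia) ∘ₗ homEval P (homComplex X U) rfl w)) 1
    refine ⟨z, homEval_ext fun i j hij p ↦ homEval_ext fun k l hkl x ↦ ?_⟩
    subst hij
    rw [homEval_curryMap U rfl hkl rfl (by lia), homEval_homMk, LinearMap.toSpanSingleton_apply,
      one_smul, tensorLift_tmul]
    rfl

instance isIso_curry (U : CochainComplex (ModuleCat.{u} A) ℤ) : IsIso (curry P X U) :=
  isIso_of_bijective _ fun n ↦ bijective_curryMap U n

theorem curry_naturality_left {P' : CochainComplex (ModuleCat.{u} A) ℤ} (e : P' ⟶ P)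
    (U : CochainComplex (ModuleCat.{u} A) ℤ) :
    homMapLeft (tensorMap e (𝟙 X)) U ≫ curry P' X U =
      curry P X U ≫ homMapLeft e (homComplex X U) := by
  refine homComplex_mor_ext fun n z i j hij p ↦ homEval_ext fun k l hkl x ↦ ?_
  simp only [HomologicalComplex.comp_f, ModuleCat.hom_comp, LinearMap.comp_apply]
  rw [homEval_homMapLeft]
  refine (homEval_curryMap U hij hkl rfl (by lia) _ p x).trans ?_
  rw [homEval_homMapLeft, tensorMap_tmul]
  exact (homEval_curryMap U hij hkl rfl (by lia) z _ x).symm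

theorem curry_naturality_right {X' : CochainComplex (ModuleCat.{u} A) ℤ} (f : X' ⟶ X)
    (U : CochainComplex (ModuleCat.{u} A) ℤ) :
    homMapLeft (tensorMap (𝟙 P) f) U ≫ curry P X' U =
      curry P X U ≫ homMapRight P (homMapLeft f U) := by
  refine homComplex_mor_ext fun n z i j hij p ↦ homEval_ext fun k l hkl x ↦ ?_
  simp only [HomologicalComplex.comp_f, ModuleCat.hom_comp, LinearMap.comp_apply]
  rw [homEval_homMapRight, homEval_homMapLeft]
  refine (homEval_curryMap U hij hkl rfl (by lia) _ p x).trans ?_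
  rw [homEval_homMapLeft, tensorMap_tmul]
  exact (homEval_curryMap U hij hkl rfl (by lia) z p _).symm

end Adjunction


/-! ### Strict bounds -/

section StrictBounds

variable {A : Type u} [CommRing A]

theorem isZero_of_forall_eq_zero {M : ModuleCat.{u} A} (h : ∀ x : M, x = 0) : IsZero M :=
  have : Subsingleton M := ⟨fun x y ↦ (h x).trans (h y).symm⟩
  ModuleCat.isZero_of_subsingleton M

theorem eq_zero_of_isZero {M : ModuleCat.{u} A} (h : IsZero M) (x : M) : x = 0 :=
  (ModuleCat.isZero_iff_subsingleton.1 h).elim x 0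

variable {P W : CochainComplex (ModuleCat.{u} A) ℤ}

theorem isZero_homComplex_X {n : ℤ}
    (h : ∀ i j, i + n = j → IsZero (P.X i) ∨ IsZero (W.X j)) :
    IsZero ((homComplex P W).X n) :=
  isZero_of_forall_eq_zero fun z ↦ homEval_ext fun i j hij p ↦ by
    obtain h | h := h i j hij
    · rw [eq_zero_of_isZero h p, map_zero, map_zero]
    · rw [eq_zero_of_isZero h (homEval P W hij z p), map_zero, LinearMap.zero_apply]

theorem isStrictlyGE_homComplex (a b : ℤ) [P.IsStrictlyLE b] [W.IsStrictlyGE a] :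
    (homComplex P W).IsStrictlyGE (a - b) := by
  rw [CochainComplex.isStrictlyGE_iff]
  refine fun n hn ↦ isZero_homComplex_X fun i j hij ↦ ?_
  by_cases hi : b < i
  · exact Or.inl (P.isZero_of_isStrictlyLE b i hi)
  · exact Or.inr (W.isZero_of_isStrictlyGE a j (by lia))

theorem isStrictlyLE_homComplex (a b : ℤ) [P.IsStrictlyGE a] [W.IsStrictlyLE b] :
    (homComplex P W).IsStrictlyLE (b - a) := by
  rw [CochainComplex.isStrictlyLE_iff]
  refine fun n hn ↦ isZero_homComplex_X fun i j hij ↦ ?_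
  by_cases hi : i < a
  · exact Or.inl (P.isZero_of_isStrictlyGE a i hi)
  · exact Or.inr (W.isZero_of_isStrictlyLE b j (by lia))

theorem StrictlyBounded.homComplex (hP : StrictlyBounded P) (hW : StrictlyBounded W) :
    StrictlyBounded (homComplex P W) := by
  obtain ⟨a, b, _, _⟩ := hP
  obtain ⟨c, d, _, _⟩ := hW
  exact ⟨c - b, d - a, isStrictlyGE_homComplex c b, isStrictlyLE_homComplex a d⟩

theorem isStrictlyLE_tensorComplex (a b : ℤ) [P.IsStrictlyLE a] [W.IsStrictlyLE b] :
    (tensorComplex P W).IsStrictlyLE (a + b) := by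
  rw [CochainComplex.isStrictlyLE_iff]
  refine fun n hn ↦ isZero_of_forall_eq_zero fun x ↦ ?_
  refine LinearMap.congr_fun (f := LinearMap.id) (g := 0)
    (tensorComplex_hom_ext fun i j hij p w ↦ ?_) x
  rw [LinearMap.id_apply, LinearMap.zero_apply]
  by_cases hi : a < i
  · rw [eq_zero_of_isZero (P.isZero_of_isStrictlyLE a i hi) p, map_zero, LinearMap.zero_apply]
  · rw [eq_zero_of_isZero (W.isZero_of_isStrictlyLE b j (by lia)) w, map_zero]

end StrictBounds

/-! ### Duality with respect to the character module of the ring -/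

section Characters

open CochainComplex.HomComplex

variable {A : Type u} [CommRing A]

theorem exists_character_of_notMem {M : Type u} [AddCommGroup M] [Module A M]
    (N : Submodule A M) {x : M} (hx : x ∉ N) :
    ∃ χ : CharacterModule M, (∀ y ∈ N, χ y = 0) ∧ χ x ≠ 0 := by
  obtain ⟨c, hc⟩ := CharacterModule.exists_character_apply_ne_zero_of_ne_zero
    (a := N.mkQ x) (by simpa using hx)
  refine ⟨CharacterModule.dual N.mkQ c, fun y hy ↦ ?_, hc⟩
  change c (N.mkQ y) = 0
  rw [Submodule.mkQ_apply, (Submodule.Quotient.mk_eq_zero N).2 hy, map_zero]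

theorem exists_character_comp_eq {M N : Type u} [AddCommGroup M] [Module A M] [AddCommGroup N]
    [Module A N] (f : M →ₗ[A] N) (χ : CharacterModule M) (h : ∀ x, f x = 0 → χ x = 0) :
    ∃ η : CharacterModule N, ∀ x, η (f x) = χ x := by
  let χ' : CharacterModule (M ⧸ LinearMap.ker f) :=
    QuotientAddGroup.lift (LinearMap.ker f).toAddSubgroup χ fun x hx ↦ h x hx
  obtain ⟨η, hη⟩ := CharacterModule.dual_surjective_of_injective
    ((LinearMap.ker f).liftQ f le_rfl)
    (LinearMap.ker_eq_bot.1 (Submodule.ker_liftQ_eq_bot _ _ _ le_rfl)) χ'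
  exact ⟨η, fun x ↦ congrArg (fun c : CharacterModule (M ⧸ LinearMap.ker f) ↦
    c ((LinearMap.ker f).mkQ x)) hη⟩

variable (A) in
/-- The character module of `A`, as a complex concentrated in degree `0`. -/
def charComplex : CochainComplex (ModuleCat.{u} A) ℤ :=
  (HomologicalComplex.single (ModuleCat.{u} A) (ComplexShape.up ℤ) 0).obj
    (ModuleCat.of A (CharacterModule A))

instance : (charComplex A).IsStrictlyGE 0 :=
  inferInstanceAs (CochainComplex.IsStrictlyGE
    ((HomologicalComplex.single (ModuleCat.{u} A) (ComplexShape.up ℤ) 0).obj _) 0)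

instance : (charComplex A).IsStrictlyLE 0 :=
  inferInstanceAs (CochainComplex.IsStrictlyLE
    ((HomologicalComplex.single (ModuleCat.{u} A) (ComplexShape.up ℤ) 0).obj _) 0)

variable (A) in
theorem strictlyBounded_charComplex : StrictlyBounded (charComplex A) :=
  ⟨0, 0, inferInstance, inferInstance⟩

variable (A) in
theorem charComplex_d (i j : ℤ) : (charComplex A).d i j = 0 :=
  HomologicalComplex.single_obj_d _ _ _ _ _

variable (A) in
/-- The module in degree `0` of `charComplex A`. -/
def charEquiv : (charComplex A).X 0 ≃ₗ[A] CharacterModule A :=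
  (HomologicalComplex.singleObjXSelf (ComplexShape.up ℤ) 0
    (ModuleCat.of A (CharacterModule A))).toLinearEquiv

theorem injective_of_flat (M : Type u) [AddCommGroup M] [Module A M] [Module.Flat A M] :
    Injective (ModuleCat.of A (CharacterModule M)) :=
  (Module.injective_iff_injective_object A (CharacterModule M)).1
    (Module.Flat.iff_characterModule_injective.1 inferInstance)

variable (A) in
theorem isZero_charComplex_X {n : ℤ} (hn : n ≠ 0) : IsZero ((charComplex A).X n) :=
  HomologicalComplex.isZero_single_obj_X _ _ _ _ hn

instance (n : ℤ) : Injective ((charComplex A).X n) := by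
  by_cases hn : n = 0
  · subst hn
    have := injective_of_flat (A := A) A
    exact Injective.of_iso (charEquiv A).toModuleIso.symm this
  · exact (isZero_charComplex_X A hn).injective

instance : (charComplex A).IsKInjective := CochainComplex.isKInjective_of_injective _ 0

/-- The character of `K^i` given by an element of `Hom(K, charComplex A)^n`, where `i + n = 0`. -/
def charOf (K : CochainComplex (ModuleCat.{u} A) ℤ) {n i : ℤ} (h : i + n = 0) :
    (homComplex K (charComplex A)).X n →ₗ[A] CharacterModule (K.X i) where
  toFun z :=
    { toFun := fun x ↦ charEquiv A (homEval K (charComplex A) h z x) 1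
      map_zero' := by rw [map_zero, map_zero]; rfl
      map_add' := fun x y ↦ by rw [map_add, map_add]; rfl }
  map_add' z z' := CharacterModule.ext _ fun x ↦ by
    change charEquiv A (homEval K (charComplex A) h (z + z') x) 1 = _
    rw [map_add, LinearMap.add_apply, map_add]
    rfl
  map_smul' r z := CharacterModule.ext _ fun x ↦ by
    change charEquiv A (homEval K (charComplex A) h (r • z) x) 1 =
      charEquiv A (homEval K (charComplex A) h z (r • x)) 1
    rw [map_smul, map_smul, LinearMap.smul_apply]

theorem charOf_apply (K : CochainComplex (ModuleCat.{u} A) ℤ) {n i : ℤ} (h : i + n = 0)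
    (z : (homComplex K (charComplex A)).X n) (x : K.X i) :
    charOf K h z x = charEquiv A (homEval K (charComplex A) h z x) 1 := rfl

theorem charEquiv_apply (c : (charComplex A).X 0) (r : A) :
    charEquiv A c r = charEquiv A (r • c) 1 := by
  rw [map_smul, CharacterModule.smul_apply, smul_eq_mul, mul_one]

/-- The linear map `M ⟶ CharacterModule A` given by a character of `M`. -/
def homOfCharacter {M : Type u} [AddCommGroup M] [Module A M] (χ : CharacterModule M) :
    M →ₗ[A] CharacterModule A where
  toFun x := CharacterModule.dual (LinearMap.toSpanSingleton A M x) χ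
  map_add' x y := CharacterModule.ext _ fun r ↦ by
    change χ (r • (x + y)) = χ (r • x) + χ (r • y)
    rw [smul_add, map_add]
  map_smul' s x := CharacterModule.ext _ fun r ↦ by
    change χ (r • s • x) = χ ((s * r) • x)
    rw [smul_smul, mul_comm]

theorem homOfCharacter_apply {M : Type u} [AddCommGroup M] [Module A M] (χ : CharacterModule M)
    (x : M) (r : A) : homOfCharacter χ x r = χ (r • x) := rfl

theorem bijective_charOf (K : CochainComplex (ModuleCat.{u} A) ℤ) {n i : ℤ} (h : i + n = 0) :
    Function.Bijective (charOf K h) := by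
  refine ⟨(injective_iff_map_eq_zero _).2 fun z hz ↦ homEval_ext fun k l hkl x ↦ ?_, fun χ ↦ ?_⟩
  · rw [map_zero, LinearMap.zero_apply]
    by_cases hl : l = 0
    · subst hl
      obtain rfl : k = i := by lia
      refine (charEquiv A).map_eq_zero_iff.1 (CharacterModule.ext _ fun r ↦ ?_)
      rw [charEquiv_apply, ← map_smul, ← charOf_apply, hz]
      rfl
    · exact eq_zero_of_isZero (isZero_charComplex_X A hl) _
  · refine ⟨Cochain.single (ModuleCat.ofHom ((charEquiv A).symm.toLinearMap ∘ₗ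
      homOfCharacter χ)) n, CharacterModule.ext _ fun x ↦ ?_⟩
    have := congrArg (fun f ↦ f.hom x) (Cochain.single_v (K := K) (L := charComplex A)
      (ModuleCat.ofHom ((charEquiv A).symm.toLinearMap ∘ₗ homOfCharacter χ)) n h)
    refine (congrArg (fun c ↦ charEquiv A c 1) this).trans ?_
    change charEquiv A ((charEquiv A).symm (homOfCharacter χ x)) 1 = _
    rw [LinearEquiv.apply_symm_apply, homOfCharacter_apply, one_smul]

theorem charOf_d (K : CochainComplex (ModuleCat.{u} A) ℤ) {n m i i' : ℤ} (hm : n + 1 = m)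
    (hi : i + 1 = i') (h : i' + n = 0) (h' : i + m = 0)
    (z : (homComplex K (charComplex A)).X n) (x : K.X i) :
    charOf K h' (((homComplex K (charComplex A)).d n m).hom z) x =
      m.negOnePow • charOf K h z ((K.d i i').hom x) := by
  rw [charOf_apply, homEval_d (j := -1) hm hi (by lia) (by lia) h' h, charComplex_d,
    charOf_apply, ModuleCat.hom_zero, LinearMap.zero_apply, zero_add, map_zsmul_unit]
  rfl

theorem charOf_homMapLeft {K L : CochainComplex (ModuleCat.{u} A) ℤ} (f : K ⟶ L) {n i : ℤ}
    (h : i + n = 0) (z : (homComplex L (charComplex A)).X n) (x : K.X i) :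
    charOf K h (((homMapLeft f (charComplex A)).f n).hom z) x = charOf L h z ((f.f i).hom x) := by
  rw [charOf_apply, charOf_apply, homEval_homMapLeft]

theorem d_eq_zero_of_charOf (K : CochainComplex (ModuleCat.{u} A) ℤ) {n i : ℤ} (h : i + n = 0)
    (z : (homComplex K (charComplex A)).X n)
    (hz : ∀ y : K.X (i - 1), charOf K h z ((K.d (i - 1) i).hom y) = 0) :
    ((homComplex K (charComplex A)).d n (n + 1)).hom z = 0 := by
  have h' : i - 1 + (n + 1) = 0 := by lia
  refine (injective_iff_map_eq_zero (charOf K h')).1 (bijective_charOf K h').1 _ ?_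
  refine CharacterModule.ext _ fun y ↦ ?_
  rw [charOf_d K rfl (by lia) h h', hz, smul_zero]
  rfl

theorem charOf_d_apply_eq_zero (K : CochainComplex (ModuleCat.{u} A) ℤ) {n i : ℤ}
    (h : i + n = 0) (w : (homComplex K (charComplex A)).X (n - 1)) (x : K.X i)
    (hx : (K.d i (i + 1)).hom x = 0) :
    charOf K h (((homComplex K (charComplex A)).d (n - 1) n).hom w) x = 0 := by
  rw [charOf_d K (by lia) rfl (by lia) h, hx, map_zero, smul_zero]

theorem exactAt_of_exactAt_homComplex_charComplex {K : CochainComplex (ModuleCat.{u} A) ℤ}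
    {n i : ℤ} (h : i + n = 0) (hK : (homComplex K (charComplex A)).ExactAt n) : K.ExactAt i := by
  rw [exactAt_iff_forall_exists] at hK ⊢
  intro x hx
  by_contra hx'
  obtain ⟨χ, hχ, hχx⟩ := exists_character_of_notMem (LinearMap.range (K.d (i - 1) i).hom) hx'
  obtain ⟨z, rfl⟩ := (bijective_charOf K h).2 χ
  obtain ⟨w, rfl⟩ := hK z (d_eq_zero_of_charOf K h z fun y ↦ hχ _ ⟨y, rfl⟩)
  exact hχx (charOf_d_apply_eq_zero K h w x hx)

theorem HomologicallyBounded.of_homComplex_charComplex {K : CochainComplex (ModuleCat.{u} A) ℤ}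
    (hK : HomologicallyBounded (homComplex K (charComplex A))) : HomologicallyBounded K := by
  rw [homologicallyBounded_iff] at hK ⊢
  obtain ⟨a, b, h⟩ := hK
  exact ⟨-b, -a, fun n hn ↦ exactAt_of_exactAt_homComplex_charComplex (n := -n) (by lia)
    (h (-n) (by lia))⟩

theorem quasiIso_of_quasiIso_homMapLeft {K L : CochainComplex (ModuleCat.{u} A) ℤ} (f : K ⟶ L)
    (hf : QuasiIso (homMapLeft f (charComplex A))) : QuasiIso f := by
  rw [quasiIso_iff_elementwise] at hf ⊢
  intro i
  have h : i + -i = 0 := by lia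
  obtain ⟨hinj, hsurj⟩ := hf (-i)
  refine ⟨fun x hx ⟨y', hy'⟩ ↦ ?_, fun y hy ↦ ?_⟩
  · by_contra hx'
    obtain ⟨χ, hχ, hχx⟩ := exists_character_of_notMem (LinearMap.range (K.d (i - 1) i).hom)
      (x := x) fun ⟨x', h⟩ ↦ hx' ⟨x', h.symm⟩
    obtain ⟨z, rfl⟩ := (bijective_charOf K h).2 χ
    obtain ⟨w, t, hw, ht⟩ := hsurj z (d_eq_zero_of_charOf K h z fun y ↦ hχ _ ⟨y, rfl⟩)
    have e := congrArg (fun c ↦ charOf K h c x) ht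
    rw [charOf_homMapLeft, hy', map_add] at e
    refine hχx ?_
    have e₁ := charOf_d L (i := i - 1) rfl (by lia) h (by lia) w y'
    rw [hw, map_zero] at e₁
    have e₂ : charOf L h w ((L.d (i - 1) i).hom y') = 0 := by
      rw [← smul_eq_zero_iff_eq (-i + 1).negOnePow, ← e₁]
      rfl
    rw [e₂] at e
    have e₃ := charOf_d_apply_eq_zero K h t x hx
    change 0 = charOf K h z x + charOf K h _ x at e
    rw [e₃, add_zero] at e
    exact e.symm
  · by_contra hy'
    let N : Submodule A (L.X i) := LinearMap.range (L.d (i - 1) i).hom ⊔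
      (LinearMap.ker (K.d i (i + 1)).hom).map (f.f i).hom
    have hyN : y ∉ N := by
      intro hyN
      obtain ⟨_, ⟨t, rfl⟩, _, ⟨x, hx, rfl⟩, e⟩ := Submodule.mem_sup.1 hyN
      refine hy' ⟨x, -t, hx, ?_⟩
      rw [← e, map_neg]
      abel
    obtain ⟨χ, hχ, hχy⟩ := exists_character_of_notMem N hyN
    obtain ⟨z, rfl⟩ := (bijective_charOf L h).2 χ
    have hz := d_eq_zero_of_charOf L h z fun t ↦
      hχ _ (Submodule.mem_sup_left ⟨t, rfl⟩)
    obtain ⟨η, hη⟩ := exists_character_comp_eq (K.d i (i + 1)).hom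
      (charOf K h (((homMapLeft f (charComplex A)).f (-i)).hom z)) fun x hx ↦ by
        rw [charOf_homMapLeft]
        exact hχ _ (Submodule.mem_sup_right ⟨x, hx, rfl⟩)
    have h' : i + 1 + (-i - 1) = 0 := by lia
    obtain ⟨w, hw⟩ := (bijective_charOf K h').2 ((-i).negOnePow • η)
    obtain ⟨w', rfl⟩ := hinj z hz ⟨w, (bijective_charOf K h).1 (CharacterModule.ext _ fun x ↦ by
      rw [← hη]
      rw [charOf_d K (by lia) rfl h' h, hw]
      change _ = (-i).negOnePow • (-i).negOnePow • η _
      rw [smul_smul, Int.units_mul_self, one_smul])⟩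
    exact hχy (charOf_d_apply_eq_zero L h w' y hy)

theorem injective_homComplex_charComplex (V : CochainComplex (ModuleCat.{u} A) ℤ)
    (hV : ∀ n, Module.Flat A (V.X n)) (n : ℤ) :
    Injective ((homComplex V (charComplex A)).X n) := by
  have := injective_of_flat (A := A) (V.X (-n))
  exact Injective.of_iso (LinearEquiv.ofBijective _
    (bijective_charOf V (neg_add_cancel n))).toModuleIso.symm this

end Characters


/-! ### Tensor products and quasi-isomorphisms -/

section TensorQuasiIso

variable {A : Type u} [CommRing A]

theorem quasiIso_tensorMap_right (P : CochainComplex (ModuleCat.{u} A) ℤ) [P.IsKProjective]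
    {X X' : CochainComplex (ModuleCat.{u} A) ℤ} (f : X ⟶ X') [QuasiIso f] :
    QuasiIso (tensorMap (𝟙 P) f) := by
  refine quasiIso_of_quasiIso_homMapLeft _ ?_
  have := quasiIso_homMapLeft f (charComplex A)
  have := quasiIso_homMapRight P (homMapLeft f (charComplex A))
  rw [← quasiIso_iff_comp_right _ (curry P X (charComplex A)), curry_naturality_right]
  infer_instance

theorem quasiIso_tensorMap_left {P P' : CochainComplex (ModuleCat.{u} A) ℤ}
    (e : HomotopyEquiv P' P) (X : CochainComplex (ModuleCat.{u} A) ℤ) :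
    QuasiIso (tensorMap e.hom (𝟙 X)) := by
  refine quasiIso_of_quasiIso_homMapLeft _ ?_
  have := quasiIso_homMapLeft_hom e (homComplex X (charComplex A))
  rw [← quasiIso_iff_comp_right _ (curry P' X (charComplex A)), curry_naturality_left]
  infer_instance

end TensorQuasiIso

/-! ### Foxby equivalence with respect to a complex `P` -/

section FoxbyPairs

variable {A : Type u} [CommRing A]

/-- The conditions defining the Auslander class, with respect to an arbitrary complex `P`. -/
structure AuslanderFor (P X : CochainComplex (ModuleCat.{u} A) ℤ) : Prop where
  homologicallyBounded : HomologicallyBounded X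
  homologicallyBounded_tensor : HomologicallyBounded (tensorComplex P X)
  quasiIso_unit : QuasiIso (unitHom P X)

/-- The conditions defining the Bass class, with respect to an arbitrary complex `P`. -/
structure BassFor (P Y : CochainComplex (ModuleCat.{u} A) ℤ) : Prop where
  homologicallyBounded : HomologicallyBounded Y
  homologicallyBounded_hom : HomologicallyBounded (homComplex P Y)
  quasiIso_counit : QuasiIso (counitHom P Y)

/-- `X` and `W` correspond to each other under Foxby equivalence with respect to `P`. -/
structure FoxbyPair (P X W : CochainComplex (ModuleCat.{u} A) ℤ) : Prop where
  left : HomologicallyBounded X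
  right : HomologicallyBounded W
  exists_quasiIso : ∃ φ : tensorComplex P X ⟶ W, QuasiIso φ ∧ QuasiIso (adj φ)

variable {P X W Y : CochainComplex (ModuleCat.{u} A) ℤ}

theorem AuslanderFor.foxbyPair (h : AuslanderFor P X) : FoxbyPair P X (tensorComplex P X) :=
  ⟨h.1, h.2, 𝟙 _, inferInstance, by rw [adj_id]; exact h.3⟩

theorem BassFor.foxbyPair (h : BassFor P Y) : FoxbyPair P (homComplex P Y) Y :=
  ⟨h.2, h.1, counitHom P Y, h.3, by rw [← coadj_id, adj_coadj]; infer_instance⟩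

theorem FoxbyPair.auslanderFor [P.IsKProjective] (h : FoxbyPair P X W) : AuslanderFor P X := by
  obtain ⟨hX, hW, φ, hφ, hφ'⟩ := h
  refine ⟨hX, hW.of_quasiIso' φ, ?_⟩
  have := quasiIso_homMapRight P φ
  exact (quasiIso_iff_comp_right (unitHom P X) (homMapRight P φ)).1 hφ'

theorem FoxbyPair.bassFor [P.IsKProjective] (h : FoxbyPair P X W) : BassFor P W := by
  obtain ⟨hX, hW, φ, hφ, hφ'⟩ := h
  refine ⟨hW, hX.of_quasiIso (adj φ), ?_⟩
  have := quasiIso_tensorMap_right P (adj φ)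
  refine (quasiIso_iff_comp_left (tensorMap (𝟙 P) (adj φ)) (counitHom P W)).1 ?_
  change QuasiIso (coadj (adj φ))
  rwa [coadj_adj]

theorem FoxbyPair.of_homotopyEquiv {P' : CochainComplex (ModuleCat.{u} A) ℤ}
    (e : HomotopyEquiv P' P) (h : FoxbyPair P X W) : FoxbyPair P' X W := by
  obtain ⟨hX, hW, φ, hφ, hφ'⟩ := h
  have := quasiIso_tensorMap_left e X
  have := quasiIso_homMapLeft_hom e W
  refine ⟨hX, hW, tensorMap e.hom (𝟙 X) ≫ φ, inferInstance, ?_⟩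
  rw [adj_tensorMap_left]
  infer_instance

theorem unitHom_naturality (P : CochainComplex (ModuleCat.{u} A) ℤ) (f : X ⟶ Y) :
    unitHom P X ≫ homMapRight P (tensorMap (𝟙 P) f) = f ≫ unitHom P Y := by
  rw [← adj_id P Y, ← adj_tensorMap_right, Category.comp_id]
  rfl

theorem counitHom_naturality (P : CochainComplex (ModuleCat.{u} A) ℤ) (f : X ⟶ Y) :
    tensorMap (𝟙 P) (homMapRight P f) ≫ counitHom P Y = counitHom P X ≫ f := by
  rw [← coadj_id P X, ← coadj_comp_homMapRight, Category.id_comp]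
  rfl

theorem auslanderFor_iff_of_quasiIso [P.IsKProjective] (f : X ⟶ Y) [QuasiIso f] :
    AuslanderFor P X ↔ AuslanderFor P Y := by
  have := quasiIso_tensorMap_right P f
  have := quasiIso_homMapRight P (tensorMap (𝟙 P) f)
  have key : QuasiIso (unitHom P X) ↔ QuasiIso (unitHom P Y) := by
    rw [← quasiIso_iff_comp_right (unitHom P X) (homMapRight P (tensorMap (𝟙 P) f)),
      unitHom_naturality, quasiIso_iff_comp_left]
  exact ⟨fun h ↦ ⟨h.1.of_quasiIso f, h.2.of_quasiIso (tensorMap (𝟙 P) f), key.1 h.3⟩,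
    fun h ↦ ⟨h.1.of_quasiIso' f, h.2.of_quasiIso' (tensorMap (𝟙 P) f), key.2 h.3⟩⟩

theorem bassFor_iff_of_quasiIso [P.IsKProjective] (f : X ⟶ Y) [QuasiIso f] :
    BassFor P X ↔ BassFor P Y := by
  have := quasiIso_homMapRight P f
  have := quasiIso_tensorMap_right P (homMapRight P f)
  have key : QuasiIso (counitHom P X) ↔ QuasiIso (counitHom P Y) := by
    rw [← quasiIso_iff_comp_right (counitHom P X) f, ← counitHom_naturality,
      quasiIso_iff_comp_left]
  exact ⟨fun h ↦ ⟨h.1.of_quasiIso f, h.2.of_quasiIso (homMapRight P f), key.1 h.3⟩,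
    fun h ↦ ⟨h.1.of_quasiIso' f, h.2.of_quasiIso' (homMapRight P f), key.2 h.3⟩⟩

/-- A homologically bounded complex is connected to a bounded one by quasi-isomorphisms. -/
theorem exists_strictlyBounded {C : Type*} [Category* C] [Abelian C] {X : CochainComplex C ℤ}
    (hX : HomologicallyBounded X) :
    ∃ (X₁ X₂ : CochainComplex C ℤ) (f : X₁ ⟶ X) (g : X₁ ⟶ X₂),
      QuasiIso f ∧ QuasiIso g ∧ StrictlyBounded X₂ := by
  obtain ⟨a, b, _, _⟩ := hX
  have : (X.truncLE b).IsGE a := by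
    rw [CochainComplex.isGE_iff]
    intro i hi
    exact (exactAt_iff_of_quasiIsoAt (X.ιTruncLE b) i).2 (X.exactAt_of_isGE a i hi)
  exact ⟨X.truncLE b, (X.truncLE b).truncGE a, X.ιTruncLE b, (X.truncLE b).πTruncGE a,
    inferInstance, inferInstance, a, b, inferInstance, inferInstance⟩

theorem AuslanderFor.exists_foxbyPair [P.IsKProjective] (hP : ∃ b : ℤ, P.IsStrictlyLE b)
    (hX : StrictlyBounded X) (h : AuslanderFor P X) :
    ∃ W, StrictlyBounded W ∧ FoxbyPair P X W := by
  obtain ⟨b, _⟩ := hP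
  obtain ⟨_, d, _, _⟩ := hX
  obtain ⟨a, _, _, _⟩ := h.2
  have := isStrictlyLE_tensorComplex (P := P) (W := X) b d
  have hu := h.3
  let φ := (tensorComplex P X).πTruncGE a
  have := quasiIso_homMapRight P φ
  refine ⟨(tensorComplex P X).truncGE a, ⟨a, b + d, inferInstance, inferInstance⟩, h.1,
    h.2.of_quasiIso φ, φ, inferInstance, ?_⟩
  rw [adj]
  infer_instance

theorem BassFor.exists_foxbyPair [P.IsKProjective] (hP : ∃ b : ℤ, P.IsStrictlyLE b)
    (hY : StrictlyBounded Y) (h : BassFor P Y) :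
    ∃ X, StrictlyBounded X ∧ FoxbyPair P X Y := by
  obtain ⟨b, _⟩ := hP
  obtain ⟨c, _, _, _⟩ := hY
  obtain ⟨_, a, _, _⟩ := h.2
  have := isStrictlyGE_homComplex (P := P) (W := Y) c b
  have hc := h.3
  let ψ := (homComplex P Y).ιTruncLE a
  have := quasiIso_tensorMap_right P ψ
  refine ⟨(homComplex P Y).truncLE a, ⟨c - b, a, inferInstance, inferInstance⟩,
    h.2.of_quasiIso' ψ, h.1, coadj ψ, ?_, ?_⟩
  · rw [coadj]
    infer_instance
  · rw [adj_coadj]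
    infer_instance

end FoxbyPairs

/-! ### Duality for pairs -/

section DualPairs

open CochainComplex.HomComplex

variable {A : Type u} [CommRing A] {P X W : CochainComplex (ModuleCat.{u} A) ℤ}

/-- The morphism `Hom(W, U) ⟶ Hom(P, Hom(X, U))` induced by `φ : P ⊗ X ⟶ W`. -/
def dualAdj (φ : tensorComplex P X ⟶ W) (U : CochainComplex (ModuleCat.{u} A) ℤ) :
    homComplex W U ⟶ homComplex P (homComplex X U) :=
  homMapLeft φ U ≫ curry P X U

/-- The morphism `P ⊗ Hom(W, U) ⟶ Hom(X, U)` induced by `φ : P ⊗ X ⟶ W`. -/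
def dualPairing (φ : tensorComplex P X ⟶ W) (U : CochainComplex (ModuleCat.{u} A) ℤ) :
    tensorComplex P (homComplex W U) ⟶ homComplex X U :=
  coadj (dualAdj φ U)

variable (P W) in
/-- Homomorphism evaluation `P ⊗ Hom(W, U) ⟶ Hom(Hom(P, W), U)`. -/
def homEvaluation (U : CochainComplex (ModuleCat.{u} A) ℤ) :
    tensorComplex P (homComplex W U) ⟶ homComplex (homComplex P W) U :=
  dualPairing (counitHom P W) U

theorem dualPairing_eq (φ : tensorComplex P X ⟶ W) (U : CochainComplex (ModuleCat.{u} A) ℤ) :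
    dualPairing φ U = homEvaluation P W U ≫ homMapLeft (adj φ) U := by
  rw [homEvaluation, dualPairing, dualPairing, ← coadj_comp_homMapRight]
  congr 1
  nth_rewrite 1 [← coadj_adj φ]
  rw [dualAdj, dualAdj, coadj, homMapLeft_comp, Category.assoc, curry_naturality_right,
    Category.assoc]

theorem homEval_homEvaluation (U : CochainComplex (ModuleCat.{u} A) ℤ) {i n j k l m : ℤ}
    (hij : i + n = j) (hkl : k + j = l) (hik : i + k = m) (hml : m + n = l) (p : P.X i)
    (g : (homComplex W U).X n) (f : (homComplex P W).X k) :
    homEval (homComplex P W) U hkl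
        (((homEvaluation P W U).f j).hom (tmul P (homComplex W U) hij p g)) f =
      ((i * n).negOnePow * (i * k).negOnePow) •
        homEval W U hml g (homEval P W hik f p) := by
  rw [homEvaluation, dualPairing, coadj_tmul, map_zsmul_unit, LinearMap.smul_apply, mul_smul]
  congr 1
  refine (homEval_curryMap U hij hkl hik hml
    (((homMapLeft (counitHom P W) U).f n).hom g) p f).trans ?_
  rw [homEval_homMapLeft, ← map_zsmul_unit]
  congr 1
  exact counitMap_tmul P W i k m hik p f

/-- The rank one homomorphism `p ↦ c(p) w` in `Hom(P, W)^k`, for `w ∈ W^m`, where `i + k = m`. -/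
def rankOne {i k m : ℤ} (h : i + k = m) (c : P.X i →ₗ[A] A) :
    W.X m →ₗ[A] (homComplex P W).X k :=
  homMk fun i' m' h' ↦ if hi : i' = i then
    LinearMap.flip (by
      obtain rfl := hi
      obtain rfl : m' = m := by lia
      exact LinearMap.lsmul A (W.X m') ∘ₗ c) else 0

theorem homEval_rankOne {i k m : ℤ} (h : i + k = m) (c : P.X i →ₗ[A] A) (w : W.X m)
    (p : P.X i) : homEval P W h (rankOne h c w) p = c p • w := by
  subst h
  simp [rankOne]

theorem homEval_rankOne_of_ne {i k m i' m' : ℤ} (h : i + k = m) (c : P.X i →ₗ[A] A) (w : W.X m)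
    (h' : i' + k = m') (hi : i' ≠ i) (p : P.X i') : homEval P W h' (rankOne h c w) p = 0 := by
  simp [rankOne, hi]

variable (P W) in
/-- The cochain `w ↦ ± h(c(-) w)` of `Hom(W, U)` given by a cochain `h` of
`Hom(Hom(P, W), U)`. -/
def contract (U : CochainComplex (ModuleCat.{u} A) ℤ) {i n j : ℤ} (hij : i + n = j)
    (c : P.X i →ₗ[A] A) :
    (homComplex (homComplex P W) U).X j →ₗ[A] (homComplex W U).X n :=
  homMk fun m l hml ↦ ((i * n).negOnePow * (i * (m - i)).negOnePow) •
    ((rankOne (show i + (m - i) = m by lia) c).lcomp A _ ∘ₗ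
      homEval (homComplex P W) U (show m - i + j = l by lia))

theorem homEval_contract (U : CochainComplex (ModuleCat.{u} A) ℤ) {i n j k l m : ℤ}
    (hij : i + n = j) (hkl : k + j = l) (hik : i + k = m) (hml : m + n = l)
    (c : P.X i →ₗ[A] A) (h : (homComplex (homComplex P W) U).X j) (w : W.X m) :
    homEval W U hml (contract P W U hij c h) w =
      ((i * n).negOnePow * (i * k).negOnePow) •
        homEval (homComplex P W) U hkl h (rankOne hik c w) := by
  obtain rfl : k = m - i := by lia
  rfl

theorem exists_dualBasis (M : Type u) [AddCommGroup M] [Module A M] [Module.Finite A M]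
    [Module.Projective A M] :
    ∃ (s : ℕ) (b : Fin s → M) (c : Fin s → (M →ₗ[A] A)), ∀ x, ∑ a, c a x • b a = x := by
  obtain ⟨s, f, g, -, -, h⟩ := Module.Finite.exists_comp_eq_id_of_projective A M
  refine ⟨s, fun a ↦ f (Pi.single a 1), fun a ↦ LinearMap.proj a ∘ₗ g, fun x ↦ ?_⟩
  have := LinearMap.congr_fun h x
  simp only [LinearMap.comp_apply, LinearMap.proj_apply, ← map_smul, ← map_sum]
  refine Eq.trans (congrArg f ?_) this
  ext t
  simp [Finset.sum_apply, Pi.single_apply]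

theorem bijective_homEvaluation (hP : ∀ i, Module.Finite A (P.X i))
    (hP' : ∀ i, Module.Projective A (P.X i)) (hW : StrictlyBounded W)
    {U : CochainComplex (ModuleCat.{u} A) ℤ} (hU : StrictlyBounded U) (j : ℤ) :
    Function.Bijective ((homEvaluation P W U).f j).hom := by
  obtain ⟨a, b, _, _⟩ := hW
  obtain ⟨c, d, _, _⟩ := hU
  choose s e f hef using fun i ↦ exists_dualBasis (A := A) (P.X i)
  let T := Finset.Icc (a - d + j) (b - c + j)
  let θ : (homComplex (homComplex P W) U).X j →ₗ[A] (tensorComplex P (homComplex W U)).X j :=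
    ∑ i ∈ T, ∑ r, tmul P (homComplex W U) (show i + (j - i) = j by lia) (e i r) ∘ₗ
      contract P W U (show i + (j - i) = j by lia) (f i r)
  have hθ (h : (homComplex (homComplex P W) U).X j) :
      θ h = ∑ i ∈ T, ∑ r, tmul P (homComplex W U) (show i + (j - i) = j by lia) (e i r)
        (contract P W U (show i + (j - i) = j by lia) (f i r) h) := by
    simp only [θ, LinearMap.sum_apply, LinearMap.comp_apply]
  refine Function.bijective_iff_has_inverse.2 ⟨θ, fun y ↦ ?_, fun h ↦ ?_⟩
  · refine LinearMap.congr_fun (f := θ ∘ₗ ((homEvaluation P W U).f j).hom)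
      (g := LinearMap.id) (tensorComplex_hom_ext fun i n hij p g ↦ ?_) y
    obtain rfl : n = j - i := by lia
    rw [LinearMap.comp_apply, LinearMap.id_apply, hθ]
    have hne (i' : ℤ) (hi' : i' ≠ i) (r) :
        contract P W U (show i' + (j - i') = j by lia) (f i' r)
          (((homEvaluation P W U).f j).hom (tmul P (homComplex W U) hij p g)) = 0 := by
      refine homEval_ext fun m l hml w ↦ ?_
      rw [homEval_contract U _ (show m - i' + j = l by lia) (by lia),
        homEval_homEvaluation U _ _ (show i + (m - i') = m - i' + i by lia) (by lia),
        homEval_rankOne_of_ne _ _ _ _ hi'.symm]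
      simp
    have heq (r) : contract P W U (show i + (j - i) = j by lia) (f i r)
        (((homEvaluation P W U).f j).hom (tmul P (homComplex W U) hij p g)) = f i r p • g := by
      refine homEval_ext fun m l hml w ↦ ?_
      rw [homEval_contract U _ (show m - i + j = l by lia) (by lia),
        homEval_homEvaluation U _ _ (show i + (m - i) = m by lia) hml,
        homEval_rankOne, smul_smul, Int.units_mul_self, one_smul, map_smul, map_smul,
        LinearMap.smul_apply]
    by_cases hi : i ∈ T
    · rw [Finset.sum_eq_single_of_mem i hi fun i' _ hi' ↦ Finset.sum_eq_zero fun r _ ↦ by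
        rw [hne i' hi', map_zero]]
      simp only [heq]
      nth_rewrite 2 [← hef i p]
      simp only [map_smul, map_sum, LinearMap.sum_apply, LinearMap.smul_apply]
    · have hg : g = 0 := eq_zero_of_isZero (isZero_homComplex_X fun m l hml ↦ by
        by_cases hm : a ≤ m ∧ m ≤ b
        · refine Or.inr ?_
          by_cases hl : l < c
          · exact U.isZero_of_isStrictlyGE c l hl
          · refine U.isZero_of_isStrictlyLE d l ?_
            simp only [T, Finset.mem_Icc] at hi
            lia
        · refine Or.inl ?_
          by_cases hm' : m < a
          · exact W.isZero_of_isStrictlyGE a m hm'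
          · exact W.isZero_of_isStrictlyLE b m (by lia)) g
      rw [hg, map_zero]
      simp
  · rw [hθ]
    refine homEval_ext fun k l hkl z ↦ ?_
    simp only [map_sum, LinearMap.sum_apply]
    have hr (i : ℤ) (r) : homEval (homComplex P W) U hkl (((homEvaluation P W U).f j).hom
        (tmul P (homComplex W U) (show i + (j - i) = j by lia) (e i r)
          (contract P W U (show i + (j - i) = j by lia) (f i r) h))) z =
        homEval (homComplex P W) U hkl h
          (rankOne rfl (f i r) (homEval P W (rfl : i + k = i + k) z (e i r))) := by
      rw [homEval_homEvaluation U _ _ rfl (by lia), homEval_contract U _ hkl rfl, smul_smul,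
        Int.units_mul_self, one_smul]
    simp only [hr, ← map_sum]
    by_cases hl : c ≤ l ∧ l ≤ d
    · congr 1
      refine homEval_ext fun i m him p ↦ ?_
      subst him
      simp only [map_sum, LinearMap.sum_apply]
      by_cases hi : i ∈ T
      · rw [Finset.sum_eq_single_of_mem i hi fun i' _ hi' ↦ Finset.sum_eq_zero fun r _ ↦
          homEval_rankOne_of_ne _ _ _ _ hi'.symm p]
        simp only [homEval_rankOne, ← map_smul, ← map_sum, hef]
      · rw [Finset.sum_eq_zero fun i' hi' ↦ Finset.sum_eq_zero fun r _ ↦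
          homEval_rankOne_of_ne _ _ _ _ (fun h' ↦ hi (by rw [h']; exact hi')) p]
        refine (eq_zero_of_isZero ?_ _).symm
        simp only [T, Finset.mem_Icc] at hi
        by_cases hm' : i + k < a
        · exact W.isZero_of_isStrictlyGE a _ hm'
        · exact W.isZero_of_isStrictlyLE b _ (by lia)
    · have hz : IsZero (U.X l) := by
        by_cases hl' : l < c
        · exact U.isZero_of_isStrictlyGE c l hl'
        · exact U.isZero_of_isStrictlyLE d l (by lia)
      rw [eq_zero_of_isZero hz (homEval _ U hkl h z)]
      exact eq_zero_of_isZero hz _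

end DualPairs


/-! ### The theorem over one ring -/

section OneRingTheorem

variable {A : Type u} [CommRing A]

/-- `P` is bounded above and consists of finitely generated projective modules. -/
structure IsFinProjective (P : CochainComplex (ModuleCat.{u} A) ℤ) : Prop where
  finite : ∀ i, Module.Finite A (P.X i)
  projective : ∀ i, Module.Projective A (P.X i)
  bounded : ∃ b : ℤ, P.IsStrictlyLE b

theorem IsFinProjective.isKProjective {P : CochainComplex (ModuleCat.{u} A) ℤ}
    (hP : IsFinProjective P) : P.IsKProjective := by
  obtain ⟨b, _⟩ := hP.bounded
  have (n : ℤ) : Projective (P.X n) := (IsProjective.iff_projective _).1 (hP.projective n)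
  exact CochainComplex.isKProjective_of_projective P b

theorem StrictlyBounded.isKInjective {C : Type*} [Category* C] [Abelian C]
    {U : CochainComplex C ℤ} (hU : StrictlyBounded U) (hU' : ∀ n, Injective (U.X n)) :
    U.IsKInjective := by
  obtain ⟨a, _, _, _⟩ := hU
  exact CochainComplex.isKInjective_of_injective U a

variable {P X Y Z W U : CochainComplex (ModuleCat.{u} A) ℤ}

theorem IsFinProjective.isIso_homEvaluation (hP : IsFinProjective P) (hW : StrictlyBounded W)
    (hU : StrictlyBounded U) : IsIso (homEvaluation P W U) :=
  isIso_of_bijective _ (bijective_homEvaluation hP.finite hP.projective hW hU)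

theorem FoxbyPair.dual (hP : IsFinProjective P) (hX : StrictlyBounded X)
    (hW : StrictlyBounded W) (hU : StrictlyBounded U) (hU' : ∀ n, Injective (U.X n))
    (h : FoxbyPair P X W) : FoxbyPair P (homComplex W U) (homComplex X U) := by
  have := hU.isKInjective hU'
  obtain ⟨φ, hφ, hφ'⟩ := h.exists_quasiIso
  have := hP.isIso_homEvaluation hW hU
  have := quasiIso_homMapLeft φ U
  have := quasiIso_homMapLeft (adj φ) U
  refine ⟨(hW.homComplex hU).homologicallyBounded, (hX.homComplex hU).homologicallyBounded,
    dualPairing φ U, ?_, ?_⟩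
  · rw [dualPairing_eq]
    infer_instance
  · rw [dualPairing, adj_coadj, dualAdj]
    infer_instance

theorem AuslanderFor.bassFor_dual (hP : IsFinProjective P) (hU : StrictlyBounded U)
    (hU' : ∀ n, Injective (U.X n)) (h : AuslanderFor P X) : BassFor P (homComplex X U) := by
  have := hP.isKProjective
  have := hU.isKInjective hU'
  obtain ⟨X₁, X₂, f, g, _, _, hX₂⟩ := exists_strictlyBounded h.1
  rw [← auslanderFor_iff_of_quasiIso f, auslanderFor_iff_of_quasiIso g] at h
  obtain ⟨W, hW, h⟩ := h.exists_foxbyPair hP.bounded hX₂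
  have := quasiIso_homMapLeft f U
  have := quasiIso_homMapLeft g U
  rw [bassFor_iff_of_quasiIso (homMapLeft f U), ← bassFor_iff_of_quasiIso (homMapLeft g U)]
  exact (h.dual hP hX₂ hW hU hU').bassFor

theorem BassFor.auslanderFor_dual (hP : IsFinProjective P) (hU : StrictlyBounded U)
    (hU' : ∀ n, Injective (U.X n)) (h : BassFor P Y) : AuslanderFor P (homComplex Y U) := by
  have := hP.isKProjective
  have := hU.isKInjective hU'
  obtain ⟨Y₁, Y₂, f, g, _, _, hY₂⟩ := exists_strictlyBounded h.1
  rw [← bassFor_iff_of_quasiIso f, bassFor_iff_of_quasiIso g] at h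
  obtain ⟨X, hX, h⟩ := h.exists_foxbyPair hP.bounded hY₂
  have := quasiIso_homMapLeft f U
  have := quasiIso_homMapLeft g U
  rw [auslanderFor_iff_of_quasiIso (homMapLeft f U),
    ← auslanderFor_iff_of_quasiIso (homMapLeft g U)]
  exact (h.dual hP hX hY₂ hU hU').auslanderFor

theorem AuslanderFor.of_strictlyBounded_of_bassFor (hP : IsFinProjective P)
    (hZ : StrictlyBounded Z) (h : BassFor P (homComplex Z (charComplex A))) :
    AuslanderFor P Z := by
  have := hP.isKProjective
  have hT : HomologicallyBounded (tensorComplex P Z) :=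
    (h.2.of_quasiIso' (curry P Z (charComplex A))).of_homComplex_charComplex
  obtain ⟨b, _⟩ := hP.bounded
  have hZ' := hZ.homologicallyBounded
  obtain ⟨_, d, _, _⟩ := hZ
  have hT' := hT
  obtain ⟨a, _, _, _⟩ := hT
  have := isStrictlyLE_tensorComplex (P := P) (W := Z) b d
  let φ := (tensorComplex P Z).πTruncGE a
  have hW : StrictlyBounded ((tensorComplex P Z).truncGE a) :=
    ⟨a, b + d, inferInstance, inferInstance⟩
  refine FoxbyPair.auslanderFor ⟨hZ', hT'.of_quasiIso φ, φ, inferInstance, ?_⟩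
  have := quasiIso_homMapLeft φ (charComplex A)
  have : QuasiIso (dualAdj φ (charComplex A)) := by rw [dualAdj]; infer_instance
  have := quasiIso_tensorMap_right P (dualAdj φ (charComplex A))
  have := h.3
  have hp : QuasiIso (dualPairing φ (charComplex A)) := by
    rw [dualPairing, coadj]; infer_instance
  have := hP.isIso_homEvaluation hW (strictlyBounded_charComplex A)
  rw [dualPairing_eq, quasiIso_iff_comp_left] at hp
  exact quasiIso_of_quasiIso_homMapLeft _ hp

theorem BassFor.of_strictlyBounded_of_auslanderFor (hP : IsFinProjective P)
    (hZ : StrictlyBounded Z) (h : AuslanderFor P (homComplex Z (charComplex A))) :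
    BassFor P Z := by
  have := hP.isKProjective
  have := hP.isIso_homEvaluation hZ (strictlyBounded_charComplex A)
  have hT : HomologicallyBounded (homComplex P Z) :=
    (h.2.of_quasiIso (homEvaluation P Z (charComplex A))).of_homComplex_charComplex
  obtain ⟨b, _⟩ := hP.bounded
  have hZ' := hZ.homologicallyBounded
  obtain ⟨c, _, _, _⟩ := hZ
  have hT' := hT
  obtain ⟨_, a, _, _⟩ := hT
  have := isStrictlyGE_homComplex (P := P) (W := Z) c b
  let ψ := (homComplex P Z).ιTruncLE a
  refine FoxbyPair.bassFor ⟨hT'.of_quasiIso' ψ, hZ', coadj ψ, ?_, ?_⟩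
  · have := quasiIso_homMapLeft ψ (charComplex A)
    have : QuasiIso (dualPairing (coadj ψ) (charComplex A)) := by
      rw [dualPairing_eq, adj_coadj]; infer_instance
    have := quasiIso_homMapRight P (dualPairing (coadj ψ) (charComplex A))
    have := h.3
    have hd : QuasiIso (dualAdj (coadj ψ) (charComplex A)) := by
      rw [← adj_coadj (dualAdj (coadj ψ) (charComplex A)), adj]
      change QuasiIso (_ ≫ homMapRight P (dualPairing (coadj ψ) (charComplex A)))
      infer_instance
    rw [dualAdj, quasiIso_iff_comp_right] at hd
    exact quasiIso_of_quasiIso_homMapLeft _ hd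
  · rw [adj_coadj]
    infer_instance

theorem AuslanderFor.of_bassFor_homComplex (hP : IsFinProjective P)
    (h : BassFor P (homComplex Z (charComplex A))) : AuslanderFor P Z := by
  have := hP.isKProjective
  obtain ⟨Z₁, Z₂, f, g, _, _, hZ₂⟩ := exists_strictlyBounded h.1.of_homComplex_charComplex
  have := quasiIso_homMapLeft f (charComplex A)
  have := quasiIso_homMapLeft g (charComplex A)
  rw [← auslanderFor_iff_of_quasiIso f, auslanderFor_iff_of_quasiIso g]
  rw [bassFor_iff_of_quasiIso (homMapLeft f (charComplex A)),
    ← bassFor_iff_of_quasiIso (homMapLeft g (charComplex A))] at h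
  exact .of_strictlyBounded_of_bassFor hP hZ₂ h

theorem BassFor.of_auslanderFor_homComplex (hP : IsFinProjective P)
    (h : AuslanderFor P (homComplex Z (charComplex A))) : BassFor P Z := by
  have := hP.isKProjective
  obtain ⟨Z₁, Z₂, f, g, _, _, hZ₂⟩ := exists_strictlyBounded h.1.of_homComplex_charComplex
  have := quasiIso_homMapLeft f (charComplex A)
  have := quasiIso_homMapLeft g (charComplex A)
  rw [← bassFor_iff_of_quasiIso f, bassFor_iff_of_quasiIso g]
  rw [auslanderFor_iff_of_quasiIso (homMapLeft f (charComplex A)),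
    ← auslanderFor_iff_of_quasiIso (homMapLeft g (charComplex A))] at h
  exact .of_strictlyBounded_of_auslanderFor hP hZ₂ h

end OneRingTheorem


/-! ### Change of rings -/

section ChangeOfRings

variable {A B : Type u} [CommRing A] [CommRing B] (f : A →+* B)

/-- Restriction of scalars for complexes. -/
abbrev resComplex (Z : CochainComplex (ModuleCat.{u} B) ℤ) : CochainComplex (ModuleCat.{u} A) ℤ :=
  ((ModuleCat.restrictScalars f).mapHomologicalComplex (ComplexShape.up ℤ)).obj Z

/-- Restriction of scalars for morphisms of complexes. -/
abbrev resMap {Z W : CochainComplex (ModuleCat.{u} B) ℤ} (g : Z ⟶ W) :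
    resComplex f Z ⟶ resComplex f W :=
  ((ModuleCat.restrictScalars f).mapHomologicalComplex (ComplexShape.up ℤ)).map g

theorem homologicallyBounded_resComplex_iff (Z : CochainComplex (ModuleCat.{u} B) ℤ) :
    HomologicallyBounded (resComplex f Z) ↔ HomologicallyBounded Z := by
  simp only [homologicallyBounded_iff, exactAt_iff_forall_exists]
  rfl

theorem quasiIso_resMap_iff {Z W : CochainComplex (ModuleCat.{u} B) ℤ} (g : Z ⟶ W) :
    QuasiIso (resMap f g) ↔ QuasiIso g := by
  simp only [quasiIso_iff_elementwise]
  rfl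

instance additive_extendScalars : (ModuleCat.extendScalars.{u, u, u} f).Additive :=
  (ModuleCat.extendRestrictScalarsAdj.{u, u, u} f).left_adjoint_additive

/-- Extension of scalars for complexes. -/
abbrev extComplex (P : CochainComplex (ModuleCat.{u} A) ℤ) : CochainComplex (ModuleCat.{u} B) ℤ :=
  ((ModuleCat.extendScalars f).mapHomologicalComplex (ComplexShape.up ℤ)).obj P

/-- The identity `Z^n ⟶ Z^n` from the `B`-module to its restriction to `A`. -/
def toRes (Z : CochainComplex (ModuleCat.{u} B) ℤ) (n : ℤ) : Z.X n →+ (resComplex f Z).X n where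
  toFun z := z
  map_zero' := rfl
  map_add' _ _ := rfl

/-- The identity `Z^n ⟶ Z^n` from the restriction to `A` of the `B`-module. -/
def ofRes (Z : CochainComplex (ModuleCat.{u} B) ℤ) (n : ℤ) :
    (resComplex f Z).X n →ₛₗ[f] Z.X n where
  toFun z := z
  map_add' _ _ := rfl
  map_smul' _ _ := rfl

variable {f}

@[simp]
theorem toRes_ofRes (Z : CochainComplex (ModuleCat.{u} B) ℤ) {n : ℤ} (z : (resComplex f Z).X n) :
    toRes f Z n (ofRes f Z n z) = z := rfl

@[simp]
theorem ofRes_toRes (Z : CochainComplex (ModuleCat.{u} B) ℤ) {n : ℤ} (z : Z.X n) :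
    ofRes f Z n (toRes f Z n z) = z := rfl

theorem toRes_smul (Z : CochainComplex (ModuleCat.{u} B) ℤ) {n : ℤ} (a : A) (z : Z.X n) :
    toRes f Z n (f a • z) = a • toRes f Z n z := rfl

theorem ofRes_injective (Z : CochainComplex (ModuleCat.{u} B) ℤ) (n : ℤ) :
    Function.Injective (ofRes f Z n) := fun _ _ h ↦ h

theorem ofRes_units_smul (Z : CochainComplex (ModuleCat.{u} B) ℤ) {n : ℤ} (ε : ℤˣ)
    (z : (resComplex f Z).X n) : ofRes f Z n (ε • z) = ε • ofRes f Z n z := rfl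

theorem ofRes_d (Z : CochainComplex (ModuleCat.{u} B) ℤ) {n m : ℤ} (z : (resComplex f Z).X n) :
    ofRes f Z m (((resComplex f Z).d n m).hom z) = (Z.d n m).hom (ofRes f Z n z) := rfl

theorem ofRes_resMap {Z W : CochainComplex (ModuleCat.{u} B) ℤ} (g : Z ⟶ W) {n : ℤ}
    (z : (resComplex f Z).X n) :
    ofRes f W n (((resMap f g).f n).hom z) = (g.f n).hom (ofRes f Z n z) := rfl

variable (f) in
/-- The map `P^i ⟶ (B ⊗ P)^i`. -/
def extMk (P : CochainComplex (ModuleCat.{u} A) ℤ) (i : ℤ) :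
    P.X i →ₛₗ[f] (extComplex f P).X i where
  toFun p := ((ModuleCat.extendRestrictScalarsAdj f).unit.app (P.X i)).hom p
  map_add' p p' := map_add _ p p'
  map_smul' a p := map_smul ((ModuleCat.extendRestrictScalarsAdj f).unit.app (P.X i)).hom a p

theorem extMk_d (P : CochainComplex (ModuleCat.{u} A) ℤ) {i j : ℤ} (p : P.X i) :
    extMk f P j ((P.d i j).hom p) = ((extComplex f P).d i j).hom (extMk f P i p) :=
  LinearMap.congr_fun (congrArg ModuleCat.Hom.hom
    ((ModuleCat.extendRestrictScalarsAdj f).unit.naturality (P.d i j))) p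

/-- The linear map out of `(B ⊗ P)^i` determined by a semilinear map on `P^i`. -/
def extLift {P : CochainComplex (ModuleCat.{u} A) ℤ} {i : ℤ} {N : Type u} [AddCommGroup N]
    [Module B N] (g : P.X i →ₛₗ[f] N) : (extComplex f P).X i →ₗ[B] N :=
  (((ModuleCat.extendRestrictScalarsAdj f).homEquiv (P.X i) (ModuleCat.of B N)).symm
    (ModuleCat.semilinearMapAddEquiv f (P.X i) (ModuleCat.of B N) g)).hom

theorem extLift_extMk {P : CochainComplex (ModuleCat.{u} A) ℤ} {i : ℤ} {N : Type u}
    [AddCommGroup N] [Module B N] (g : P.X i →ₛₗ[f] N) (p : P.X i) :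
    extLift g (extMk f P i p) = g p := by
  have h := ((ModuleCat.extendRestrictScalarsAdj f).homEquiv (P.X i)
    (ModuleCat.of B N)).apply_symm_apply
      (ModuleCat.semilinearMapAddEquiv f (P.X i) (ModuleCat.of B N) g)
  rw [Adjunction.homEquiv_unit] at h
  exact LinearMap.congr_fun (congrArg ModuleCat.Hom.hom h) p

theorem extComplex_hom_ext {P : CochainComplex (ModuleCat.{u} A) ℤ} {i : ℤ} {N : Type u}
    [AddCommGroup N] [Module B N] {g g' : (extComplex f P).X i →ₗ[B] N}
    (h : ∀ p, g (extMk f P i p) = g' (extMk f P i p)) : g = g' := by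
  have key : ∀ k k' : (ModuleCat.extendScalars f).obj (P.X i) ⟶ ModuleCat.of B N,
      (∀ p, k.hom (extMk f P i p) = k'.hom (extMk f P i p)) → k = k' := fun k k' hk ↦ by
    refine ((ModuleCat.extendRestrictScalarsAdj f).homEquiv (P.X i)
      (ModuleCat.of B N)).injective ?_
    rw [Adjunction.homEquiv_unit, Adjunction.homEquiv_unit]
    exact ModuleCat.hom_ext (LinearMap.ext hk)
  exact congrArg ModuleCat.Hom.hom (key
    (ModuleCat.ofHom (X := (extComplex f P).X i) g)
    (ModuleCat.ofHom (X := (extComplex f P).X i) g') h)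

theorem finite_extComplex_X {P : CochainComplex (ModuleCat.{u} A) ℤ} {i : ℤ}
    [hP : Module.Finite A (P.X i)] : Module.Finite B ((extComplex f P).X i) := by
  classical
  obtain ⟨s, hs⟩ := hP.fg_top
  refine ⟨⟨s.image (extMk f P i), ?_⟩⟩
  rw [← Submodule.ker_mkQ (Submodule.span B _), LinearMap.ker_eq_top]
  refine extComplex_hom_ext fun p ↦ ?_
  rw [LinearMap.zero_apply, Submodule.mkQ_apply, Submodule.Quotient.mk_eq_zero]
  have hp : p ∈ Submodule.span A (s : Set (P.X i)) := hs ▸ Submodule.mem_top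
  induction hp using Submodule.span_induction with
  | mem x hx => exact Submodule.subset_span (Finset.mem_coe.2 (Finset.mem_image_of_mem _ hx))
  | zero => rw [map_zero]; exact Submodule.zero_mem _
  | add x y _ _ hx hy => rw [map_add]; exact Submodule.add_mem _ hx hy
  | smul a x _ hx => rw [LinearMap.map_smulₛₗ]; exact Submodule.smul_mem _ (f a) hx

theorem IsFinProjective.extComplex {P : CochainComplex (ModuleCat.{u} A) ℤ}
    (hP : IsFinProjective P) : IsFinProjective (extComplex f P) where
  finite i := by
    have := hP.finite i
    exact finite_extComplex_X
  projective i := by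
    have := hP.projective i
    have : Projective (P.X i) := (IsProjective.iff_projective _).1 this
    exact (IsProjective.iff_projective _).2
      ((ModuleCat.extendRestrictScalarsAdj f).map_projective (P.X i) this)
  bounded := by
    obtain ⟨b, hb⟩ := hP.bounded
    refine ⟨b, (CochainComplex.isStrictlyLE_iff _ b).2 fun i hi ↦ ?_⟩
    exact (ModuleCat.extendScalars f).map_isZero (P.isZero_of_isStrictlyLE b i hi)

variable (f) in
/-- The map `Hom_B(B ⊗ P, W)^n ⟶ Hom_A(P, W)^n` given by restriction to `P`. -/
def resHomMap (P : CochainComplex (ModuleCat.{u} A) ℤ) (W : CochainComplex (ModuleCat.{u} B) ℤ)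
    (n : ℤ) : (resComplex f (homComplex (extComplex f P) W)).X n →ₗ[A]
      (homComplex P (resComplex f W)).X n :=
  homMk fun i j h ↦
    { toFun := fun z ↦
        { toFun := fun p ↦ toRes f W j
            (homEval (extComplex f P) W h (ofRes f _ n z) (extMk f P i p))
          map_add' := fun p p' ↦ by simp only [map_add]
          map_smul' := fun a p ↦ by
            rw [LinearMap.map_smulₛₗ, map_smul, toRes_smul, RingHom.id_apply] }
      map_add' := fun _ _ ↦ rfl
      map_smul' := fun _ _ ↦ rfl }

theorem ofRes_homEval_resHomMap {P : CochainComplex (ModuleCat.{u} A) ℤ}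
    {W : CochainComplex (ModuleCat.{u} B) ℤ} {n i j : ℤ} (hij : i + n = j)
    (z : (resComplex f (homComplex (extComplex f P) W)).X n) (p : P.X i) :
    ofRes f W j (homEval P (resComplex f W) hij (resHomMap f P W n z) p) =
      homEval (extComplex f P) W hij (ofRes f _ n z) (extMk f P i p) := rfl

variable (f) in
/-- The morphism `Hom_B(B ⊗ P, W) ⟶ Hom_A(P, W)` given by restriction to `P`. -/
def resHom (P : CochainComplex (ModuleCat.{u} A) ℤ) (W : CochainComplex (ModuleCat.{u} B) ℤ) :
    resComplex f (homComplex (extComplex f P) W) ⟶ homComplex P (resComplex f W) where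
  f n := ModuleCat.ofHom (X := (resComplex f (homComplex (extComplex f P) W)).X n)
    (Y := (homComplex P (resComplex f W)).X n) (resHomMap f P W n)
  comm' n m hnm := by
    obtain rfl : n + 1 = m := hnm
    refine ModuleCat.hom_ext (LinearMap.ext fun z ↦ homEval_ext fun i j hij p ↦
      ofRes_injective W j ?_)
    change ofRes f W j (homEval P (resComplex f W) hij
        (((homComplex P (resComplex f W)).d n (n + 1)).hom (resHomMap f P W n z)) p) =
      ofRes f W j (homEval P (resComplex f W) hij (resHomMap f P W (n + 1)
        (((resComplex f (homComplex (extComplex f P) W)).d n (n + 1)).hom z)) p)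
    rw [homEval_d (i' := i + 1) (j := j - 1) rfl rfl (by lia) (by lia) hij (by lia), map_add,
      ofRes_units_smul, ofRes_d, ofRes_homEval_resHomMap, ofRes_homEval_resHomMap,
      ofRes_homEval_resHomMap, ofRes_d, extMk_d,
      homEval_d (i' := i + 1) (j := j - 1) rfl rfl (by lia) (by lia) hij (by lia)]

theorem ofRes_homEval_resHom {P : CochainComplex (ModuleCat.{u} A) ℤ}
    {W : CochainComplex (ModuleCat.{u} B) ℤ} {n i j : ℤ} (hij : i + n = j)
    (z : (resComplex f (homComplex (extComplex f P) W)).X n) (p : P.X i) :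
    ofRes f W j (homEval P (resComplex f W) hij (((resHom f P W).f n).hom z) p) =
      homEval (extComplex f P) W hij (ofRes f _ n z) (extMk f P i p) := rfl

theorem bijective_resHomMap (P : CochainComplex (ModuleCat.{u} A) ℤ)
    (W : CochainComplex (ModuleCat.{u} B) ℤ) (n : ℤ) :
    Function.Bijective (resHomMap f P W n) := by
  refine ⟨fun z z' h ↦ ofRes_injective _ n (homEval_ext fun i j hij ↦ LinearMap.congr_fun
    (extComplex_hom_ext fun p ↦ ?_)), fun w ↦ ?_⟩
  · rw [← ofRes_homEval_resHomMap, h, ofRes_homEval_resHomMap]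
  · refine ⟨toRes f _ n (homMk (M := B) (P := extComplex f P) (W := W) (fun i j hij ↦
      LinearMap.toSpanSingleton B _ (extLift ((ofRes f W j).comp
        (homEval P (resComplex f W) hij w)))) 1),
      homEval_ext fun i j hij p ↦ ofRes_injective W j ?_⟩
    rw [ofRes_homEval_resHomMap, ofRes_toRes, homEval_homMk, LinearMap.toSpanSingleton_apply,
      one_smul, extLift_extMk]
    rfl

instance isIso_resHom (P : CochainComplex (ModuleCat.{u} A) ℤ)
    (W : CochainComplex (ModuleCat.{u} B) ℤ) : IsIso (resHom f P W) :=
  isIso_of_bijective _ fun n ↦ bijective_resHomMap P W n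

theorem resHom_naturality (P : CochainComplex (ModuleCat.{u} A) ℤ)
    {W W' : CochainComplex (ModuleCat.{u} B) ℤ} (g : W ⟶ W') :
    resMap f (homMapRight (extComplex f P) g) ≫ resHom f P W' =
      resHom f P W ≫ homMapRight P (resMap f g) := by
  refine homComplex_mor_ext fun n z i j hij p ↦ ofRes_injective W' j ?_
  simp only [HomologicalComplex.comp_f, ModuleCat.hom_comp, LinearMap.comp_apply]
  rw [homEval_homMapRight, ofRes_homEval_resHom, ofRes_resMap, ofRes_resMap,
    homEval_homMapRight, ofRes_homEval_resHom]

variable (f) in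
/-- The morphism `P ⊗_A Z ⟶ (B ⊗ P) ⊗_B Z`. -/
def resTensor (P : CochainComplex (ModuleCat.{u} A) ℤ) (Z : CochainComplex (ModuleCat.{u} B) ℤ) :
    tensorComplex P (resComplex f Z) ⟶ resComplex f (tensorComplex (extComplex f P) Z) :=
  coadj (resMap f (unitHom (extComplex f P) Z) ≫ resHom f P _)

theorem ofRes_resTensor_tmul {P : CochainComplex (ModuleCat.{u} A) ℤ}
    {Z : CochainComplex (ModuleCat.{u} B) ℤ} {i n j : ℤ} (hij : i + n = j) (p : P.X i)
    (z : (resComplex f Z).X n) :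
    ofRes f _ j (((resTensor f P Z).f j).hom (tmul P (resComplex f Z) hij p z)) =
      tmul (extComplex f P) Z hij (extMk f P i p) (ofRes f Z n z) := by
  rw [resTensor, coadj_tmul, ofRes_units_smul, HomologicalComplex.comp_f, ModuleCat.hom_comp,
    LinearMap.comp_apply, ofRes_homEval_resHom, ofRes_resMap, ← adj_id, homEval_adj, smul_smul,
    Int.units_mul_self, one_smul]
  rfl

theorem tensorComplex_addHom_ext {P X : CochainComplex (ModuleCat.{u} A) ℤ} {j : ℤ} {M : Type*}
    [AddCommGroup M] {g g' : (tensorComplex P X).X j →+ M}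
    (h : ∀ i n (hij : i + n = j) p x, g (tmul P X hij p x) = g' (tmul P X hij p x)) : g = g' := by
  let N : Submodule A ((tensorComplex P X).X j) :=
    { carrier := {t | ∀ a : A, g (a • t) = g' (a • t)}
      zero_mem' := fun a ↦ by simp
      add_mem' := fun hx hy a ↦ by rw [smul_add, map_add, map_add, hx, hy]
      smul_mem' := fun b x hx a ↦ by rw [smul_smul, hx] }
  have hN : N.mkQ = 0 := tensorComplex_hom_ext fun i n hij p x ↦ by
    rw [LinearMap.zero_apply, Submodule.mkQ_apply, Submodule.Quotient.mk_eq_zero]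
    intro a
    rw [← LinearMap.smul_apply, ← map_smul, h]
  refine AddMonoidHom.ext fun t ↦ ?_
  have ht : t ∈ N := by
    rw [← Submodule.ker_mkQ N, hN]
    trivial
  simpa using ht 1

section ResTensor

variable (P : CochainComplex (ModuleCat.{u} A) ℤ) (Z : CochainComplex (ModuleCat.{u} B) ℤ) (j : ℤ)

/-- Multiplication by elements of `B` on `P ⊗_A Z`. -/
def tensorResMul (b : B) :
    (tensorComplex P (resComplex f Z)).X j →+ (tensorComplex P (resComplex f Z)).X j :=
  (((tensorMap (𝟙 P) (resMap f (b • 𝟙 Z))).f j).hom : _ →ₗ[A] _).toAddMonoidHom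

theorem tensorResMul_tmul {i n j : ℤ} (hij : i + n = j) (b : B) (p : P.X i)
    (z : (resComplex f Z).X n) :
    tensorResMul P Z j b (tmul P (resComplex f Z) hij p z) =
      tmul P (resComplex f Z) hij p (toRes f Z n (b • ofRes f Z n z)) :=
  tensorMap_tmul _ _ hij p z

/-- `B` acts on `P ⊗_A Z` through `Z`. -/
@[reducible]
def tensorResModule : Module B ((tensorComplex P (resComplex f Z)).X j) where
  smul b t := tensorResMul P Z j b t
  one_smul t := DFunLike.congr_fun (f := tensorResMul P Z j 1) (g := AddMonoidHom.id _)
    (tensorComplex_addHom_ext fun i n hij p z ↦ by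
      rw [tensorResMul_tmul, one_smul, toRes_ofRes]; rfl) t
  mul_smul b b' t := DFunLike.congr_fun (f := tensorResMul P Z j (b * b'))
    (g := (tensorResMul P Z j b).comp (tensorResMul P Z j b'))
    (tensorComplex_addHom_ext fun i n hij p z ↦ by
      rw [AddMonoidHom.comp_apply, tensorResMul_tmul, tensorResMul_tmul, tensorResMul_tmul,
        ofRes_toRes, mul_smul]) t
  smul_zero b := map_zero (tensorResMul P Z j b)
  smul_add b := map_add (tensorResMul P Z j b)
  add_smul b b' t := DFunLike.congr_fun (f := tensorResMul P Z j (b + b'))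
    (g := tensorResMul P Z j b + tensorResMul P Z j b')
    (tensorComplex_addHom_ext fun i n hij p z ↦ by
      rw [AddMonoidHom.add_apply, tensorResMul_tmul, tensorResMul_tmul, tensorResMul_tmul,
        add_smul, map_add, map_add]) t
  zero_smul t := DFunLike.congr_fun (f := tensorResMul P Z j 0) (g := 0)
    (tensorComplex_addHom_ext fun i n hij p z ↦ by
      rw [tensorResMul_tmul, zero_smul, map_zero, map_zero, AddMonoidHom.zero_apply]) t

attribute [local instance] tensorResModule

theorem smul_tmul_res {i n j : ℤ} (hij : i + n = j) (b : B) (p : P.X i) (z : Z.X n) :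
    b • tmul P (resComplex f Z) hij p (toRes f Z n z) =
      tmul P (resComplex f Z) hij p (toRes f Z n (b • z)) :=
  tensorResMul_tmul P Z hij b p (toRes f Z n z)

/-- The inverse of `resTensor`. -/
def resTensorInv :
    (tensorComplex (extComplex f P) Z).X j →ₗ[B] (tensorComplex P (resComplex f Z)).X j :=
  tensorLift fun i n hij ↦ extLift
    { toFun := fun p ↦
        { toFun := fun z ↦ tmul P (resComplex f Z) hij p (toRes f Z n z)
          map_add' := fun z z' ↦ by simp only [map_add]
          map_smul' := fun b z ↦ (smul_tmul_res P Z hij b p z).symm }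
      map_add' := fun p p' ↦ LinearMap.ext fun z ↦ by
        simp only [map_add, LinearMap.add_apply, LinearMap.coe_mk, AddHom.coe_mk]
      map_smul' := fun a p ↦ LinearMap.ext fun z ↦ by
        simp only [LinearMap.smul_apply, LinearMap.coe_mk, AddHom.coe_mk]
        rw [smul_tmul_res, map_smul, LinearMap.smul_apply, toRes_smul, map_smul] }

theorem resTensorInv_tmul {i n j : ℤ} (hij : i + n = j) (p : P.X i) (z : Z.X n) :
    resTensorInv P Z j (tmul (extComplex f P) Z hij (extMk f P i p) z) =
      tmul P (resComplex f Z) hij p (toRes f Z n z) := by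
  rw [resTensorInv, tensorLift_tmul, extLift_extMk]
  rfl

theorem ofRes_resTensor_smul (b : B) (t : (tensorComplex P (resComplex f Z)).X j) :
    ofRes f _ j (((resTensor f P Z).f j).hom (b • t)) =
      b • ofRes f _ j (((resTensor f P Z).f j).hom t) := by
  let g : (tensorComplex P (resComplex f Z)).X j →+ (tensorComplex (extComplex f P) Z).X j :=
    (ofRes f _ j).toAddMonoidHom.comp
      (((resTensor f P Z).f j).hom : _ →ₗ[A] _).toAddMonoidHom
  refine DFunLike.congr_fun (f := g.comp (tensorResMul P Z j b))
    (g := (DistribSMul.toAddMonoidHom _ b).comp g)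
    (tensorComplex_addHom_ext fun i n hij p z ↦ ?_) t
  change ofRes f _ j (((resTensor f P Z).f j).hom
      (tensorResMul P Z j b (tmul P (resComplex f Z) hij p z))) =
    b • ofRes f _ j (((resTensor f P Z).f j).hom (tmul P (resComplex f Z) hij p z))
  rw [tensorResMul_tmul, ofRes_resTensor_tmul, ofRes_resTensor_tmul, ofRes_toRes, map_smul]

theorem bijective_resTensor : Function.Bijective ((resTensor f P Z).f j).hom := by
  refine Function.bijective_iff_has_inverse.2
    ⟨fun t ↦ resTensorInv P Z j (ofRes f _ j t), fun t ↦ ?_, fun t ↦ ?_⟩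
  · refine DFunLike.congr_fun (f := ((resTensorInv P Z j).toAddMonoidHom.comp
      (ofRes f _ j).toAddMonoidHom).comp
        (((resTensor f P Z).f j).hom : _ →ₗ[A] _).toAddMonoidHom) (g := AddMonoidHom.id _)
      (tensorComplex_addHom_ext fun i n hij p z ↦ ?_) t
    change resTensorInv P Z j (ofRes f _ j (((resTensor f P Z).f j).hom
      (tmul P (resComplex f Z) hij p z))) = tmul P (resComplex f Z) hij p z
    rw [ofRes_resTensor_tmul, resTensorInv_tmul, toRes_ofRes]
  · let g : (tensorComplex P (resComplex f Z)).X j →ₗ[B] (tensorComplex (extComplex f P) Z).X j :=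
      { toFun := fun t ↦ ofRes f _ j (((resTensor f P Z).f j).hom t)
        map_add' := fun t t' ↦ by simp only [map_add]
        map_smul' := fun b t ↦ ofRes_resTensor_smul P Z j b t }
    have h : g ∘ₗ resTensorInv P Z j = LinearMap.id := by
      refine tensorComplex_hom_ext fun i n hij p z ↦ ?_
      refine LinearMap.congr_fun (extComplex_hom_ext
        (g := (g ∘ₗ resTensorInv P Z j) ∘ₗ (tmul (extComplex f P) Z hij).flip z)
        (g' := (tmul (extComplex f P) Z hij).flip z) fun p ↦ ?_) p
      simp only [LinearMap.comp_apply, LinearMap.flip_apply]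
      rw [resTensorInv_tmul]
      exact ofRes_resTensor_tmul hij p (toRes f Z n z)
    exact ofRes_injective _ j (LinearMap.congr_fun h (ofRes f _ j t))

instance isIso_resTensor : IsIso (resTensor f P Z) :=
  isIso_of_bijective _ fun j ↦ bijective_resTensor P Z j

theorem adj_resTensor :
    unitHom P (resComplex f Z) ≫ homMapRight P (resTensor f P Z) =
      resMap f (unitHom (extComplex f P) Z) ≫ resHom f P (tensorComplex (extComplex f P) Z) := by
  change adj (resTensor f P Z) = _
  rw [resTensor, adj_coadj]

theorem coadj_resHom :
    tensorMap (𝟙 P) (resHom f P Z) ≫ counitHom P (resComplex f Z) =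
      resTensor f P (homComplex (extComplex f P) Z) ≫ resMap f (counitHom (extComplex f P) Z) := by
  change coadj (resHom f P Z) = _
  rw [← coadj_adj (resTensor f P (homComplex (extComplex f P) Z) ≫ _), adj_comp]
  congr 1
  rw [resTensor, adj_coadj, Category.assoc, ← resHom_naturality, ← Category.assoc,
    ← Functor.map_comp]
  have : unitHom (extComplex f P) (homComplex (extComplex f P) Z) ≫
      homMapRight (extComplex f P) (counitHom (extComplex f P) Z) = 𝟙 _ := by
    change adj (counitHom (extComplex f P) Z) = _
    rw [← coadj_id, adj_coadj]
  rw [this, CategoryTheory.Functor.map_id, Category.id_comp]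

end ResTensor

theorem auslanderFor_resComplex_iff {P : CochainComplex (ModuleCat.{u} A) ℤ} [P.IsKProjective]
    {Z : CochainComplex (ModuleCat.{u} B) ℤ} :
    AuslanderFor P (resComplex f Z) ↔ AuslanderFor (extComplex f P) Z := by
  have key : QuasiIso (unitHom P (resComplex f Z)) ↔ QuasiIso (unitHom (extComplex f P) Z) := by
    have := quasiIso_homMapRight P (resTensor f P Z)
    rw [← quasiIso_iff_comp_right _ (homMapRight P (resTensor f P Z)), adj_resTensor,
      quasiIso_iff_comp_right, quasiIso_resMap_iff]
  have key' : HomologicallyBounded (tensorComplex P (resComplex f Z)) ↔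
      HomologicallyBounded (tensorComplex (extComplex f P) Z) := by
    rw [← homologicallyBounded_resComplex_iff f]
    exact ⟨.of_quasiIso (resTensor f P Z), .of_quasiIso' (resTensor f P Z)⟩
  exact ⟨fun h ↦ ⟨(homologicallyBounded_resComplex_iff f Z).1 h.1, key'.1 h.2, key.1 h.3⟩,
    fun h ↦ ⟨(homologicallyBounded_resComplex_iff f Z).2 h.1, key'.2 h.2, key.2 h.3⟩⟩

theorem bassFor_resComplex_iff {P : CochainComplex (ModuleCat.{u} A) ℤ} [P.IsKProjective]
    {Z : CochainComplex (ModuleCat.{u} B) ℤ} :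
    BassFor P (resComplex f Z) ↔ BassFor (extComplex f P) Z := by
  have key : QuasiIso (counitHom P (resComplex f Z)) ↔
      QuasiIso (counitHom (extComplex f P) Z) := by
    have := quasiIso_tensorMap_right P (resHom f P Z)
    rw [← quasiIso_iff_comp_left (tensorMap (𝟙 P) (resHom f P Z)), coadj_resHom,
      quasiIso_iff_comp_left, quasiIso_resMap_iff]
  have key' : HomologicallyBounded (homComplex P (resComplex f Z)) ↔
      HomologicallyBounded (homComplex (extComplex f P) Z) := by
    rw [← homologicallyBounded_resComplex_iff f]
    exact ⟨.of_quasiIso' (resHom f P Z), .of_quasiIso (resHom f P Z)⟩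
  exact ⟨fun h ↦ ⟨(homologicallyBounded_resComplex_iff f Z).1 h.1, key'.1 h.2, key.1 h.3⟩,
    fun h ↦ ⟨(homologicallyBounded_resComplex_iff f Z).2 h.1, key'.2 h.2, key.2 h.3⟩⟩

end ChangeOfRings


/-! ### Homomorphisms of bimodules into coextended modules -/

section Coextension

open CochainComplex.HomComplex

theorem quasiIso_homMapRight_hom {A : Type u} [CommRing A]
    (P : CochainComplex (ModuleCat.{u} A) ℤ) {K L : CochainComplex (ModuleCat.{u} A) ℤ}
    (e : HomotopyEquiv K L) : QuasiIso (homMapRight P e.hom) := by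
  refine quasiIso_of_inverse _ (homMapRight P e.inv) (fun n (x : Cochain P K n) hx ↦ ?_)
    fun n (y : Cochain P L n) hy ↦ ?_
  · obtain ⟨y, hy⟩ := exists_comp_ofHom_eq e.homotopyHomInvId x hx
    refine ⟨y, Eq.trans ?_ hy⟩
    rw [homMapRight_apply, homMapRight_apply, Cochain.ofHom_comp,
      Cochain.comp_assoc_of_third_is_zero_cochain]
  · obtain ⟨y', hy'⟩ := exists_comp_ofHom_eq e.homotopyInvHomId y hy
    refine ⟨y', Eq.trans ?_ hy'⟩
    rw [homMapRight_apply, homMapRight_apply, Cochain.ofHom_comp,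
      Cochain.comp_assoc_of_third_is_zero_cochain]

variable {A B : Type u} [CommRing A] [CommRing B] (f : A →+* B)

instance additive_coextendScalars : (ModuleCat.coextendScalars.{u, u, u} f).Additive :=
  (ModuleCat.restrictCoextendScalarsAdj.{u, u, u} f).right_adjoint_additive

/-- Coextension of scalars for complexes. -/
abbrev coextComplex (J : CochainComplex (ModuleCat.{u} A) ℤ) :
    CochainComplex (ModuleCat.{u} B) ℤ :=
  ((ModuleCat.coextendScalars f).mapHomologicalComplex (ComplexShape.up ℤ)).obj J

theorem StrictlyBounded.coextComplex {U : CochainComplex (ModuleCat.{u} A) ℤ}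
    (hU : StrictlyBounded U) : StrictlyBounded (coextComplex f U) := by
  obtain ⟨a, b, _, _⟩ := hU
  exact ⟨a, b,
    (CochainComplex.isStrictlyGE_iff _ a).2 fun i hi ↦
      (ModuleCat.coextendScalars f).map_isZero (U.isZero_of_isStrictlyGE a i hi),
    (CochainComplex.isStrictlyLE_iff _ b).2 fun i hi ↦
      (ModuleCat.coextendScalars f).map_isZero (U.isZero_of_isStrictlyLE b i hi)⟩

theorem injective_coextComplex_X {U : CochainComplex (ModuleCat.{u} A) ℤ} {n : ℤ}
    (hU : Injective (U.X n)) : Injective ((coextComplex f U).X n) :=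
  Injective.injective_of_adjoint (ModuleCat.restrictCoextendScalarsAdj f) (U.X n)

end Coextension

section BimoduleHom

open CochainComplex.HomComplex

variable {Q : Type v} {R S : Type u} [CommRing Q] [CommRing R] [CommRing S] [Algebra Q R]
  [Algebra Q S]

attribute [local instance] bimodCochainModule

variable (R) in
/-- The complex of bimodules coextended from a complex of `S`-modules. -/
abbrev bimodCoext (J : CochainComplex (ModuleCat.{u} S) ℤ) :
    CochainComplex (ModuleCat.{u} (R ⊗[Q] S)) ℤ :=
  coextComplex (Algebra.TensorProduct.includeRight : S →ₐ[Q] R ⊗[Q] S).toRingHom J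

variable (X : CochainComplex (ModuleCat.{u} (R ⊗[Q] S)) ℤ) (J : CochainComplex (ModuleCat.{u} S) ℤ)

/-- The counit of coextension of scalars from `S` to `R ⊗[Q] S`. -/
def coextCounit : rightComplex Q R S (bimodCoext R J) ⟶ J where
  f j := (ModuleCat.restrictCoextendScalarsAdj.{u, u, u}
    (Algebra.TensorProduct.includeRight : S →ₐ[Q] R ⊗[Q] S).toRingHom).counit.app (J.X j)
  comm' i j _ := ((ModuleCat.restrictCoextendScalarsAdj.{u, u, u}
    (Algebra.TensorProduct.includeRight : S →ₐ[Q] R ⊗[Q] S).toRingHom).counit.naturality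
      (J.d i j)).symm

/-- The adjunction between restriction and coextension, for cochains. -/
def uncoextCochain (n : ℤ) (z : Cochain X (bimodCoext R J) n) :
    Cochain (rightComplex Q R S X) J n :=
  (z.map (toRight Q R S)).comp (Cochain.ofHom (coextCounit J)) (add_zero n)

theorem uncoextCochain_v {n : ℤ} (z : Cochain X (bimodCoext R J) n) {i j : ℤ} (h : i + n = j) :
    (uncoextCochain X J n z).v i j h =
      (show (rightComplex Q R S X).X i ⟶ (rightComplex Q R S (bimodCoext R J)).X j from
        (toRight Q R S).map (z.v i j h)) ≫ (coextCounit J).f j := by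
  rw [uncoextCochain, Cochain.comp_zero_cochain_v, Cochain.ofHom_v]
  rfl

theorem δ_uncoextCochain (n m : ℤ) (z : Cochain X (bimodCoext R J) n) :
    δ n m (uncoextCochain X J n z) = uncoextCochain X J m (δ n m z) := by
  rw [uncoextCochain, δ_comp_ofHom, δ_map]
  rfl

theorem bijective_uncoextCochain (n : ℤ) : Function.Bijective (uncoextCochain X J n) := by
  let E := ModuleCat.restrictCoextendScalarsAdj.{u, u, u}
    (Algebra.TensorProduct.includeRight : S →ₐ[Q] R ⊗[Q] S).toRingHom
  have hE (i j : ℤ) : Function.Bijective fun g : X.X i ⟶ (bimodCoext R J).X j ↦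
      (show (rightComplex Q R S X).X i ⟶ (rightComplex Q R S (bimodCoext R J)).X j from
        (toRight Q R S).map g) ≫ (coextCounit J).f j := by
    have h := (E.homEquiv (X.X i) (J.X j)).symm.bijective
    rwa [show ⇑(E.homEquiv (X.X i) (J.X j)).symm = _ from
      funext fun g ↦ E.homEquiv_counit (X.X i) (J.X j) g] at h
  refine ⟨fun z z' h ↦ Cochain.ext _ _ fun i j hij ↦ (hE i j).injective ?_, fun w ↦ ?_⟩
  · have := congrArg (fun w ↦ Cochain.v w i j hij) h
    simpa only [uncoextCochain_v] using this
  · choose g hg using fun i j ↦ (hE i j).surjective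
    refine ⟨Cochain.mk fun i j hij ↦ g i j (w.v i j hij), Cochain.ext _ _ fun i j hij ↦ ?_⟩
    rw [uncoextCochain_v, Cochain.mk_v]
    exact hg i j _

/-- The isomorphism between `Hom_B(X, Hom_S(B, J))`, where `B = R ⊗[Q] S`, and `Hom_S(X, J)`. -/
def uncoext : leftComplex Q R S (homComplex X (bimodCoext R J)) ⟶ bimodHomComplex X J where
  f n := ModuleCat.ofHom (X := (leftComplex Q R S (homComplex X (bimodCoext R J))).X n)
    (Y := (bimodHomComplex X J).X n)
    { toFun := fun z ↦ uncoextCochain X J n z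
      map_add' := fun (z z' : Cochain X (bimodCoext R J) n) ↦ by
        change uncoextCochain X J n (z + z') = uncoextCochain X J n z + uncoextCochain X J n z'
        rw [uncoextCochain, Cochain.map_add, Cochain.add_comp]
        rfl
      map_smul' := fun r (z : Cochain X (bimodCoext R J) n) ↦ by
        change uncoextCochain X J n ((r ⊗ₜ[Q] (1 : S)) • z) =
          (Cochain.ofHom (leftMul X r)).comp (uncoextCochain X J n z) (zero_add n)
        refine Cochain.ext _ _ fun i j h ↦ ?_
        rw [Cochain.zero_cochain_comp_v, Cochain.ofHom_v, uncoextCochain_v, uncoextCochain_v,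
          ← Category.assoc]
        refine congrArg (· ≫ (coextCounit J).f j) (ModuleCat.hom_ext (LinearMap.ext fun x ↦ ?_))
        exact ((z.v i j h).hom.map_smul (r ⊗ₜ[Q] (1 : S)) x).symm }
  comm' n m hnm :=
    ModuleCat.hom_ext (LinearMap.ext fun z ↦ δ_uncoextCochain X J n m z)

instance isIso_uncoext : IsIso (uncoext X J) :=
  isIso_of_bijective _ fun n ↦ bijective_uncoextCochain X J n

/-- A complex of `S`-modules that is homotopy equivalent to a bounded complex of injectives. -/
def IsFinInjective (J : CochainComplex (ModuleCat.{u} S) ℤ) : Prop :=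
  ∃ U : CochainComplex (ModuleCat.{u} S) ℤ, StrictlyBounded U ∧ (∀ n, Injective (U.X n)) ∧
    Nonempty (HomotopyEquiv J U)

variable {X J} {P : CochainComplex (ModuleCat.{u} R) ℤ}

theorem IsFinInjective.exists_quasiIso (hJ : IsFinInjective J)
    (X : CochainComplex (ModuleCat.{u} (R ⊗[Q] S)) ℤ) :
    ∃ U : CochainComplex (ModuleCat.{u} (R ⊗[Q] S)) ℤ, StrictlyBounded U ∧
      (∀ n, Injective (U.X n)) ∧
      ∃ g : homComplex X (bimodCoext R J) ⟶ homComplex X U, QuasiIso g := by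
  obtain ⟨U, hU, hU', ⟨e⟩⟩ := hJ
  exact ⟨bimodCoext R U, hU.coextComplex _, fun n ↦ injective_coextComplex_X _ (hU' n), _,
    quasiIso_homMapRight_hom X
      ((ModuleCat.coextendScalars (Algebra.TensorProduct.includeRight :
        S →ₐ[Q] R ⊗[Q] S).toRingHom).mapHomotopyEquiv e)⟩

theorem AuslanderFor.bassFor_bimodHomComplex (hP : IsFinProjective P) (hJ : IsFinInjective J)
    (h : AuslanderFor P (leftComplex Q R S X)) : BassFor P (bimodHomComplex X J) := by
  have := hP.isKProjective
  rw [auslanderFor_resComplex_iff] at h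
  obtain ⟨U, hU, hU', g, _⟩ := hJ.exists_quasiIso X
  rw [← bassFor_iff_of_quasiIso (uncoext X J), bassFor_resComplex_iff]
  have := (hP.extComplex (f := Algebra.TensorProduct.includeLeftRingHom
    (A := R) (B := S) (R := Q))).isKProjective
  rw [bassFor_iff_of_quasiIso g]
  exact h.bassFor_dual hP.extComplex hU hU'

theorem BassFor.auslanderFor_bimodHomComplex (hP : IsFinProjective P) (hJ : IsFinInjective J)
    (h : BassFor P (leftComplex Q R S X)) : AuslanderFor P (bimodHomComplex X J) := by
  have := hP.isKProjective
  rw [bassFor_resComplex_iff] at h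
  obtain ⟨U, hU, hU', g, _⟩ := hJ.exists_quasiIso X
  rw [← auslanderFor_iff_of_quasiIso (uncoext X J), auslanderFor_resComplex_iff]
  have := (hP.extComplex (f := Algebra.TensorProduct.includeLeftRingHom
    (A := R) (B := S) (R := Q))).isKProjective
  rw [auslanderFor_iff_of_quasiIso g]
  exact h.auslanderFor_dual hP.extComplex hU hU'

end BimoduleHom


/-! ### Duals of tensor products of bimodules -/

section BimoduleTensor

open CochainComplex.HomComplex

variable {Q : Type v} {R S : Type u} [CommRing Q] [CommRing R] [CommRing S] [Algebra Q R]
  [Algebra Q S]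

attribute [local instance] leftModule smulCommClass_leftModule

variable (X : CochainComplex (ModuleCat.{u} (R ⊗[Q] S)) ℤ) (G : CochainComplex (ModuleCat.{u} S) ℤ)

/-- The inclusion of `X^i ⊗_S G^k` into `(X ⊗_S G)^m`, where `i + k = m`. -/
def bimodι {i k m : ℤ} (h : i + k = m) :
    ((toRight Q R S).obj (X.X i) ⊗[S] G.X k) →ₗ[R] (bimodTensorComplex X G).X m :=
  (HomologicalComplex.ιMapBifunctor X G bimodTensor (ComplexShape.up ℤ) i k m h).hom

/-- The biadditive map `X^i × G^k ⟶ (X ⊗_S G)^m`, where `i + k = m`. -/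
def bimodTmul {i k m : ℤ} (h : i + k = m) :
    (rightComplex Q R S X).X i →+ G.X k →+ (bimodTensorComplex X G).X m where
  toFun x :=
    { toFun := fun g ↦ bimodι X G h ((show (toRight Q R S).obj (X.X i) from x) ⊗ₜ[S] g)
      map_zero' := by rw [TensorProduct.tmul_zero, map_zero]
      map_add' := fun g g' ↦ by rw [TensorProduct.tmul_add, map_add] }
  map_zero' := AddMonoidHom.ext fun g ↦
    (congrArg (bimodι X G h) (TensorProduct.zero_tmul _ g)).trans (map_zero _)
  map_add' x x' := AddMonoidHom.ext fun g ↦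
    (congrArg (bimodι X G h) (TensorProduct.add_tmul (R := S)
      (show (toRight Q R S).obj (X.X i) from x) (show (toRight Q R S).obj (X.X i) from x')
      g)).trans (map_add _ _ _)

variable {X G}

theorem bimodTmul_smul {i k m : ℤ} (h : i + k = m) (s : S) (x : (rightComplex Q R S X).X i)
    (g : G.X k) : bimodTmul X G h (s • x) g = bimodTmul X G h x (s • g) :=
  congrArg (bimodι X G h) (TensorProduct.smul_tmul (R := S) s
    (show (toRight Q R S).obj (X.X i) from x) g)

theorem bimodTmul_leftMul {i k m : ℤ} (h : i + k = m) (r : R) (x : (rightComplex Q R S X).X i)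
    (g : G.X k) :
    bimodTmul X G h (((leftMul X r).f i).hom x) g = r • bimodTmul X G h x g :=
  (bimodι X G h).map_smul r ((show (toRight Q R S).obj (X.X i) from x) ⊗ₜ[S] g)

theorem bimodTensorComplex_hom_ext {m : ℤ} {M : Type u} [AddCommGroup M] [Module R M]
    {φ ψ : (bimodTensorComplex X G).X m →ₗ[R] M}
    (h : ∀ i k (hik : i + k = m) x g,
      φ (bimodTmul X G hik x g) = ψ (bimodTmul X G hik x g)) : φ = ψ := by
  have : ModuleCat.ofHom (X := (bimodTensorComplex X G).X m) φ = ModuleCat.ofHom ψ :=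
    HomologicalComplex.mapBifunctor.hom_ext fun i k hik ↦
      ModuleCat.hom_ext (bimodTensor_hom_ext fun x g ↦ h i k hik x g)
  exact congrArg ModuleCat.Hom.hom this

theorem bimodTensorComplex_addHom_ext {m : ℤ} {M : Type*} [AddCommGroup M]
    {φ ψ : (bimodTensorComplex X G).X m →+ M}
    (h : ∀ i k (hik : i + k = m) x g,
      φ (bimodTmul X G hik x g) = ψ (bimodTmul X G hik x g)) : φ = ψ := by
  let N : Submodule R ((bimodTensorComplex X G).X m) :=
    { carrier := {t | ∀ r : R, φ (r • t) = ψ (r • t)}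
      zero_mem' := fun r ↦ by rw [smul_zero, map_zero, map_zero]
      add_mem' := fun hx hy r ↦ by rw [smul_add, map_add, map_add, hx, hy]
      smul_mem' := fun b x hx r ↦ by rw [smul_smul, hx] }
  have hN : N.mkQ = 0 := bimodTensorComplex_hom_ext fun i n hij x g ↦ by
    rw [LinearMap.zero_apply, Submodule.mkQ_apply, Submodule.Quotient.mk_eq_zero]
    intro r
    rw [← bimodTmul_leftMul, h]
  refine AddMonoidHom.ext fun t ↦ ?_
  have ht : t ∈ N := by
    rw [← Submodule.ker_mkQ N, hN]
    trivial
  simpa using ht 1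

theorem exists_character_bimodTmul {m : ℤ}
    (c : ∀ i k, i + k = m → (rightComplex Q R S X).X i →+ G.X k →+ AddCircle (1 : ℚ))
    (hc : ∀ i k h (s : S) x g, c i k h (s • x) g = c i k h x (s • g)) :
    ∃ χ : CharacterModule ((bimodTensorComplex X G).X m),
      ∀ i k (h : i + k = m) x g, χ (bimodTmul X G h x g) = c i k h x g := by
  let c' (i k : ℤ) (h : i + k = m) : CharacterModule ((toRight Q R S).obj (X.X i) ⊗[S] G.X k) :=
    TensorProduct.liftAddHom (c i k h) (hc i k h)
  let φ : (bimodTensorComplex X G).X m ⟶ ModuleCat.of R (CharacterModule R) :=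
    HomologicalComplex.mapBifunctorDesc (K₁ := X) (K₂ := G) (F := bimodTensor)
      (c := ComplexShape.up ℤ) fun i k h ↦ ModuleCat.ofHom (homOfCharacter (A := R) (c' i k h))
  let χ : (bimodTensorComplex X G).X m →+ AddCircle (1 : ℚ) :=
    { toFun := fun t ↦ φ.hom t 1
      map_zero' := by rw [map_zero]; rfl
      map_add' := fun t t' ↦ by rw [map_add]; rfl }
  refine ⟨χ, fun i k h x g ↦ ?_⟩
  have e := HomologicalComplex.ι_mapBifunctorDesc (K₁ := X) (K₂ := G) (F := bimodTensor)
    (c := ComplexShape.up ℤ) (A := ModuleCat.of R (CharacterModule R))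
    (fun i k h ↦ ModuleCat.ofHom (homOfCharacter (A := R) (c' i k h))) i k h
  have e' := congrArg (fun ψ ↦ (show CharacterModule R from
    ψ.hom ((show (toRight Q R S).obj (X.X i) from x) ⊗ₜ[S] g)) 1) e
  refine e'.trans ?_
  change c' i k h ((1 : R) • ((show (toRight Q R S).obj (X.X i) from x) ⊗ₜ[S] g)) = c i k h x g
  rw [one_smul]
  rfl

theorem d_bimodTmul {i k m i' k' m' : ℤ} (h : i + k = m) (hi : i + 1 = i') (hk : k + 1 = k')
    (h₁ : i' + k = m') (h₂ : i + k' = m') (x : (rightComplex Q R S X).X i) (g : G.X k) :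
    ((bimodTensorComplex X G).d m m').hom (bimodTmul X G h x g) =
      bimodTmul X G h₁ (((rightComplex Q R S X).d i i').hom x) g +
        i.negOnePow • bimodTmul X G h₂ x ((G.d k k').hom g) := by
  have e : HomologicalComplex.ιMapBifunctor X G bimodTensor (ComplexShape.up ℤ) i k m h ≫
      (bimodTensorComplex X G).d m m' =
      (bimodTensor.map (X.d i i')).app (G.X k) ≫
        HomologicalComplex.ιMapBifunctor X G bimodTensor (ComplexShape.up ℤ) i' k m' h₁ +
      i.negOnePow • ((bimodTensor.obj (X.X i)).map (G.d k k') ≫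
        HomologicalComplex.ιMapBifunctor X G bimodTensor (ComplexShape.up ℤ) i k' m' h₂) := by
    rw [HomologicalComplex.mapBifunctor.d_eq, Preadditive.comp_add,
      HomologicalComplex.mapBifunctor.ι_D₁, HomologicalComplex.mapBifunctor.ι_D₂,
      HomologicalComplex.mapBifunctor.d₁_eq X G bimodTensor _
        (show (ComplexShape.up ℤ).Rel i i' from hi) k m' h₁,
      HomologicalComplex.mapBifunctor.d₂_eq X G bimodTensor _ i
        (show (ComplexShape.up ℤ).Rel k k' from hk) m' h₂]
    congr 1
    exact one_smul _ _
  exact LinearMap.congr_fun (congrArg ModuleCat.Hom.hom e)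
    ((show (toRight Q R S).obj (X.X i) from x) ⊗ₜ[S] g)

/-- The map `x ↦ (g ↦ χ (x ⊗ g))` associated with a character `χ` of `(X ⊗_S G)^m`. -/
def bimodCurryMap {i k m : ℤ} (h : i + k = m)
    (χ : CharacterModule ((bimodTensorComplex X G).X m)) :
    (rightComplex Q R S X).X i →ₗ[S] CharacterModule (G.X k) where
  toFun x := AddMonoidHom.comp (show (bimodTensorComplex X G).X m →+ AddCircle (1 : ℚ) from χ)
    (bimodTmul X G h x)
  map_add' x x' := CharacterModule.ext _ fun g ↦
    (congrArg χ (DFunLike.congr_fun (map_add (bimodTmul X G h) x x') g)).trans (map_add χ _ _)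
  map_smul' s x := CharacterModule.ext _ fun g ↦ congrArg χ (bimodTmul_smul h s x g)

variable (X G) in
/-- The element `x ↦ (g ↦ χ (x ⊗ g))` of `Hom_S(X, Hom_S(G, charComplex S))^n` associated with a
character `χ` of `(X ⊗_S G)^m`, where `m + n = 0`. -/
def bimodCurryCochain {m n : ℤ} (hm : m + n = 0)
    (χ : CharacterModule ((bimodTensorComplex X G).X m)) :
    Cochain (rightComplex Q R S X) (homComplex G (charComplex S)) n :=
  Cochain.mk fun i j _ ↦ ModuleCat.ofHom (X := (rightComplex Q R S X).X i)
    (Y := (homComplex G (charComplex S)).X j)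
    ((LinearEquiv.ofBijective _ (bijective_charOf G (neg_add_cancel j))).symm.toLinearMap ∘ₗ
      bimodCurryMap (show i + -j = m by lia) χ)

theorem charOf_bimodCurryCochain_v {m n i j k : ℤ} (hm : m + n = 0)
    (χ : CharacterModule ((bimodTensorComplex X G).X m)) (hij : i + n = j) (hk : k + j = 0)
    (h : i + k = m) (x : (rightComplex Q R S X).X i) (g : G.X k) :
    charOf G hk (((bimodCurryCochain X G hm χ).v i j hij).hom x) g = χ (bimodTmul X G h x g) := by
  obtain rfl : k = -j := by lia
  exact DFunLike.congr_fun ((LinearEquiv.ofBijective _ (bijective_charOf G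
    (neg_add_cancel j))).apply_symm_apply (bimodCurryMap h χ x)) g

theorem charOf_δ_bimodCurryCochain {m m' n n' i j k : ℤ} (hn : n + 1 = n') (hm' : m' + 1 = m)
    (hm : m + n = 0) (χ : CharacterModule ((bimodTensorComplex X G).X m)) (hij : i + n' = j)
    (hk : k + j = 0) (h : i + k = m') (x : (rightComplex Q R S X).X i) (g : G.X k) :
    charOf G hk (((δ n n' (bimodCurryCochain X G hm χ)).v i j hij).hom x) g =
      n'.negOnePow • χ (((bimodTensorComplex X G).d m' m).hom (bimodTmul X G h x g)) := by
  have e₁ := charOf_d G (n := j - 1) (i' := k + 1) (by lia) rfl (by lia) hk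
    (((bimodCurryCochain X G hm χ).v i (j - 1) (by lia)).hom x) g
  have e₂ := charOf_bimodCurryCochain_v hm χ (j := j - 1) (k := k + 1) (by lia) (by lia)
    (by lia) x ((G.d k (k + 1)).hom g)
  have e₃ := charOf_bimodCurryCochain_v hm χ (i := i + 1) (j := j) (by lia) hk
    (by lia) (((rightComplex Q R S X).d i (i + 1)).hom x) g
  rw [d_bimodTmul (i' := i + 1) (k' := k + 1) h rfl rfl (by lia) (by lia), map_add,
    map_zsmul_unit, smul_add, smul_smul, ← Int.negOnePow_add, show n' + i = j by lia, ← e₂, ← e₃,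
    ← e₁, δ_v n n' hn _ i j hij (j - 1) (i + 1) rfl rfl, add_comm, ModuleCat.hom_add,
    LinearMap.add_apply, map_add, ModuleCat.hom_comp, LinearMap.comp_apply]
  rfl

theorem bimodHom_ext {n : ℤ}
    {z z' : Cochain (rightComplex Q R S X) (homComplex G (charComplex S)) n}
    (h : ∀ i j k (hij : i + n = j) (hk : k + j = 0) x g,
      charOf G hk ((z.v i j hij).hom x) g = charOf G hk ((z'.v i j hij).hom x) g) : z = z' :=
  Cochain.ext _ _ fun i j hij ↦ ModuleCat.hom_ext (LinearMap.ext fun x ↦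
    (bijective_charOf G (neg_add_cancel j)).1
      (CharacterModule.ext _ fun g ↦ h i j (-j) hij (neg_add_cancel j) x g))

attribute [local instance] bimodCochainModule

variable (X G) in
/-- The isomorphism between the dual of `X ⊗_S G` and `Hom_S(X, -)` of the dual of `G`. -/
def bimodCurry : homComplex (bimodTensorComplex X G) (charComplex R) ⟶
    bimodHomComplex X (homComplex G (charComplex S)) where
  f n := ModuleCat.ofHom (X := (homComplex (bimodTensorComplex X G) (charComplex R)).X n)
    (Y := (bimodHomComplex X (homComplex G (charComplex S))).X n)
    { toFun := fun z ↦ bimodCurryCochain X G (neg_add_cancel n)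
        (charOf (bimodTensorComplex X G) (neg_add_cancel n) z)
      map_add' := fun z z' ↦ bimodHom_ext fun i j k hij hk x g ↦ by
        change _ = charOf G hk (((bimodCurryCochain X G (neg_add_cancel n)
            (charOf (bimodTensorComplex X G) (neg_add_cancel n) z)).v i j hij).hom x +
          ((bimodCurryCochain X G (neg_add_cancel n)
            (charOf (bimodTensorComplex X G) (neg_add_cancel n) z')).v i j hij).hom x) g
        rw [map_add (charOf G hk), charOf_bimodCurryCochain_v _ _ _ _ (by lia), map_add]
        exact (congrArg₂ (· + ·)
          (charOf_bimodCurryCochain_v (neg_add_cancel n) _ hij hk (by lia) x g)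
          (charOf_bimodCurryCochain_v (neg_add_cancel n) _ hij hk (by lia) x g)).symm
      map_smul' := fun r z ↦ bimodHom_ext fun i j k hij hk x g ↦ by
        change _ = charOf G hk (((((Cochain.ofHom (leftMul X r)).comp
          (bimodCurryCochain X G (neg_add_cancel n)
            (charOf (bimodTensorComplex X G) (neg_add_cancel n) z)) (zero_add n))).v i j hij).hom
            x) g
        rw [Cochain.zero_cochain_comp_v, Cochain.ofHom_v, ModuleCat.hom_comp,
          LinearMap.comp_apply, charOf_bimodCurryCochain_v _ _ _ _ (by lia),
          charOf_bimodCurryCochain_v _ _ _ _ (by lia), bimodTmul_leftMul, map_smul]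
        rfl }
  comm' n m hnm := by
    obtain rfl : n + 1 = m := hnm
    refine ModuleCat.hom_ext (LinearMap.ext fun z ↦ ?_)
    change δ n (n + 1) (bimodCurryCochain X G (neg_add_cancel n)
        (charOf (bimodTensorComplex X G) (neg_add_cancel n) z)) =
      bimodCurryCochain X G (neg_add_cancel (n + 1))
        (charOf (bimodTensorComplex X G) (neg_add_cancel (n + 1))
          (((homComplex (bimodTensorComplex X G) (charComplex R)).d n (n + 1)).hom z))
    refine bimodHom_ext fun i j k hij hk x g ↦ ?_
    rw [charOf_δ_bimodCurryCochain rfl (m' := -(n + 1)) (by lia) _ _ _ _ (by lia),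
      charOf_bimodCurryCochain_v _ _ _ _ (by lia),
      charOf_d _ rfl (by lia) (neg_add_cancel n) _]

theorem bijective_bimodCurry (n : ℤ) :
    Function.Bijective ((bimodCurry X G).f n).hom := by
  refine ⟨fun z z' h ↦ (bijective_charOf _ (neg_add_cancel n)).1 ?_, fun w ↦ ?_⟩
  · refine bimodTensorComplex_addHom_ext fun i k hik x g ↦ ?_
    have e := congrArg (fun w : Cochain (rightComplex Q R S X) (homComplex G (charComplex S)) n ↦
      charOf G (show k + -k = 0 by lia) ((w.v i (-k) (by lia)).hom x) g) h
    refine Eq.trans ?_ (e.trans ?_)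
    · exact (charOf_bimodCurryCochain_v (neg_add_cancel n) _ _ _ hik x g).symm
    · exact charOf_bimodCurryCochain_v (neg_add_cancel n) _ _ _ hik x g
  · change Cochain (rightComplex Q R S X) (homComplex G (charComplex S)) n at w
    obtain ⟨χ, hχ⟩ := exists_character_bimodTmul (X := X) (G := G) (m := -n) (fun i k hik ↦
      { toFun := fun x ↦ charOf G (show k + -k = 0 by lia) ((w.v i (-k) (by lia)).hom x)
        map_zero' := by rw [map_zero, map_zero]; rfl
        map_add' := fun x x' ↦ by rw [map_add, map_add]; rfl }) fun i k hik s x g ↦ by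
        change charOf G _ ((w.v i (-k) _).hom (s • x)) g = charOf G _ ((w.v i (-k) _).hom x) (s • g)
        rw [map_smul, map_smul]
        rfl
    obtain ⟨z, rfl⟩ := (bijective_charOf (bimodTensorComplex X G) (neg_add_cancel n)).2 χ
    refine ⟨z, bimodHom_ext fun i j k hij hk x g ↦ ?_⟩
    obtain rfl : j = -k := by lia
    exact (charOf_bimodCurryCochain_v (neg_add_cancel n) _ hij hk (by lia) x g).trans
      (hχ i k (by lia) x g)

instance isIso_bimodCurry : IsIso (bimodCurry X G) :=
  isIso_of_bijective _ bijective_bimodCurry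

theorem IsFinInjective.homComplex_charComplex {V : CochainComplex (ModuleCat.{u} S) ℤ} (f : G ⟶ V)
    [QuasiIso f] (hG : ∀ n, Module.Flat S (G.X n)) (hG' : ∃ b : ℤ, G.IsStrictlyLE b)
    (hV : ∀ n, Module.Flat S (V.X n)) (hV' : StrictlyBounded V) :
    IsFinInjective (homComplex G (charComplex S)) := by
  obtain ⟨b, _⟩ := hG'
  have hU := hV'.homComplex (strictlyBounded_charComplex S)
  have hU' := injective_homComplex_charComplex V hV
  have := hU.isKInjective hU'
  have := isStrictlyGE_homComplex (P := G) (W := charComplex S) 0 b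
  have := injective_homComplex_charComplex G hG
  have : (homComplex G (charComplex S)).IsKInjective :=
    CochainComplex.isKInjective_of_injective _ (0 - b)
  have := quasiIso_homMapLeft f (charComplex S)
  exact ⟨_, hU, hU', (Equivalent.of_quasiIso (homMapLeft f (charComplex S))).symm
    |>.nonempty_homotopyEquiv⟩

theorem AuslanderFor.bimodTensorComplex {P : CochainComplex (ModuleCat.{u} R) ℤ}
    (hP : IsFinProjective P) (hG : IsFinInjective (homComplex G (charComplex S)))
    (h : AuslanderFor P (leftComplex Q R S X)) : AuslanderFor P (bimodTensorComplex X G) := by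
  have := hP.isKProjective
  refine .of_bassFor_homComplex hP ?_
  rw [bassFor_iff_of_quasiIso (bimodCurry X G)]
  exact h.bassFor_bimodHomComplex hP hG

theorem BassFor.bimodTensorComplex {P : CochainComplex (ModuleCat.{u} R) ℤ}
    (hP : IsFinProjective P) (hG : IsFinInjective (homComplex G (charComplex S)))
    (h : BassFor P (leftComplex Q R S X)) : BassFor P (bimodTensorComplex X G) := by
  have := hP.isKProjective
  refine .of_auslanderFor_homComplex hP ?_
  rw [auslanderFor_iff_of_quasiIso (bimodCurry X G)]
  exact h.auslanderFor_bimodHomComplex hP hG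

end BimoduleTensor


/-! ### Resolutions by finitely generated projective modules -/

section FinProjective

variable {R : Type u} [CommRing R]

theorem exists_fg_map_eq {M N : Type*} [AddCommGroup M] [Module R M] [AddCommGroup N] [Module R N]
    (f : M →ₗ[R] N) {L : Submodule R N} (hL : L.FG) (h : L ≤ LinearMap.range f) :
    ∃ L' : Submodule R M, L'.FG ∧ L'.map f = L := by
  classical
  obtain ⟨s, rfl⟩ := hL
  choose! g hg using fun x (hx : x ∈ (s : Set N)) ↦ h (Submodule.subset_span hx)
  refine ⟨Submodule.span R (s.image g : Finset M), ⟨_, rfl⟩, ?_⟩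
  rw [Submodule.map_span, Finset.coe_image, Set.image_image]
  congr 1
  exact (Set.image_congr hg).trans (Set.image_id' _)

theorem exists_fg_cycles (D : CochainComplex (ModuleCat.{u} R) ℤ) (n : ℤ)
    [hD : Module.Finite R (D.homology n)] :
    ∃ L : Submodule R (D.X n), L.FG ∧ L ≤ LinearMap.ker (D.d n (n + 1)).hom ∧
      LinearMap.ker (D.d n (n + 1)).hom ≤ L ⊔ LinearMap.range (D.d (n - 1) n).hom := by
  let S := D.sc' (n - 1) n (n + 1)
  have e : D.homology n ≅ S.moduleCatLeftHomologyData.H :=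
    D.homologyIsoSc' (n - 1) n (n + 1) (by simp) (by simp) ≪≫ S.moduleCatHomologyIso
  have : Module.Finite R (LinearMap.ker S.g.hom ⧸ LinearMap.range S.moduleCatToCycles) :=
    Module.Finite.equiv e.toLinearEquiv
  obtain ⟨L, hL, hL'⟩ := exists_fg_map_eq (LinearMap.range S.moduleCatToCycles).mkQ
    this.fg_top (by rw [Submodule.range_mkQ])
  refine ⟨L.map (LinearMap.ker S.g.hom).subtype, hL.map _, ?_, fun x hx ↦ ?_⟩
  · rintro _ ⟨x, _, rfl⟩
    exact x.2
  · have hx' : (LinearMap.range S.moduleCatToCycles).mkQ ⟨x, hx⟩ ∈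
        L.map (LinearMap.range S.moduleCatToCycles).mkQ := hL' ▸ Submodule.mem_top
    obtain ⟨⟨(y : D.X n), hy'⟩, hy, hyx⟩ := hx'
    obtain ⟨t, ht⟩ := (Submodule.Quotient.eq _).1 hyx.symm
    have ht' : (D.d (n - 1) n).hom t = x - y := congrArg Subtype.val ht
    refine Submodule.mem_sup.2 ⟨y, ⟨⟨y, hy'⟩, hy, rfl⟩, x - y, ⟨t, ht'⟩, add_sub_cancel _ _⟩

/-- The condition on submodules `N` of `D^n` and `N'` of `D^(n+1)` ensuring that a subcomplex of `D`
has the homology of `D`. -/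
structure IsHomologyStep (D : CochainComplex (ModuleCat.{u} R) ℤ) (n : ℤ)
    (N : Submodule R (D.X n)) (N' : Submodule R (D.X (n + 1))) : Prop where
  map_eq : N.map (D.d n (n + 1)).hom = N' ⊓ LinearMap.range (D.d n (n + 1)).hom
  ker_le : LinearMap.ker (D.d n (n + 1)).hom ≤
    (N ⊓ LinearMap.ker (D.d n (n + 1)).hom) ⊔ LinearMap.range (D.d (n - 1) n).hom

theorem IsHomologyStep.d_mem {D : CochainComplex (ModuleCat.{u} R) ℤ}
    {N : ∀ n, Submodule R (D.X n)} (h : ∀ n, IsHomologyStep D n (N n) (N (n + 1))) (i j : ℤ)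
    (x : D.X i) (hx : x ∈ N i) : (D.d i j).hom x ∈ N j := by
  by_cases hij : i + 1 = j
  · subst hij
    exact ((h i).map_eq.le (Submodule.mem_map_of_mem hx)).1
  · rw [D.shape i j hij]
    exact Submodule.zero_mem _

theorem IsHomologyStep.exists_d_eq {D : CochainComplex (ModuleCat.{u} R) ℤ}
    {N : ∀ n, Submodule R (D.X n)} (h : ∀ n, IsHomologyStep D n (N n) (N (n + 1))) {i j : ℤ}
    (hij : i + 1 = j) {y : D.X i} (hy : (D.d i j).hom y ∈ N j) :
    ∃ x ∈ N i, (D.d i j).hom x = (D.d i j).hom y := by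
  subst hij
  exact (h i).map_eq.ge ⟨hy, y, rfl⟩

variable [IsNoetherianRing R]

theorem exists_isHomologyStep (D : CochainComplex (ModuleCat.{u} R) ℤ) (n : ℤ)
    [hD : Module.Finite R (D.homology n)] {N' : Submodule R (D.X (n + 1))} (hN' : N'.FG) :
    ∃ N : Submodule R (D.X n), N.FG ∧ IsHomologyStep D n N N' := by
  obtain ⟨L, hL, hL₁, hL₂⟩ := exists_fg_cycles D n
  have : IsNoetherian R N' := isNoetherian_of_fg_of_noetherian N' hN'
  have h := Submodule.FG.of_le hN' (inf_le_left : N' ⊓ LinearMap.range (D.d n (n + 1)).hom ≤ N')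
  obtain ⟨M, hM, hM'⟩ := exists_fg_map_eq (D.d n (n + 1)).hom h inf_le_right
  refine ⟨M ⊔ L, hM.sup hL, ?_, hL₂.trans (sup_le_sup_right (le_inf le_sup_right hL₁) _)⟩
  rw [Submodule.map_sup, hM', LinearMap.le_ker_iff_map.1 hL₁, sup_bot_eq]

theorem exists_homologySubcomplex (D : CochainComplex (ModuleCat.{u} R) ℤ)
    (hD : ∀ n, Module.Finite R (D.homology n)) (b : ℤ) [D.IsLE b] :
    ∃ N : ∀ n, Submodule R (D.X n), (∀ n, (N n).FG) ∧ (∀ n, b < n → N n = ⊥) ∧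
      ∀ n, IsHomologyStep D n (N n) (N (n + 1)) := by
  classical
  choose step hstep using fun n (N' : {N' : Submodule R (D.X (n + 1)) // N'.FG}) ↦
    exists_isHomologyStep D n N'.2
  let G : ℕ → ∀ n, {N : Submodule R (D.X n) // N.FG} := fun k ↦
    Nat.rec (fun n ↦ ⟨⊥, Submodule.fg_bot⟩)
      (fun _ F n ↦ ⟨step n (F (n + 1)), (hstep n (F (n + 1))).1⟩) k
  have hb (n : ℤ) (hn : b < n) : (G (b + 1 - n).toNat n).1 = ⊥ := by
    rw [show (b + 1 - n).toNat = 0 by lia]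
    rfl
  refine ⟨fun n ↦ (G (b + 1 - n).toNat n).1, fun n ↦ (G (b + 1 - n).toNat n).2, hb, fun n ↦ ?_⟩
  beta_reduce
  by_cases hn : b < n
  · rw [hb n hn, hb (n + 1) (by lia)]
    refine ⟨by simp, fun x hx ↦ Submodule.mem_sup_right ?_⟩
    exact (exactAt_iff_forall_exists D n).1 (D.exactAt_of_isLE b n hn) x hx
  · rw [show (b + 1 - n).toNat = (b + 1 - (n + 1)).toNat + 1 by lia]
    exact (hstep n (G (b + 1 - (n + 1)).toNat (n + 1))).2

theorem exists_quasiIso_fg (D : CochainComplex (ModuleCat.{u} R) ℤ)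
    (hD : ∀ n, Module.Finite R (D.homology n)) (b : ℤ) [D.IsLE b] :
    ∃ (E : CochainComplex (FGModuleCat.{u} R) ℤ)
      (f : ((forget₂ (FGModuleCat.{u} R) (ModuleCat.{u} R)).mapHomologicalComplex _).obj E ⟶ D),
      E.IsStrictlyLE b ∧ QuasiIso f := by
  obtain ⟨N, hN, hb, h⟩ := exists_homologySubcomplex D hD b
  have (n : ℤ) : Module.Finite R (N n) := Module.Finite.iff_fg.2 (hN n)
  let E : CochainComplex (FGModuleCat.{u} R) ℤ :=
    { X := fun n ↦ FGModuleCat.of R (N n)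
      d := fun i j ↦ FGModuleCat.ofHom ((D.d i j).hom.restrict (IsHomologyStep.d_mem h i j))
      shape := fun i j hij ↦ FGModuleCat.hom_ext (LinearMap.ext fun x ↦ Subtype.ext
        (congrArg (fun g ↦ g.hom x.1) (D.shape i j hij)))
      d_comp_d' := fun i j k _ _ ↦ FGModuleCat.hom_ext (LinearMap.ext fun x ↦ Subtype.ext
        (congrArg (fun g ↦ g.hom x.1) (D.d_comp_d i j k))) }
  let f : ((forget₂ (FGModuleCat.{u} R) (ModuleCat.{u} R)).mapHomologicalComplex _).obj E ⟶ D :=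
    { f := fun n ↦ ModuleCat.ofHom (N n).subtype
      comm' := fun i j _ ↦ rfl }
  refine ⟨E, f, (CochainComplex.isStrictlyLE_iff _ b).2 fun n hn ↦ ?_, ?_⟩
  · rw [IsZero.iff_id_eq_zero]
    exact FGModuleCat.hom_ext (LinearMap.ext fun x ↦
      Subtype.ext ((Submodule.mem_bot R).1 (hb n hn ▸ x.2)))
  · rw [quasiIso_iff_elementwise]
    refine fun n ↦ ⟨fun (x : N n) hx ⟨y, hy⟩ ↦ ?_, fun y hy ↦ ?_⟩
    · obtain ⟨x', hx', e⟩ := IsHomologyStep.exists_d_eq h (sub_add_cancel n 1) (y := y)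
        (hy ▸ x.2)
      exact ⟨(⟨x', hx'⟩ : N (n - 1)), Subtype.ext (hy.trans e.symm)⟩
    · obtain ⟨x, hx, _, ⟨t, rfl⟩, e⟩ := Submodule.mem_sup.1 ((h n).ker_le hy)
      refine ⟨(⟨x, hx.1⟩ : N n), -t, Subtype.ext hx.2, ?_⟩
      rw [← e, map_neg, add_neg_cancel_right]
      rfl

theorem projective_fgModuleCat (M : FGModuleCat.{u} R) [hM : Module.Projective R M] :
    Projective M where
  factors {E X} f e _ := by
    let F := forget₂ (FGModuleCat.{u} R) (ModuleCat.{u} R)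
    have : Projective (F.obj M) := (IsProjective.iff_projective _).1 hM
    refine ⟨F.preimage (Projective.factorThru (F.map f) (F.map e)), F.map_injective ?_⟩
    rw [F.map_comp, F.map_preimage, Projective.factorThru_comp]

theorem exists_epi_fgModuleCat (M : FGModuleCat.{u} R) :
    ∃ (n : ℕ) (f : FGModuleCat.of R (Fin n → R) ⟶ M), Epi f := by
  obtain ⟨n, f, hf⟩ := Module.Finite.exists_fin' R M
  refine ⟨n, FGModuleCat.ofHom f, (forget₂ (FGModuleCat.{u} R) (ModuleCat.{u} R)).epi_of_epi_map ?_⟩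
  exact (ModuleCat.epi_iff_surjective _).2 hf

instance enoughProjectives_fgModuleCat : EnoughProjectives (FGModuleCat.{u} R) where
  presentation M := by
    obtain ⟨n, f, hf⟩ := exists_epi_fgModuleCat M
    exact ⟨{
      p := FGModuleCat.of R (Fin n → R)
      projective := projective_fgModuleCat
        (hM := inferInstanceAs (Module.Projective R (Fin n → R))) _
      f := f
      epi := hf }⟩

theorem moduleProjective_of_projective (M : FGModuleCat.{u} R) [Projective M] :
    Module.Projective R M := by
  obtain ⟨n, f, _⟩ := exists_epi_fgModuleCat M
  refine Module.Projective.of_split (Projective.factorThru (𝟙 M) f).hom.hom f.hom.hom ?_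
  rw [← FGModuleCat.hom_hom_comp, Projective.factorThru_comp, FGModuleCat.hom_hom_id]

theorem exists_isFinProjective (D : CochainComplex (ModuleCat.{u} R) ℤ)
    (hD : ∀ n, Module.Finite R (D.homology n)) (hD' : HomologicallyBounded D) :
    ∃ (P : CochainComplex (ModuleCat.{u} R) ℤ) (f : P ⟶ D), QuasiIso f ∧ IsFinProjective P := by
  obtain ⟨_, b, _, _⟩ := hD'
  obtain ⟨E, f, _, _⟩ := exists_quasiIso_fg D hD b
  obtain ⟨P, g, _, hP, hP'⟩ := exists_projective E b
  let F := forget₂ (FGModuleCat.{u} R) (ModuleCat.{u} R)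
  refine ⟨(F.mapHomologicalComplex _).obj P, (F.mapHomologicalComplex _).map g ≫ f,
    inferInstance, fun n ↦ (P.X n).property, fun n ↦ moduleProjective_of_projective (P.X n), b, ?_⟩
  exact (CochainComplex.isStrictlyLE_iff _ b).2 fun n hn ↦
    F.map_isZero (P.isZero_of_isStrictlyLE b n hn)

end FinProjective


/-! ### Independence of the resolution -/

section Independence

variable {R : Type u} [CommRing R]

theorem auslanderFor_iff_of_homotopyEquiv {P P' : CochainComplex (ModuleCat.{u} R) ℤ}
    [P.IsKProjective] [P'.IsKProjective] (e : HomotopyEquiv P P')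
    {X : CochainComplex (ModuleCat.{u} R) ℤ} : AuslanderFor P X ↔ AuslanderFor P' X :=
  ⟨fun h ↦ (h.foxbyPair.of_homotopyEquiv e.symm).auslanderFor,
    fun h ↦ (h.foxbyPair.of_homotopyEquiv e).auslanderFor⟩

theorem bassFor_iff_of_homotopyEquiv {P P' : CochainComplex (ModuleCat.{u} R) ℤ}
    [P.IsKProjective] [P'.IsKProjective] (e : HomotopyEquiv P P')
    {X : CochainComplex (ModuleCat.{u} R) ℤ} : BassFor P X ↔ BassFor P' X :=
  ⟨fun h ↦ (h.foxbyPair.of_homotopyEquiv e.symm).bassFor,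
    fun h ↦ (h.foxbyPair.of_homotopyEquiv e).bassFor⟩

theorem ProjRes.isKProjective {C : Type*} [Category* C] [Abelian C] {K : CochainComplex C ℤ}
    (r : ProjRes K) : r.P.IsKProjective := by
  obtain ⟨b, _⟩ := r.bounded
  have := r.projective
  exact CochainComplex.isKProjective_of_projective r.P b

theorem InjRes.isKInjective {C : Type*} [Category* C] [Abelian C] {K : CochainComplex C ℤ}
    (r : InjRes K) : r.J.IsKInjective := by
  obtain ⟨a, _⟩ := r.bounded
  have := r.injective
  exact CochainComplex.isKInjective_of_injective r.J a

/-- The Auslander and Bass classes of `D` can be computed with finitely generated projectives. -/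
theorem exists_isFinProjective_classes [IsNoetherianRing R]
    (D : CochainComplex (ModuleCat.{u} R) ℤ) (hD : HomologicallyBounded D)
    (hD' : ∀ n, Module.Finite R (D.homology n)) :
    ∃ P : CochainComplex (ModuleCat.{u} R) ℤ, IsFinProjective P ∧
      (∀ X, AuslanderClass D hD X ↔ AuslanderFor P X) ∧
      ∀ X, BassClass D hD X ↔ BassFor P X := by
  obtain ⟨P, f, _, hP⟩ := exists_isFinProjective D hD' hD
  have := hP.isKProjective
  have := (projRes D hD).isKProjective
  have := (projRes D hD).quasiIso
  obtain ⟨g, hg⟩ := exists_quasiIso_lift (projRes D hD).π f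
  obtain ⟨e⟩ : Nonempty (HomotopyEquiv (projRes D hD).P P) := by
    obtain ⟨e, _⟩ := (CochainComplex.IsKProjective.quasiIso_iff g).1 hg
    exact ⟨e⟩
  refine ⟨P, hP, fun X ↦ ?_, fun X ↦ ?_⟩
  · rw [← auslanderFor_iff_of_homotopyEquiv e]
    exact ⟨fun h ↦ ⟨h.1, h.2, h.3⟩, fun h ↦ ⟨h.1, h.2, h.3⟩⟩
  · rw [← bassFor_iff_of_homotopyEquiv e]
    exact ⟨fun h ↦ ⟨h.1, h.2, h.3⟩, fun h ↦ ⟨h.1, h.2, h.3⟩⟩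

theorem HasFiniteInjDim.isFinInjective {I : CochainComplex (ModuleCat.{u} R) ℤ}
    (hI : HasFiniteInjDim I) : IsFinInjective (injRes I hI.homologicallyBounded).J := by
  obtain ⟨U, h, hU, hU'⟩ := hI.exists_equivalent
  have := hU.isKInjective hU'
  have := (injRes I hI.homologicallyBounded).isKInjective
  have := (injRes I hI.homologicallyBounded).quasiIso
  exact ⟨U, hU, hU', ((Equivalent.of_quasiIso
    (injRes I hI.homologicallyBounded).ι).symm.trans h).nonempty_homotopyEquiv⟩

theorem HasFiniteFlatDim.isFinInjective {F : CochainComplex (ModuleCat.{u} R) ℤ}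
    (hF : HasFiniteFlatDim F) :
    IsFinInjective (homComplex (projRes F hF.homologicallyBounded).P (charComplex R)) := by
  obtain ⟨V, h, hV, hV'⟩ := hF.exists_equivalent
  have := (projRes F hF.homologicallyBounded).isKProjective
  have := (projRes F hF.homologicallyBounded).quasiIso
  obtain ⟨f, _⟩ := ((Equivalent.of_quasiIso
    (projRes F hF.homologicallyBounded).π).trans h).exists_quasiIso
  refine .homComplex_charComplex f (fun n ↦ ?_) (projRes F hF.homologicallyBounded).bounded hV' hV
  have : Module.Projective R ((projRes F hF.homologicallyBounded).P.X n) :=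
    (IsProjective.iff_projective _).2 ((projRes F hF.homologicallyBounded).projective n)
  infer_instance

end Independence

end

end FoxbyClasses

theorem proposition2p1 {Q : Type v} {R S : Type u} [CommRing Q] [CommRing R] [CommRing S]
    [Algebra Q R] [Algebra Q S] [IsNoetherianRing R] [IsLocalRing R] [IsNoetherianRing S]
    (D : CochainComplex (ModuleCat.{u} R) ℤ) (hD : FoxbyClasses.IsDualizingComplex D)
    (X Y : CochainComplex (ModuleCat.{u} (R ⊗[Q] S)) ℤ)
    (hX : FoxbyClasses.HomologicallyBounded X) (hY : FoxbyClasses.HomologicallyBounded Y)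
    (F I : CochainComplex (ModuleCat.{u} S) ℤ)
    (hF : FoxbyClasses.HasFiniteFlatDim F) (hI : FoxbyClasses.HasFiniteInjDim I) :
    (FoxbyClasses.AuslanderClass D hD.finiteInjDim.homologicallyBounded
        (FoxbyClasses.leftComplex Q R S X) →
      FoxbyClasses.BassClass D hD.finiteInjDim.homologicallyBounded
          (FoxbyClasses.bimodRHom X I hI.homologicallyBounded) ∧
        FoxbyClasses.AuslanderClass D hD.finiteInjDim.homologicallyBounded
          (FoxbyClasses.bimodLTensor X F hF.homologicallyBounded)) ∧
    (FoxbyClasses.BassClass D hD.finiteInjDim.homologicallyBounded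
        (FoxbyClasses.leftComplex Q R S Y) →
      FoxbyClasses.AuslanderClass D hD.finiteInjDim.homologicallyBounded
          (FoxbyClasses.bimodRHom Y I hI.homologicallyBounded) ∧
        FoxbyClasses.BassClass D hD.finiteInjDim.homologicallyBounded
          (FoxbyClasses.bimodLTensor Y F hF.homologicallyBounded)) := by
  obtain ⟨P, hP, hA, hB⟩ := FoxbyClasses.exists_isFinProjective_classes D
    hD.finiteInjDim.homologicallyBounded hD.finite_homology
  simp only [hA, hB]
  exact ⟨fun h ↦ ⟨h.bassFor_bimodHomComplex hP hI.isFinInjective,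
      h.bimodTensorComplex hP hF.isFinInjective⟩,
    fun h ↦ ⟨h.auslanderFor_bimodHomComplex hP hI.isFinInjective,
      h.bimodTensorComplex hP hF.isFinInjective⟩⟩
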